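/- **Setting.** Let $\mathcal C$ be a *partially traced category*: a symmetric monoidal category $(\mathcal C,\otimes,I,\sigma)$ with partial functions $\mathrm{Tr}^U_{A,B}:\mathcal C(A\otimes U,B\otimes U)\rightharpoonup\mathcal C(A,B)$ satisfying the following axioms, written as if $\mathcal C$ were strict (in general the associators and unitors are inserted). Here $x\simeq y$ means that $x,y$ are both undefined or both defined and equal, and $x\lesssim y$ means that if $x$ is defined then $y$ is defined and $x=y$. * Naturality: $h\circ\mathrm{Tr}^U(f)\circ g\lesssim\mathrm{Tr}^U((h\otimes 1_U)\circ f\circ(g\otimes 1_U))$ for $f:A\otimes U\to B\otimes U$, $g:A'\to A$, $h:B\to B'$. * Dinaturality: $\mathrm{Tr}^U((1_B\otimes g)\circ f)\simeq\mathrm{Tr}^{U'}(f\circ(1_A\otimes g))$ for $f:A\otimes U\to B\otimes U'$, $g:U'\to U$. * Strength: $g\otimes\mathrm{Tr}^U(f)\lesssim\mathrm{Tr}^U(g\otimes f)$. * Vanishing I: $\mathrm{Tr}^I(f)\simeq f$. * Vanishing II: for $f:A\otimes U\otimes V\to B\otimes U\otimes V$, if $\mathrm{Tr}^V(f)$ is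 defined, then $\mathrm{Tr}^U(\mathrm{Tr}^V(f))\simeq\mathrm{Tr}^{U\otimes V}(f)$. * Yanking: $\mathrm{Tr}^A(\sigma_{A,A})\simeq 1_A$. *The graph $\mathrm{Int}^p(\mathcal C)$.* Its objects are pairs $(A^+,A^-)$ of objects of $\mathcal C$, and its arrows $(A^+,A^-)\to(B^+,B^-)$ are the morphisms $A^+\otimes B^-\to B^+\otimes A^-$ of $\mathcal C$. For a path $\vec p=p_1,\dots,p_n$ with $p_i:(A_{i-1}^+,A_{i-1}^-)\to(A_i^+,A_i^-)$, put $V=A_0^-\otimes\cdots\otimes A_{n-1}^-$ and define $\langle\vec p\,\rangle:A_0^+\otimes V\otimes A_n^-\to A_n^+\otimes A_0^-\otimes V$ by recursion: $\langle\ \rangle=1_{A_0^+\otimes A_0^-}$, and $\langle\vec p,f\rangle$ applies $\langle\vec p\,\rangle$ to the factors $A_0^+,V,A_n^-$, then $f$ to the factors $A_n^+,A_{n+1}^-$, and then moves the output $A_n^-$ of $f$ to the last place by symmetries. The partial composition is $[\vec p\,]:\simeq\mathrm{Tr}^{V}\big(\langle\vec p\,\rangle\circ(1_{A_0^+}\otimes\sigma_{A_n^-,V})\big)$.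 The tensor product is $(A^+,A^-)\otimes(B^+,B^-)=(A^+\otimes B^+,B^-\otimes A^-)$ on objects, and places two arrows side by side (up to symmetries of $\mathcal C$) on arrows; the unit is $(I,I)$, and $1_{(A^+,A^-)}$ is the identity of $A^+\otimes A^-$ in $\mathcal C$. *The category $\mathrm{Path}(\mathrm{Int}^p(\mathcal C))/{\sim}$.* Let $\sim$ be the smallest family of equivalence relations on parallel paths of $\mathrm{Int}^p(\mathcal C)$ that is stable under concatenation, stable under $1\otimes(-)$ and $(-)\otimes 1$ applied arrow by arrow, and satisfies $\vec p\sim[\vec p\,]$ whenever $[\vec p\,]$ is defined. The category $\mathrm{Path}(\mathrm{Int}^p(\mathcal C))/{\sim}$ has the objects of $\mathrm{Int}^p(\mathcal C)$, classes of paths as morphisms, and concatenation as composition. It is symmetric monoidal with the tensor product above on objects, $\vec f\otimes\vec g=(\vec f\otimes 1),(1\otimes\vec g)$ on morphisms, and the symmetry of $(A^+,A^-)$ and $(B^+,B^-)$ given by $\sigma_{A^+,B^+}\otimes\sigma_{A^-,B^-}$. *The maps $N$ and $F$.* $N:\mathcal C\to\mathrm{Int}^p(\mathcal C)$ is given by $N(A)=(A,I)$,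 $N(f)=f\otimes 1_I$, and $F:\mathrm{Int}^p(\mathcal C)\to\mathrm{Path}(\mathrm{Int}^p(\mathcal C))/{\sim}$ is the identity on objects and sends an arrow to the class of the corresponding path of length one. The composite $F\circ N$ is a strong symmetric monoidal functor. **Theorem.** Let $\mathcal C$ be a partially traced category and let $\mathcal D$ be a compact closed category, with its canonical trace $$\mathrm{Tr}^U(f)=\big(A\xrightarrow{1\otimes\eta}A\otimes U^*\otimes U\xrightarrow{1\otimes\sigma}A\otimes U\otimes U^*\xrightarrow{f\otimes 1}B\otimes U\otimes U^*\xrightarrow{1\otimes\varepsilon}B\big).$$ Let $(G,m):\mathcal C\to\mathcal D$ be a traced symmetric monoidal functor, i.e. a strong symmetric monoidal functor such that, for every $f:A\otimes U\to B\otimes U$ for which $\mathrm{Tr}^U(f)$ is defined, $\mathrm{Tr}^{GU}(m_{B,U}^{-1}\circ G(f)\circ m_{A,U})=G(\mathrm{Tr}^U(f))$. Then there is an essentially unique strong symmetric monoidal functor $L:\mathrm{Path}(\mathrm{Int}^p(\mathcal C))/{\sim}\to\mathcal D$ with $L\circ F\circ N\cong G$. Precisely: 1. there are a strong symmetric monoidal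 functor $L$ and a monoidal natural isomorphism $\varphi:L\circ F\circ N\Rightarrow G$; 2. for any two such pairs $(L,\varphi)$ and $(L',\varphi')$ there is exactly one monoidal natural isomorphism $\theta:L\Rightarrow L'$ with $\varphi'\circ(\theta FN)=\varphi$. -/

import Mathlib

open CategoryTheory MonoidalCategory

universe v₁ u₁ v₂ u₂ v u


namespace PartialTrace

variable {C : Type u} [Category.{v} C] [MonoidalCategory C] [SymmetricCategory C]

/-- The canonical symmetry `X ⊗ Y ⊗ Z ⟶ X ⊗ Z ⊗ Y` exchanging the last two factors of a product
bracketed to the left. -/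
def sw (X Y Z : C) : (X ⊗ Y) ⊗ Z ⟶ (X ⊗ Z) ⊗ Y :=
  (α_ X Y Z).hom ≫ X ◁ (β_ Y Z).hom ≫ (α_ X Z Y).inv

lemma sw_sw (X Y Z : C) : sw X Y Z ≫ sw X Z Y = 𝟙 _ := by
  simp [sw, ← MonoidalCategory.whiskerLeft_comp_assoc]

lemma sw_nat_head {X X' : C} (f : X ⟶ X') (Y Z : C) :
    (f ▷ Y) ▷ Z ≫ sw X' Y Z = sw X Y Z ≫ (f ▷ Z) ▷ Y := by
  simp only [sw, associator_naturality_left_assoc, Category.assoc, ← associator_inv_naturality_left]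
  rw [whisker_exchange_assoc]

lemma sw_nat_mid (X : C) {Y Y' : C} (f : Y ⟶ Y') (Z : C) :
    (X ◁ f) ▷ Z ≫ sw X Y' Z = sw X Y Z ≫ (X ⊗ Z) ◁ f := by
  simp only [sw, associator_naturality_middle_assoc, Category.assoc,
    ← associator_inv_naturality_right, ← MonoidalCategory.whiskerLeft_comp_assoc,
    BraidedCategory.braiding_naturality_left]

lemma sw_nat_last (X Y : C) {Z Z' : C} (f : Z ⟶ Z') :
    (X ⊗ Y) ◁ f ≫ sw X Y Z' = sw X Y Z ≫ (X ◁ f) ▷ Y := by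
  simp only [sw, associator_naturality_right_assoc, Category.assoc,
    ← associator_inv_naturality_middle, ← MonoidalCategory.whiskerLeft_comp_assoc,
    BraidedCategory.braiding_naturality_right]

lemma sw_tensor_mid (X Y Z W : C) :
    (α_ X Y Z).inv ▷ W ≫ sw (X ⊗ Y) Z W ≫ sw X Y W ▷ Z = sw X (Y ⊗ Z) W ≫ (α_ _ _ _).inv := by
  simp [sw]

lemma sw_tensor_last (X Y Z W : C) :
    (α_ (X ⊗ Y) Z W).inv ≫ sw X Y Z ▷ W ≫ sw (X ⊗ Z) Y W = sw X Y (Z ⊗ W) ≫ (α_ _ _ _).inv ▷ Y := by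
  simp [sw]

lemma sw_tensor_head (X Y Z W : C) :
    sw (X ⊗ Y) Z W = (α_ X Y Z).hom ▷ W ≫ (α_ X (Y ⊗ Z) W).hom ≫ X ◁ sw Y Z W ≫
      (α_ X (Y ⊗ W) Z).inv ≫ (α_ X Y W).inv ▷ Z := by
  simp [sw]

lemma sw_unit_mid (X Y : C) : sw X (𝟙_ C) Y = (ρ_ X).hom ▷ Y ≫ (ρ_ _).inv := by
  simp [sw]

lemma sw_unit_last (X Y : C) : sw X Y (𝟙_ C) = (ρ_ _).hom ≫ (ρ_ X).inv ▷ Y := by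
  simp [sw]

lemma sw_eq_braid (X Y Z : C) : X ◁ (β_ Y Z).hom = (α_ _ _ _).inv ≫ sw X Y Z ≫ (α_ _ _ _).hom := by
  simp [sw]

/-- The braid relation. -/
lemma sw_braid (X Y Z W : C) :
    sw X Y Z ▷ W ≫ sw (X ⊗ Z) Y W ≫ sw X Z W ▷ Y =
      sw (X ⊗ Y) Z W ≫ sw X Y W ▷ Z ≫ sw (X ⊗ W) Y Z := by
  have h1 := sw_tensor_last X Y Z W
  have h2 := sw_tensor_last X Y W Z
  have h3 := sw_nat_last X Y (β_ Z W).hom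
  simp only [comp_whiskerRight, Category.assoc, sw_eq_braid] at h3
  rw [← reassoc_of% h1, cancel_epi] at h3
  rw [← cancel_mono ((α_ X W Z).hom ▷ Y)]
  simp only [Category.assoc]
  rw [← h3, ← cancel_mono ((α_ X W Z).inv ▷ Y)]
  simp [← h2]

lemma sw_sw_w (X Y Z V : C) {W : C} (h : ((X ⊗ Y) ⊗ Z) ⊗ V ⟶ W) :
    sw X Y Z ▷ V ≫ sw X Z Y ▷ V ≫ h = h := by
  rw [← comp_whiskerRight_assoc, sw_sw, id_whiskerRight, Category.id_comp]

lemma sw_braid_w (X Y Z W V : C) {T : C} (h : (((X ⊗ W) ⊗ Z) ⊗ Y) ⊗ V ⟶ T) :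
    sw X Y Z ▷ W ▷ V ≫ sw (X ⊗ Z) Y W ▷ V ≫ sw X Z W ▷ Y ▷ V ≫ h =
      sw (X ⊗ Y) Z W ▷ V ≫ sw X Y W ▷ Z ▷ V ≫ sw (X ⊗ W) Y Z ▷ V ≫ h := by
  simpa only [comp_whiskerRight, Category.assoc] using
    congrArg (fun t => t ▷ V ≫ h) (sw_braid X Y Z W)

lemma sw_nat_head_w {X X' : C} (f : X ⟶ X') (Y Z V : C) {T : C} (h : ((X' ⊗ Z) ⊗ Y) ⊗ V ⟶ T) :
    f ▷ Y ▷ Z ▷ V ≫ sw X' Y Z ▷ V ≫ h = sw X Y Z ▷ V ≫ f ▷ Z ▷ Y ▷ V ≫ h := by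
  simpa only [comp_whiskerRight, Category.assoc] using
    congrArg (fun t => t ▷ V ≫ h) (sw_nat_head f Y Z)

lemma hom_inv_ww {X Y : C} (e : X ≅ Y) (V W : C) {T : C} (h : (X ⊗ V) ⊗ W ⟶ T) :
    e.hom ▷ V ▷ W ≫ e.inv ▷ V ▷ W ≫ h = h := by
  rw [← comp_whiskerRight_assoc, ← comp_whiskerRight]; simp

lemma inv_hom_ww {X Y : C} (e : X ≅ Y) (V W : C) {T : C} (h : (Y ⊗ V) ⊗ W ⟶ T) :
    e.inv ▷ V ▷ W ≫ e.hom ▷ V ▷ W ≫ h = h := hom_inv_ww e.symm V W h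

/-- A partial trace on a symmetric monoidal category. A value `tr U f : Part (A ⟶ B)` may be
undefined. Equality of elements of `Part` is Kleene equality (both sides undefined, or both defined
and equal), and `x ≤ y` in `Part` is directed Kleene equality (if `x` is defined, then `y` is
defined and equal to `x`). -/
class PartiallyTraced (C : Type u) [Category.{v} C] [MonoidalCategory C] [SymmetricCategory C] where
  tr {A B : C} (U : C) (f : A ⊗ U ⟶ B ⊗ U) : Part (A ⟶ B)
  naturality {A B A' B' U : C} (f : A ⊗ U ⟶ B ⊗ U) (g : A' ⟶ A) (h : B ⟶ B') :
    (tr U f).map (fun t => g ≫ t ≫ h) ≤ tr U (g ▷ U ≫ f ≫ h ▷ U)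
  dinaturality {A B U U' : C} (f : A ⊗ U ⟶ B ⊗ U') (g : U' ⟶ U) :
    tr U (f ≫ B ◁ g) = tr U' (A ◁ g ≫ f)
  strength {A B X Y U : C} (f : A ⊗ U ⟶ B ⊗ U) (g : X ⟶ Y) :
    (tr U f).map (fun t => g ⊗ₘ t) ≤ tr U ((α_ X A U).hom ≫ (g ⊗ₘ f) ≫ (α_ Y B U).inv)
  vanishing_one {A B : C} (f : A ⊗ 𝟙_ C ⟶ B ⊗ 𝟙_ C) :
    tr (𝟙_ C) f = Part.some ((ρ_ A).inv ≫ f ≫ (ρ_ B).hom)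
  vanishing_two {A B U V : C} (f : (A ⊗ U) ⊗ V ⟶ (B ⊗ U) ⊗ V) :
    (tr V f).Dom → (tr V f).bind (tr U) = tr (U ⊗ V) ((α_ A U V).inv ≫ f ≫ (α_ B U V).hom)
  yanking (A : C) : tr A (β_ A A).hom = Part.some (𝟙 A)

open PartiallyTraced

lemma tr_yank [PartiallyTraced C] {P Q R U : C} (h : P ⟶ R ⊗ U) (k : R ⊗ U ⟶ Q) :
    tr U (h ▷ U ≫ sw R U U ≫ k ▷ U) = Part.some (h ≫ k) := by
  rw [Part.eq_some_iff]
  have h1 : 𝟙 U ∈ tr U (β_ U U).hom := by rw [yanking]; exact Part.mem_some _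
  have h2 := strength (β_ U U).hom (𝟙 R) _ (Part.mem_map _ h1)
  have h3 := naturality _ h k _ (Part.mem_map _ h2)
  simpa [sw] using h3

lemma tr_two [PartiallyTraced C] {A B U V : C} (f : (A ⊗ U) ⊗ V ⟶ (B ⊗ U) ⊗ V) {t : A ⊗ U ⟶ B ⊗ U}
    (h : tr V f = Part.some t) :
    tr (U ⊗ V) ((α_ A U V).inv ≫ f ≫ (α_ B U V).hom) = tr U t := by
  rw [← vanishing_two f (by simp [h]), h, Part.bind_some]

lemma tr_conj [PartiallyTraced C] {A B U V : C} (e : U ≅ V) (f : A ⊗ U ⟶ B ⊗ U) :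
    tr U f = tr V (A ◁ e.inv ≫ f ≫ B ◁ e.hom) := by
  rw [← dinaturality]
  simp [← MonoidalCategory.whiskerLeft_comp]

variable (C) in
/-- The objects of the graph `Intᵖ(C)`: pairs `(A⁺, A⁻)` of objects of `C`. -/
structure IntP where
  /-- the component `A⁺` -/
  pos : C
  /-- the component `A⁻` -/
  neg : C

namespace IntP

/-- The arrows of the graph `Intᵖ(C)`. -/
@[ext]
structure Hom (A B : IntP C) where
  /-- the underlying morphism of `C` -/
  hom : A.pos ⊗ B.neg ⟶ B.pos ⊗ A.neg

instance : Quiver (IntP C) where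
  Hom A B := Hom A B

/-- For a path `(A₀⁺, A₀⁻) → ⋯ → (Aₙ⁺, Aₙ⁻)`, the object `A₀⁻ ⊗ ⋯ ⊗ Aₙ₋₁⁻`
(bracketed to the left, with a leading unit) over which one traces. -/
def loop {A : IntP C} : {B : IntP C} → Quiver.Path A B → C
  | _, .nil => 𝟙_ C
  | _, @Quiver.Path.cons _ _ _ B _ p _ => loop p ⊗ B.neg

/-- Precomposition: for a path `p₁, …, pₙ` from `(A₀⁺, A₀⁻)` to `(Aₙ⁺, Aₙ⁻)` with
`V = A₀⁻ ⊗ ⋯ ⊗ Aₙ₋₁⁻`, a morphism `A₀⁺ ⊗ V ⊗ Aₙ⁻ ⟶ Aₙ⁺ ⊗ A₀⁻ ⊗ V`. For the empty path it is the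
identity of `A₀⁺ ⊗ A₀⁻` (up to the unit `V`). For a path `p` followed by `f` one runs `pre p` on
`A₀⁺ ⊗ V ⊗ Aₙ⁻`, then `f` on the factors `Aₙ⁺` and `Aₙ₊₁⁻`, and moves the output `Aₙ⁻` of `f` to
the last place. -/
def pre {A : IntP C} : {B : IntP C} → (p : Quiver.Path A B) →
    ((A.pos ⊗ loop p) ⊗ B.neg ⟶ (B.pos ⊗ A.neg) ⊗ loop p)
  | _, .nil => (ρ_ A.pos).hom ▷ A.neg ≫ (ρ_ (A.pos ⊗ A.neg)).inv
  | B', @Quiver.Path.cons _ _ _ B _ p f =>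
      (α_ A.pos (loop p) B.neg).inv ▷ B'.neg ≫ pre p ▷ B'.neg ≫
        sw (B.pos ⊗ A.neg) (loop p) B'.neg ≫ sw B.pos A.neg B'.neg ▷ loop p ≫
        (f.hom ▷ A.neg) ▷ loop p ≫
        sw B'.pos B.neg A.neg ▷ loop p ≫ sw (B'.pos ⊗ A.neg) B.neg (loop p) ≫
        (α_ (B'.pos ⊗ A.neg) (loop p) B.neg).hom

variable [PartiallyTraced C]

/-- The partial composition of a path: a single trace over `loop p`. -/
def comp {A B : IntP C} (p : Quiver.Path A B) : Part (A ⟶ B) :=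
  (tr (loop p) (sw A.pos B.neg (loop p) ≫ pre p)).map Hom.mk

lemma pre_one {X Y : IntP C} (f : X ⟶ Y) :
    pre f.toPath = (X.pos ◁ (λ_ X.neg).hom) ▷ Y.neg ≫ sw X.pos X.neg Y.neg ≫ f.hom ▷ X.neg ≫
      sw Y.pos X.neg X.neg ≫ (Y.pos ⊗ X.neg) ◁ (λ_ X.neg).inv := by
  simp only [pre, loop, Quiver.Hom.toPath, sw_unit_mid, sw_unit_last]
  simp
  monoidal

lemma comp_two_aux {X Y Z Y' Z' T x : C} (f : X ⊗ Y ⟶ Y' ⊗ x) (g : Y' ⊗ Z ⟶ Z' ⊗ T) :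
    sw (X ⊗ Z) Y x ≫ sw X Z x ▷ Y ≫ sw (X ⊗ x) Z Y ≫ sw X x Y ▷ Z ≫ f ▷ x ▷ Z ≫
      sw Y' x x ▷ Z ≫ sw (Y' ⊗ x) x Z ≫ sw Y' x Z ▷ x ≫ g ▷ x ▷ x =
    sw X Z Y ▷ x ≫ f ▷ Z ▷ x ≫ sw Y' x Z ▷ x ≫ g ▷ x ▷ x ≫ sw (Z' ⊗ T) x x := by
  rw [sw_nat_head g, reassoc_of% sw_braid Y' x x Z, reassoc_of% sw_nat_head f,
    ← reassoc_of% sw_braid X Z Y x]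
  simp only [← comp_whiskerRight_assoc, sw_sw, id_whiskerRight, Category.id_comp,
    reassoc_of% sw_sw]

lemma comp_two {X Y Z : IntP C} (f : X ⟶ Y) (g : Y ⟶ Z) :
    comp (f.toPath.cons g) = (tr Y.neg (sw X.pos Z.neg Y.neg ≫ f.hom ▷ Z.neg ≫
      sw Y.pos X.neg Z.neg ≫ g.hom ▷ X.neg ≫ sw Z.pos Y.neg X.neg)).map Hom.mk := by
  let e : loop (f.toPath.cons g) ≅ Y.neg ⊗ X.neg :=
    (whiskerRightIso (λ_ X.neg) Y.neg) ≪≫ (β_ Y.neg X.neg).symm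
  have h1 := tr_yank (U := X.neg) (sw X.pos Z.neg Y.neg ≫ f.hom ▷ Z.neg ≫
      sw Y.pos X.neg Z.neg ≫ g.hom ▷ X.neg) (sw Z.pos Y.neg X.neg)
  have h2 := tr_two _ h1
  simp only [Category.assoc] at h2
  rw [← h2, comp, tr_conj e]
  congr 2
  have h3 := comp_two_aux f.hom g.hom
  have h4 : sw (X.pos ⊗ Z.neg) Y.neg X.neg ≫ sw X.pos Z.neg X.neg ▷ Y.neg ≫ sw (X.pos ⊗ X.neg) Z.neg Y.neg =
    (α_ _ _ _).hom ≫ _ ◁ (β_ _ _).hom ≫ sw X.pos Z.neg (X.neg ⊗ Y.neg) ≫ (α_ _ _ _).inv ▷ _ := by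
    rw [← sw_tensor_last, sw_eq_braid]; simp
  have e1 : e.inv = (β_ _ _).hom ≫ (λ_ X.neg).inv ▷ Y.neg := rfl
  have e2 : e.hom = (λ_ X.neg).hom ▷ Y.neg ≫ (β_ _ _).hom := by
    rw [SymmetricCategory.braiding_swap_eq_inv_braiding]; rfl
  rw [pre, pre_one, e1, e2]
  simp only [loop, Quiver.Hom.toPath, MonoidalCategory.whiskerLeft_comp, Category.assoc,
    comp_whiskerRight]
  rw [reassoc_of% sw_nat_last X.pos Z.neg ((λ_ X.neg).inv ▷ Y.neg)]
  have h5 : (X.pos ◁ (λ_ X.neg).inv ▷ Y.neg) ▷ Z.neg ≫ (α_ X.pos (𝟙_ C ⊗ X.neg) Y.neg).inv ▷ Z.neg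
      ≫ (X.pos ◁ (λ_ X.neg).hom) ▷ Y.neg ▷ Z.neg = (α_ _ _ _).inv ▷ Z.neg := by
    simp only [← comp_whiskerRight]
    simp
  rw [reassoc_of% h5, reassoc_of% sw_nat_mid (Y.pos ⊗ X.neg) (λ_ X.neg).inv Z.neg]
  simp only [reassoc_of% whisker_exchange]
  rw [reassoc_of% sw_nat_last (Z.pos ⊗ X.neg) Y.neg (λ_ X.neg).inv]
  have h6 : ((Z.pos ⊗ X.neg) ◁ (λ_ X.neg).inv) ▷ Y.neg ≫
      (α_ (Z.pos ⊗ X.neg) (𝟙_ C ⊗ X.neg) Y.neg).hom ≫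
      (Z.pos ⊗ X.neg) ◁ (λ_ X.neg).hom ▷ Y.neg = (α_ _ _ _).hom := by
    rw [← associator_naturality_middle]; simp
  have h7 : (α_ (Z.pos ⊗ X.neg) X.neg Y.neg).hom ≫ (Z.pos ⊗ X.neg) ◁ (β_ X.neg Y.neg).hom =
      sw (Z.pos ⊗ X.neg) X.neg Y.neg ≫ (α_ _ _ _).hom := by simp [sw]
  rw [reassoc_of% h6, h7, reassoc_of% sw_sw]
  rw [← cancel_epi (α_ _ _ _).hom, ← reassoc_of% h4, Iso.hom_inv_id_assoc, reassoc_of% h3]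

/-- The arrow of `Intᵖ(C)` given by a pair of morphisms `u : A⁺ ⟶ B⁺` and `v : B⁻ ⟶ A⁻`. -/
def pair {A B : IntP C} (u : A.pos ⟶ B.pos) (v : B.neg ⟶ A.neg) : A ⟶ B := ⟨u ⊗ₘ v⟩

lemma comp_pair {X A B : IntP C} (f : X ⟶ A) (u : A.pos ⟶ B.pos) (v : B.neg ⟶ A.neg) :
    comp (f.toPath.cons (pair u v)) = Part.some ⟨X.pos ◁ v ≫ f.hom ≫ u ▷ X.neg⟩ := by
  have h := tr_yank (X.pos ◁ v) (f.hom ≫ u ▷ X.neg)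
  rw [comp_two, ← Part.map_some, ← h]
  congr 2
  simp only [pair, MonoidalCategory.tensorHom_def, comp_whiskerRight, Category.assoc, sw_nat_mid]
  rw [reassoc_of% sw_nat_head u, reassoc_of% sw_sw, ← whisker_exchange, ← reassoc_of% whisker_exchange,
    ← reassoc_of% sw_nat_mid]

lemma pair_comp {X A B : IntP C} (u : X.pos ⟶ A.pos) (v : A.neg ⟶ X.neg) (f : A ⟶ B) :
    comp ((pair u v).toPath.cons f) = Part.some ⟨u ▷ B.neg ≫ f.hom ≫ B.pos ◁ v⟩ := by
  have h := tr_yank (u ▷ B.neg ≫ f.hom) (B.pos ◁ v)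
  rw [← Category.assoc, comp_two, ← Part.map_some, ← h]
  congr 2
  simp only [pair, MonoidalCategory.tensorHom_def, comp_whiskerRight, Category.assoc]
  rw [reassoc_of% sw_nat_mid A.pos v B.neg, ← reassoc_of% sw_nat_head u, reassoc_of% sw_sw,
    reassoc_of% whisker_exchange, sw_nat_last]

lemma sw_block (Z y w q z : C) : sw Z (y ⊗ w) (q ⊗ z) =
    (α_ (Z ⊗ (y ⊗ w)) q z).inv ≫ (α_ Z y w).inv ▷ q ▷ z ≫ sw (Z ⊗ y) w q ▷ z ≫ sw Z y q ▷ w ▷ z ≫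
      sw ((Z ⊗ q) ⊗ y) w z ≫ sw (Z ⊗ q) y z ▷ w ≫ (α_ Z q z).hom ▷ y ▷ w ≫ (α_ _ _ _).hom := by
  simp [sw]
  monoidal

/-- Exchange of the last factors of the two blocks `y ⊗ w` and `q ⊗ z`. -/
def th (Z y w q z : C) : (Z ⊗ (y ⊗ w)) ⊗ (q ⊗ z) ⟶ (Z ⊗ (y ⊗ z)) ⊗ (q ⊗ w) :=
  (α_ (Z ⊗ (y ⊗ w)) q z).inv ≫ (α_ Z y w).inv ▷ q ▷ z ≫ sw (Z ⊗ y) w q ▷ z ≫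
    sw ((Z ⊗ y) ⊗ q) w z ≫ sw (Z ⊗ y) q z ▷ w ≫ (α_ Z y z).hom ▷ q ▷ w ≫ (α_ _ _ _).hom

lemma th_sw (Z y w q z : C) : th Z y w q z ≫ sw Z (y ⊗ z) (q ⊗ w) =
    (α_ (Z ⊗ (y ⊗ w)) q z).inv ≫ ((α_ Z y w).inv ≫ sw Z y w) ▷ q ▷ z ≫ sw (Z ⊗ w) y q ▷ z ≫
      (sw Z w q ≫ (α_ _ _ _).hom) ▷ y ▷ z ≫ (α_ _ _ _).hom := by
  simp only [th, sw_block, comp_whiskerRight, Category.assoc, Iso.hom_inv_id_assoc]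
  rw [hom_inv_ww, sw_sw_w, reassoc_of% sw_nat_head (sw Z y q) z w, reassoc_of% sw_sw,
    sw_braid_w]

/-- `f` acting on the outer factors `a` and `p` of `(a ⊗ b) ⊗ (y ⊗ p)`. -/
def outer {a p a' s : C} (f : a ⊗ p ⟶ a' ⊗ s) (b y : C) : (a ⊗ b) ⊗ (y ⊗ p) ⟶ (a' ⊗ b) ⊗ (y ⊗ s) :=
  (α_ (a ⊗ b) y p).inv ≫ sw (a ⊗ b) y p ≫ sw a b p ▷ y ≫ f ▷ b ▷ y ≫ sw a' s b ▷ y ≫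
    sw (a' ⊗ b) s y ≫ (α_ (a' ⊗ b) y s).hom

lemma outer_exchange {a p a' s : C} (f : a ⊗ p ⟶ a' ⊗ s) (b y q : C) :
    sw (a ⊗ b) (y ⊗ p) (q ⊗ p) ≫ outer f b q ▷ (y ⊗ p) ≫ sw (a' ⊗ b) (q ⊗ s) (y ⊗ p) =
      th (a ⊗ b) y p q p ≫ outer f b y ▷ (q ⊗ p) ≫ th (a' ⊗ b) y s q p := by
  simp only [sw_block, outer, th, comp_whiskerRight, Category.assoc, whiskerRight_tensor,
    Iso.hom_inv_id_assoc, Iso.inv_hom_id_assoc, hom_inv_ww, inv_hom_ww]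
  rw [reassoc_of% sw_nat_head (sw (a ⊗ b) y q) p p, sw_braid_w (a ⊗ b) y q p p,
    ← sw_nat_head_w (sw a b p) y q p, ← sw_nat_head_w (f ▷ b) y q p,
    ← sw_nat_head_w (sw a' s b) y q p, ← sw_braid_w (a' ⊗ b) s y q p,
    ← comp_whiskerRight_assoc (sw (a' ⊗ b) y q ▷ s) (sw (a' ⊗ b) q y ▷ s), ← comp_whiskerRight,
    sw_sw, id_whiskerRight, id_whiskerRight, Category.id_comp]

/-- `g` acting on the inner factors `b` and `y` of `(a ⊗ b) ⊗ (y ⊗ p)`. -/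
def inner {b y b' q : C} (g : b ⊗ y ⟶ b' ⊗ q) (a p : C) : (a ⊗ b) ⊗ (y ⊗ p) ⟶ (a ⊗ b') ⊗ (q ⊗ p) :=
  (α_ (a ⊗ b) y p).inv ≫ (α_ a b y).hom ▷ p ≫ (a ◁ g) ▷ p ≫ (α_ a b' q).inv ▷ p ≫
   (α_ (a ⊗ b') q p).hom

lemma th_inner {b y b' q' : C} (g : b ⊗ y ⟶ b' ⊗ q') (a s q p : C) :
    th (a ⊗ b) y s q p ≫ inner g a p ▷ (q ⊗ s) = inner g a s ▷ (q ⊗ p) ≫ th (a ⊗ b') q' s q p := by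
  simp only [inner, th, comp_whiskerRight, Category.assoc, whiskerRight_tensor,
    Iso.hom_inv_id_assoc, Iso.inv_hom_id_assoc, hom_inv_ww, inv_hom_ww]
  have n := fun {X X' : C} (k : X ⟶ X') => sw_nat_head (k ▷ q) s p
  rw [sw_nat_head_w (α_ a b' q').inv, reassoc_of% n, sw_nat_head_w (α_ a b' q').inv,
    sw_nat_head_w (a ◁ g), reassoc_of% n, sw_nat_head_w (a ◁ g),
    sw_nat_head_w (α_ a b y).hom, reassoc_of% n, sw_nat_head_w (α_ a b y).hom]

/-- The two morphisms side by side: `f` on the factors `a`, `p` and `g` on the factors `b`, `y`. -/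
def tensHom {a p a' s b y b' q : C} (f : a ⊗ p ⟶ a' ⊗ s) (g : b ⊗ y ⟶ b' ⊗ q) :
    (a ⊗ b) ⊗ (y ⊗ p) ⟶ (a' ⊗ b') ⊗ (q ⊗ s) :=
  (α_ (a ⊗ b) y p).inv ≫ (α_ a b y).hom ▷ p ≫ sw a (b ⊗ y) p ≫ (f ⊗ₘ g) ≫
    sw a' s (b' ⊗ q) ≫ (α_ a' b' q).inv ▷ s ≫ (α_ (a' ⊗ b') q s).hom

lemma outer_eq {a p a' s : C} (f : a ⊗ p ⟶ a' ⊗ s) (b y : C) : outer f b y =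
    (α_ (a ⊗ b) y p).inv ≫ (α_ a b y).hom ▷ p ≫ sw a (b ⊗ y) p ≫ f ▷ (b ⊗ y) ≫
    sw a' s (b ⊗ y) ≫ (α_ a' b y).inv ▷ s ≫ (α_ (a' ⊗ b) y s).hom := by
  rw [← reassoc_of% sw_tensor_last, whiskerRight_tensor]
  simp only [Category.assoc, Iso.hom_inv_id_assoc]
  rw [← reassoc_of% sw_tensor_mid, hom_inv_whiskerRight_assoc, outer]

lemma tensHom_eq {a p a' s b y b' q : C} (f : a ⊗ p ⟶ a' ⊗ s) (g : b ⊗ y ⟶ b' ⊗ q) :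
    tensHom f g = outer f b y ≫ inner g a' s := by
  rw [outer_eq]
  simp only [tensHom, inner, MonoidalCategory.tensorHom_def, Category.assoc, Iso.hom_inv_id_assoc,
    inv_hom_whiskerRight_assoc]
  rw [reassoc_of% sw_nat_last a' s g]

lemma tensHom_eq' {a p a' s b y b' q : C} (f : a ⊗ p ⟶ a' ⊗ s) (g : b ⊗ y ⟶ b' ⊗ q) :
    tensHom f g = inner g a p ≫ outer f b' q := by
  rw [outer_eq]
  simp only [tensHom, inner, MonoidalCategory.tensorHom_def', Category.assoc, Iso.hom_inv_id_assoc,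
    inv_hom_whiskerRight_assoc]
  rw [reassoc_of% sw_nat_mid a g p]

lemma tensHom_id_left {b y b' q : C} (g : b ⊗ y ⟶ b' ⊗ q) (a p : C) :
    tensHom (𝟙 (a ⊗ p)) g = inner g a p := by
  rw [tensHom_eq', outer_eq]
  simp [reassoc_of% sw_sw]

lemma tensHom_id_right {a p a' s : C} (f : a ⊗ p ⟶ a' ⊗ s) (b y : C) :
    tensHom f (𝟙 (b ⊗ y)) = outer f b y := by
  rw [tensHom_eq, inner]
  simp

/-- The tensor product of objects: `(A⁺, A⁻) ⊗ (B⁺, B⁻) = (A⁺ ⊗ B⁺, B⁻ ⊗ A⁻)`. -/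
abbrev tensorObj (A B : IntP C) : IntP C := ⟨A.pos ⊗ B.pos, B.neg ⊗ A.neg⟩

/-- The tensor product of arrows of `Intᵖ(C)`. -/
def tensorHom {A B A' B' : IntP C} (f : A ⟶ A') (g : B ⟶ B') : tensorObj A B ⟶ tensorObj A' B' :=
  ⟨tensHom f.hom g.hom⟩

/-- The identity arrow of `Intᵖ(C)`, whose underlying morphism is the identity of `A⁺ ⊗ A⁻`. -/
def ident (A : IntP C) : A ⟶ A := ⟨𝟙 _⟩

lemma exchange_aux {A B A' B' : IntP C} (f : A ⟶ A') (g : B ⟶ B') :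
    comp ((tensorHom f (ident B)).toPath.cons (tensorHom (ident A') g)) =
      Part.some (tensorHom f g) := by
  rw [comp_two]
  simp only [tensorHom, ident, tensHom_id_left, tensHom_id_right, tensorObj]
  rw [reassoc_of% outer_exchange]
  rw [reassoc_of% th_inner, th_sw, ← comp_whiskerRight_assoc, ← tensHom_eq]
  have h1 := tr_yank (U := A'.neg) (P := ((A.pos ⊗ B.pos) ⊗ B'.neg ⊗ A'.neg) ⊗ B.neg)
    ((α_ _ _ _).inv ▷ B.neg ≫ sw ((A.pos ⊗ B.pos) ⊗ B'.neg) A'.neg B.neg)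
    ((sw ((A.pos ⊗ B.pos) ⊗ B'.neg) B.neg A'.neg) ≫ (α_ _ _ _).hom ▷ B.neg ≫
      tensHom f.hom g.hom ▷ B.neg ≫ ((α_ _ _ _).inv ≫ sw _ _ _) ▷ B.neg ≫ sw _ _ _ ≫
      (sw _ _ _ ≫ (α_ _ _ _).hom) ▷ B.neg)
  simp only [Category.assoc, reassoc_of% sw_sw, inv_hom_whiskerRight_assoc] at h1
  have h2 := tr_two _ h1
  have h3 := tr_yank (tensHom f.hom g.hom ≫ (α_ _ _ _).inv ≫ sw _ _ _) (sw _ _ _ ≫ (α_ _ _ _).hom)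
  simp only [Category.assoc, reassoc_of% sw_sw, Iso.inv_hom_id, Category.comp_id] at h3
  rw [← Part.map_some, ← h3]
  simp only [comp_whiskerRight, Category.assoc] at h2 h3 ⊢
  rw [← h2]
  congr 2
  simp only [th, Category.assoc, comp_whiskerRight, whiskerRight_tensor, Iso.hom_inv_id_assoc,
    Iso.inv_hom_id_assoc]

instance (X Y Z : C) : IsIso (sw X Y Z) := ⟨sw X Z Y, sw_sw _ _ _, sw_sw _ _ _⟩

lemma sw_sw_ww (X Y Z V W : C) {T : C} (h : (((X ⊗ Y) ⊗ Z) ⊗ V) ⊗ W ⟶ T) :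
    sw X Y Z ▷ V ▷ W ≫ sw X Z Y ▷ V ▷ W ≫ h = h := by
  rw [← comp_whiskerRight_assoc, ← comp_whiskerRight, sw_sw]; simp

lemma sw_last_eq (X Y Z W : C) : sw X Y (Z ⊗ W) =
    (α_ (X ⊗ Y) Z W).inv ≫ sw X Y Z ▷ W ≫ sw (X ⊗ Z) Y W ≫ (α_ X Z W).hom ▷ Y := by
  rw [reassoc_of% sw_tensor_last]; simp

lemma sw_mid_eq (X Y Z W : C) : sw X (Y ⊗ Z) W =
    (α_ X Y Z).inv ▷ W ≫ sw (X ⊗ Y) Z W ≫ sw X Y W ▷ Z ≫ (α_ (X ⊗ W) Y Z).hom := by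
  rw [reassoc_of% sw_tensor_mid]; simp

lemma inner_assoc {c z c' w : C} (h : c ⊗ z ⟶ c' ⊗ w) (a b y p : C) :
    ((a ⊗ b) ⊗ c) ◁ (α_ z y p).hom ≫ inner h (a ⊗ b) (y ⊗ p) ≫ (α_ a b c').hom ▷ (w ⊗ y ⊗ p) =
      (α_ a b c).hom ▷ ((z ⊗ y) ⊗ p) ≫ inner (inner h b y) a p ≫ (a ⊗ b ⊗ c') ◁ (α_ w y p).hom := by
  simp only [inner]
  monoidal

lemma inner_unit {a p a' s : C} (f : a ⊗ p ⟶ a' ⊗ s) :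
    (𝟙_ C ⊗ a) ◁ (ρ_ p).inv ≫ inner f (𝟙_ C) (𝟙_ C) ≫ (λ_ a').hom ▷ (s ⊗ 𝟙_ C) =
      (λ_ a).hom ▷ p ≫ f ≫ a' ◁ (ρ_ s).inv := by
  simp only [inner]
  monoidal

lemma outer_unit {a p a' s : C} (f : a ⊗ p ⟶ a' ⊗ s) :
    (a ⊗ 𝟙_ C) ◁ (λ_ p).inv ≫ outer f (𝟙_ C) (𝟙_ C) ≫ (ρ_ a').hom ▷ (𝟙_ C ⊗ s) =
      (ρ_ a).hom ▷ p ≫ f ≫ a' ◁ (λ_ s).inv := by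
  simp only [outer, sw_unit_mid, sw_unit_last]
  monoidal

lemma outer_braid {a p a' s : C} (f : a ⊗ p ⟶ a' ⊗ s) (b y : C) :
    (a ⊗ b) ◁ (β_ p y).hom ≫ outer f b y ≫ (β_ a' b).hom ▷ (y ⊗ s) =
      (β_ a b).hom ▷ (p ⊗ y) ≫ inner f b y ≫ (b ⊗ a') ◁ (β_ s y).hom := by
  have h1 : sw a b p ≫ f ▷ b ≫ sw a' s b ≫ (β_ a' b).hom ▷ s =
      (β_ a b).hom ▷ p ≫ (α_ b a p).hom ≫ b ◁ f ≫ (α_ b a' s).inv := by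
    have h := BraidedCategory.braiding_naturality_left f b
    rw [BraidedCategory.braiding_tensor_left_hom, BraidedCategory.braiding_tensor_left_hom] at h
    rw [← cancel_epi (sw a p b), ← cancel_mono (α_ b a' s).hom]
    simp only [Category.assoc, reassoc_of% sw_sw]
    simpa [sw] using h
  have h2 := congrArg (fun t => t ▷ y) h1
  simp only [comp_whiskerRight, Category.assoc] at h2
  simp only [sw_eq_braid, outer, inner, Category.assoc, Iso.hom_inv_id_assoc, reassoc_of% sw_sw,
    whiskerRight_tensor]
  rw [← reassoc_of% sw_nat_head (β_ a' b).hom s y, reassoc_of% h2]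

lemma outer_braid' {a p a' s : C} (f : a ⊗ p ⟶ a' ⊗ s) (b y : C) :
    (b ⊗ a) ◁ (β_ y p).hom ≫ inner f b y ≫ (β_ b a').hom ▷ (s ⊗ y) =
      (β_ b a).hom ▷ (y ⊗ p) ≫ outer f b y ≫ (a' ⊗ b) ◁ (β_ y s).hom := by
  have h := outer_braid f b y
  rw [← cancel_epi ((β_ a b).hom ▷ (y ⊗ p)), ← cancel_epi ((a ⊗ b) ◁ (β_ p y).hom)]
  rw [← comp_whiskerRight_assoc, SymmetricCategory.symmetry, id_whiskerRight, Category.id_comp,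
    reassoc_of% whisker_exchange, ← whiskerLeft_comp_assoc, SymmetricCategory.symmetry,
    MonoidalCategory.whiskerLeft_id, Category.id_comp]
  rw [← cancel_mono ((a' ⊗ b) ◁ (β_ s y).hom), ← cancel_mono ((β_ a' b).hom ▷ (y ⊗ s))]
  simp only [Category.assoc]
  rw [← whiskerLeft_comp_assoc, SymmetricCategory.symmetry, MonoidalCategory.whiskerLeft_id,
    Category.id_comp, h, whisker_exchange, ← comp_whiskerRight_assoc, SymmetricCategory.symmetry]
  simp

lemma sw_nat {X X' Y Y' Z Z' : C} (f : X ⟶ X') (g : Y ⟶ Y') (h : Z ⟶ Z') :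
    ((f ⊗ₘ g) ⊗ₘ h) ≫ sw X' Y' Z' = sw X Y Z ≫ ((f ⊗ₘ h) ⊗ₘ g) := by
  simp only [MonoidalCategory.tensorHom_def, comp_whiskerRight, Category.assoc]
  rw [sw_nat_last, reassoc_of% sw_nat_mid, reassoc_of% sw_nat_head, whisker_exchange]

lemma tensHom_pair {a a' b b' p s y q : C} (u : a ⟶ a') (v : p ⟶ s) (u' : b ⟶ b') (v' : y ⟶ q) :
    tensHom (u ⊗ₘ v) (u' ⊗ₘ v') = (u ⊗ₘ u') ⊗ₘ (v' ⊗ₘ v) := by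
  rw [tensHom, reassoc_of% sw_nat, reassoc_of% sw_sw]
  have h : (α_ a b y).hom ▷ p ≫ ((u ⊗ₘ (u' ⊗ₘ v')) ⊗ₘ v) =
      (((u ⊗ₘ u') ⊗ₘ v') ⊗ₘ v) ≫ (α_ a' b' q).hom ▷ s := by
    rw [← tensorHom_id, ← tensorHom_id, MonoidalCategory.tensorHom_comp_tensorHom,
      MonoidalCategory.tensorHom_comp_tensorHom, MonoidalCategory.associator_naturality,
      Category.id_comp, Category.comp_id]
  rw [reassoc_of% h, hom_inv_whiskerRight_assoc, MonoidalCategory.associator_naturality,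
    Iso.inv_hom_id_assoc]

lemma outer_inner_aux {X X' y q : C} (G : X ⊗ y ⟶ X' ⊗ q) (c z p : C) :
    sw (X ⊗ c) z y ▷ p ≫ sw ((X ⊗ c) ⊗ y) z p ≫ sw X c y ▷ p ▷ z ≫ sw (X ⊗ y) c p ▷ z ≫
      G ▷ p ▷ c ▷ z ≫ sw (X' ⊗ q) p c ▷ z ≫ sw X' q c ▷ p ▷ z ≫ sw ((X' ⊗ c) ⊗ q) p z ≫
      sw (X' ⊗ c) q z ▷ p =
    sw (X ⊗ c) z y ▷ p ≫ sw X c y ▷ z ▷ p ≫ G ▷ c ▷ z ▷ p ≫ sw X' q c ▷ z ▷ p ≫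
      sw (X' ⊗ c) q z ▷ p := by
  rw [← reassoc_of% sw_nat_head (sw X c y), ← sw_nat_head_w G, ← reassoc_of% sw_nat_head (G ▷ c),
    sw_sw_w, reassoc_of% sw_nat_head (sw X' q c), reassoc_of% sw_sw]

lemma outer_inner_assoc {b y b' q : C} (g : b ⊗ y ⟶ b' ⊗ q) (a c z p : C) :
    ((a ⊗ b) ⊗ c) ◁ (α_ z y p).hom ≫ outer (inner g a p) c z ≫ (α_ a b' c).hom ▷ (z ⊗ q ⊗ p) =
      (α_ a b c).hom ▷ ((z ⊗ y) ⊗ p) ≫ inner (outer g c z) a p ≫ (a ⊗ b' ⊗ c) ◁ (α_ z q p).hom := by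
  have h := outer_inner_aux ((α_ a b y).hom ≫ a ◁ g ≫ (α_ a b' q).inv) c z p
  have h' := congrArg (fun t => ((α_ _ _ _).inv ≫ (α_ _ _ _).inv ▷ p) ≫ t ≫
    ((α_ _ _ _).hom ▷ p ≫ (α_ _ _ _).hom ≫ (α_ _ _ _).hom ▷ ((z ⊗ q) ⊗ p)) ≫
     (a ⊗ b' ⊗ c) ◁ (α_ z q p).hom) h
  convert h' using 1
  · simp only [outer, inner, sw_last_eq, sw_mid_eq]
    monoidal
  · simp only [outer, inner, sw]
    monoidal

lemma outer_assoc_half (X c z y p : C) :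
    sw (X ⊗ c) z y ▷ p ≫ sw ((X ⊗ c) ⊗ y) z p ≫ sw X c y ▷ p ▷ z ≫ sw (X ⊗ y) c p ▷ z ≫
      sw X y p ▷ c ▷ z =
    sw ((X ⊗ c) ⊗ z) y p ≫ sw (X ⊗ c) z p ▷ y ≫ sw X c p ▷ z ▷ y ≫ sw ((X ⊗ p) ⊗ c) z y ≫
      sw (X ⊗ p) c y ▷ z := by
  have := sw_braid_w X c y p z (𝟙 _)
  simp only [Category.comp_id] at this
  rw [this, reassoc_of% sw_braid, reassoc_of% sw_nat_head (sw X c p)]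

lemma outer_assoc_aux {a p a' s : C} (f : a ⊗ p ⟶ a' ⊗ s) (b c z y : C) :
    sw ((a ⊗ b) ⊗ c) z y ▷ p ≫ sw (((a ⊗ b) ⊗ c) ⊗ y) z p ≫ sw (a ⊗ b) c y ▷ p ▷ z ≫
      sw ((a ⊗ b) ⊗ y) c p ▷ z ≫ sw (a ⊗ b) y p ▷ c ▷ z ≫ sw a b p ▷ y ▷ c ▷ z ≫
      f ▷ b ▷ y ▷ c ▷ z ≫ sw a' s b ▷ y ▷ c ▷ z ≫ sw (a' ⊗ b) s y ▷ c ▷ z ≫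
      sw ((a' ⊗ b) ⊗ y) s c ▷ z ≫ sw (a' ⊗ b) y c ▷ s ▷ z ≫ sw (((a' ⊗ b) ⊗ c) ⊗ y) s z ≫
      sw ((a' ⊗ b) ⊗ c) y z ▷ s =
    sw (((a ⊗ b) ⊗ c) ⊗ z) y p ≫ sw ((a ⊗ b) ⊗ c) z p ▷ y ≫ sw (a ⊗ b) c p ▷ z ▷ y ≫
      sw a b p ▷ c ▷ z ▷ y ≫ f ▷ b ▷ c ▷ z ▷ y ≫ sw a' s b ▷ c ▷ z ▷ y ≫
      sw (a' ⊗ b) s c ▷ z ▷ y ≫ sw ((a' ⊗ b) ⊗ c) s z ▷ y ≫ sw (((a' ⊗ b) ⊗ c) ⊗ z) s y := by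
  have h := outer_assoc_half (a ⊗ b) c z y p
  have h' := outer_assoc_half (a' ⊗ b) c z y s
  rw [reassoc_of% h, ← sw_nat_head_w (sw a b p), ← reassoc_of% sw_nat_head (sw a b p ▷ c),
    ← sw_nat_head_w (f ▷ b), ← reassoc_of% sw_nat_head (f ▷ b ▷ c),
    ← sw_nat_head_w (sw a' s b), ← reassoc_of% sw_nat_head (sw a' s b ▷ c)]
  iterate 6 apply congrArg (_ ≫ ·)
  rw [← cancel_epi (sw (a' ⊗ b) c s ▷ z ▷ y), ← cancel_epi (sw ((a' ⊗ b) ⊗ c) z s ▷ y),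
    ← cancel_epi (sw (((a' ⊗ b) ⊗ c) ⊗ z) y s), ← reassoc_of% h']
  simp only [sw_sw_ww, sw_sw_w, reassoc_of% sw_sw, ← comp_whiskerRight, sw_sw, id_whiskerRight]

lemma outer_assoc {a p a' s : C} (f : a ⊗ p ⟶ a' ⊗ s) (b c z y : C) :
    ((a ⊗ b) ⊗ c) ◁ (α_ z y p).hom ≫ outer (outer f b y) c z ≫ (α_ a' b c).hom ▷ (z ⊗ y ⊗ s) =
      (α_ a b c).hom ▷ ((z ⊗ y) ⊗ p) ≫ outer f (b ⊗ c) (z ⊗ y) ≫ (a' ⊗ b ⊗ c) ◁ (α_ z y s).hom := by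
  have h := outer_assoc_aux f b c z y
  have h' := congrArg (fun t => ((α_ _ _ _).inv ≫ (α_ _ _ _).inv ▷ p) ≫ t ≫
    ((α_ _ _ _).hom ▷ s ≫ (α_ _ _ _).hom ≫ (α_ _ _ _).hom ▷ ((z ⊗ y) ⊗ s)) ≫
     (a' ⊗ b ⊗ c) ◁ (α_ z y s).hom) h
  convert h' using 1
  · simp only [outer, inner, sw_last_eq, sw_mid_eq]
    monoidal
  · simp only [outer, inner, sw_last_eq, sw_mid_eq]
    simp only [sw]
    monoidal

lemma tensHom_braid {a p a' s b y b' q : C} (f : a ⊗ p ⟶ a' ⊗ s) (g : b ⊗ y ⟶ b' ⊗ q) :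
    (a ⊗ b) ◁ (β_ p y).hom ≫ tensHom f g ≫ (β_ a' b').hom ▷ (q ⊗ s) =
      (β_ a b).hom ▷ (p ⊗ y) ≫ tensHom g f ≫ (b' ⊗ a') ◁ (β_ s q).hom := by
  rw [tensHom_eq, tensHom_eq']
  have e1 := outer_braid f b y
  have e2 := outer_braid' g a' s
  have h (X z w : C) : X ◁ (β_ z w).hom ≫ X ◁ (β_ w z).hom = 𝟙 _ := by
    rw [← MonoidalCategory.whiskerLeft_comp, SymmetricCategory.symmetry,
      MonoidalCategory.whiskerLeft_id]
  have e3 : inner g a' s ≫ (β_ a' b').hom ▷ (q ⊗ s) = (β_ a' b).hom ▷ (y ⊗ s) ≫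
      (b ⊗ a') ◁ (β_ y s).hom ≫ outer g a' s ≫ (b' ⊗ a') ◁ (β_ s q).hom := by
    rw [← reassoc_of% whisker_exchange, ← e2, reassoc_of% h]
  simp only [Category.assoc]
  rw [e3, reassoc_of% e1, reassoc_of% h]

lemma comp_nil (A : IntP C) : comp (Quiver.Path.nil : Quiver.Path A A) = Part.some (ident A) := by
  simp only [comp, loop, pre, ident]
  rw [PartiallyTraced.vanishing_one, Part.map_some, sw_unit_last]
  simp

/-- `g ↦ 1 ⊗ g`; its `mapPath` is `p ↦ 1 ⊗ p` on paths. -/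
def tensorLeft (X : IntP C) : IntP C ⥤q IntP C where
  obj Y := tensorObj X Y
  map g := tensorHom (ident X) g

/-- `g ↦ g ⊗ 1`; its `mapPath` is `p ↦ p ⊗ 1` on paths. -/
def tensorRight (X : IntP C) : IntP C ⥤q IntP C where
  obj Y := tensorObj Y X
  map g := tensorHom g (ident X)

/-- Congruence relations on the category of paths of `Intᵖ(C)`: equivalence relations on parallel
paths that are stable under concatenation and under tensoring with identities, and that relate a
path to its composite whenever the latter is defined. -/
structure IsCongruence (S : ∀ A B : IntP C, Quiver.Path A B → Quiver.Path A B → Prop) :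
    Prop where
  equivalence (A B : IntP C) : Equivalence (S A B)
  append {X Y Z : IntP C} {p p' : Quiver.Path X Y} {q q' : Quiver.Path Y Z} :
    S X Y p p' → S Y Z q q' → S X Z (p.comp q) (p'.comp q')
  comp {X Y : IntP C} {p : Quiver.Path X Y} {f : X ⟶ Y} : f ∈ comp p → S X Y p f.toPath
  tensorLeft (A : IntP C) {X Y : IntP C} {p q : Quiver.Path X Y} : S X Y p q →
    S _ _ ((tensorLeft A).mapPath p) ((tensorLeft A).mapPath q)
  tensorRight (A : IntP C) {X Y : IntP C} {p q : Quiver.Path X Y} : S X Y p q →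
    S _ _ ((tensorRight A).mapPath p) ((tensorRight A).mapPath q)

/-- The smallest congruence relation, i.e. the intersection of all congruence relations. -/
def Sim (A B : IntP C) (p q : Quiver.Path A B) : Prop :=
  ∀ S : (∀ A B : IntP C, Quiver.Path A B → Quiver.Path A B → Prop), IsCongruence S → S A B p q

lemma isCongruence_sim : IsCongruence (Sim (C := C)) where
  equivalence A B :=
    { refl := fun p S hS => (hS.equivalence A B).refl p
      symm := fun h S hS => (hS.equivalence A B).symm (h S hS)
      trans := fun h h' S hS => (hS.equivalence A B).trans (h S hS) (h' S hS) }
  append h h' S hS := hS.append (h S hS) (h' S hS)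
  comp h S hS := hS.comp h
  tensorLeft A _ _ _ _ h S hS := hS.tensorLeft A (h S hS)
  tensorRight A _ _ _ _ h S hS := hS.tensorRight A (h S hS)

end IntP

variable (C) in
/-- The objects of the category `Path(Intᵖ(C))/∼`; they are the objects of `Intᵖ(C)`. -/
structure PathInt [PartiallyTraced C] where
  /-- the underlying object of `Intᵖ(C)` -/
  as : IntP C

namespace PathInt

open IntP

variable [PartiallyTraced C]

/-- Morphisms are paths up to the smallest congruence. -/
def Hom (A B : PathInt C) : Type (max u v) := Quot (Sim A.as B.as)

/-- Composition is concatenation of paths. -/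
instance : Category (PathInt C) where
  Hom := Hom
  id A := Quot.mk _ Quiver.Path.nil
  comp := fun {A B D} f g => Quot.map₂ (fun p q => p.comp q)
    (fun p _ _ h => isCongruence_sim.append ((isCongruence_sim.equivalence _ _).refl p) h)
    (fun _ _ q h => isCongruence_sim.append h ((isCongruence_sim.equivalence _ _).refl q)) f g
  id_comp := by rintro A B ⟨p⟩; exact congrArg (Quot.mk _) (Quiver.Path.nil_comp p)
  comp_id := by rintro A B ⟨p⟩; rfl
  assoc := by rintro A B D E ⟨p⟩ ⟨q⟩ ⟨r⟩; exact congrArg (Quot.mk _) (Quiver.Path.comp_assoc p q r)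

/-- The class of a path of length one. -/
def sing {X Y : IntP C} (f : X ⟶ Y) : (⟨X⟩ : PathInt C) ⟶ ⟨Y⟩ := Quot.mk _ f.toPath

@[elab_as_elim]
lemma hom_induction {A : PathInt C} {P : ∀ {B : PathInt C}, (A ⟶ B) → Prop} (id : P (𝟙 A))
    (step : ∀ {X Y : IntP C} (p : A ⟶ (⟨X⟩ : PathInt C)) (f : X ⟶ Y), P p → P (p ≫ sing f))
    {B : PathInt C} (f : A ⟶ B) : P f := by
  obtain ⟨p⟩ := f
  change P (B := ⟨B.as⟩) (Quot.mk _ p)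
  generalize B.as = B' at p
  induction p with
  | nil => exact id
  | cons p f ih => exact step (X := _) (Quot.mk _ p) f ih

lemma sing_of_mem {X Y Z : IntP C} {f : X ⟶ Y} {g : Y ⟶ Z} {t : X ⟶ Z}
    (h : comp (f.toPath.cons g) = Part.some t) : sing f ≫ sing g = sing t :=
  Quot.sound (isCongruence_sim.comp (Part.eq_some_iff.1 h))

lemma sing_ident (X : IntP C) : sing (ident X) = 𝟙 _ :=
  (Quot.sound (isCongruence_sim.comp (Part.eq_some_iff.1 (comp_nil X)))).symm

/-- The map `p ↦ 1 ⊗ p` on classes of paths. -/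
def whL (X : PathInt C) {Y Z : PathInt C} (f : Y ⟶ Z) :
    (⟨tensorObj X.as Y.as⟩ : PathInt C) ⟶ ⟨tensorObj X.as Z.as⟩ :=
  Quot.map (IntP.tensorLeft X.as).mapPath (fun _ _ h => isCongruence_sim.tensorLeft X.as h) f

/-- The map `p ↦ p ⊗ 1` on classes of paths. -/
def whR {Y Z : PathInt C} (f : Y ⟶ Z) (X : PathInt C) :
    (⟨tensorObj Y.as X.as⟩ : PathInt C) ⟶ ⟨tensorObj Z.as X.as⟩ :=
  Quot.map (IntP.tensorRight X.as).mapPath (fun _ _ h => isCongruence_sim.tensorRight X.as h) f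

lemma whL_id (X Y : PathInt C) : whL X (𝟙 Y) = 𝟙 _ := rfl
lemma whR_id (X Y : PathInt C) : whR (𝟙 Y) X = 𝟙 _ := rfl

lemma whL_comp (X : PathInt C) {Y Z W : PathInt C} (f : Y ⟶ Z) (g : Z ⟶ W) :
    whL X (f ≫ g) = whL X f ≫ whL X g := by
  obtain ⟨p⟩ := f
  obtain ⟨q⟩ := g
  exact congrArg (Quot.mk _) ((IntP.tensorLeft X.as).mapPath_comp p q)

lemma whR_comp {Y Z W : PathInt C} (f : Y ⟶ Z) (g : Z ⟶ W) (X : PathInt C) :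
    whR (f ≫ g) X = whR f X ≫ whR g X := by
  obtain ⟨p⟩ := f
  obtain ⟨q⟩ := g
  exact congrArg (Quot.mk _) ((IntP.tensorRight X.as).mapPath_comp p q)

lemma whL_F (X : PathInt C) {Y Z : IntP C} (f : Y ⟶ Z) :
    whL X (sing f) = sing (IntP.tensorHom (ident X.as) f) := rfl

lemma whR_F {Y Z : IntP C} (f : Y ⟶ Z) (X : PathInt C) :
    whR (sing f) X = sing (IntP.tensorHom f (ident X.as)) := rfl

/-- The class of the arrow given by a pair of morphisms of `C`. -/
def J {a p a' p' : C} (u : a ⟶ a') (v : p' ⟶ p) :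
    (⟨⟨a, p⟩⟩ : PathInt C) ⟶ (⟨⟨a', p'⟩⟩ : PathInt C) :=
  sing (pair (A := ⟨a, p⟩) (B := ⟨a', p'⟩) u v)

lemma J_id (a p : C) : J (𝟙 a) (𝟙 p) = 𝟙 ((⟨⟨a, p⟩⟩ : PathInt C)) := by
  rw [← sing_ident, J, pair, ident]; simp

lemma J_comp {a p a' p' a'' p'' : C} (u : a ⟶ a') (v : p' ⟶ p) (u' : a' ⟶ a'') (v' : p'' ⟶ p') :
    J u v ≫ J u' v' = J (u ≫ u') (v' ≫ v) := by
  rw [J, J, sing_of_mem (comp_pair _ _ _), J]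
  congr 2
  simp only [pair, MonoidalCategory.tensorHom_def, comp_whiskerRight, MonoidalCategory.whiskerLeft_comp,
    Category.assoc]
  rw [whisker_exchange u' v, reassoc_of% whisker_exchange u v', reassoc_of% whisker_exchange u' v']

lemma ident_eq (A : IntP C) : ident A = pair (𝟙 _) (𝟙 _) := by simp [ident, pair]

lemma tensorHom_pair {A B A' B' : IntP C} (u : A.pos ⟶ B.pos) (v : B.neg ⟶ A.neg)
    (u' : A'.pos ⟶ B'.pos) (v' : B'.neg ⟶ A'.neg) :
    IntP.tensorHom (pair u v) (pair u' v') =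
      pair (A := A.tensorObj A') (B := B.tensorObj B') (u ⊗ₘ u') (v' ⊗ₘ v) :=
  congrArg Hom.mk (tensHom_pair u v u' v')

lemma whL_J (X : PathInt C) {a p a' p' : C} (u : a ⟶ a') (v : p' ⟶ p) :
    whL X (J u v) = J (X.as.pos ◁ u) (v ▷ X.as.neg) := by
  change sing (IntP.tensorHom (ident X.as) (pair (A := ⟨a, p⟩) (B := ⟨a', p'⟩) u v)) = sing (pair _ _)
  rw [ident_eq, tensorHom_pair, id_tensorHom, tensorHom_id]

lemma whR_J (X : PathInt C) {a p a' p' : C} (u : a ⟶ a') (v : p' ⟶ p) :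
    whR (J u v) X = J (u ▷ X.as.pos) (X.as.neg ◁ v) := by
  change sing (IntP.tensorHom (pair (A := ⟨a, p⟩) (B := ⟨a', p'⟩) u v) (ident X.as)) = sing (pair _ _)
  rw [ident_eq, tensorHom_pair, id_tensorHom, tensorHom_id]

/-- A sufficient condition for naturality squares with respect to `J`. -/
lemma J_square {X Y X' Y' : IntP C} (f : X ⟶ Y) (g : X' ⟶ Y') (u : Y.pos ⟶ Y'.pos)
    (v : Y'.neg ⟶ Y.neg) (u' : X.pos ⟶ X'.pos) (v' : X'.neg ⟶ X.neg)
    (h : X.pos ◁ v ≫ f.hom ≫ u ▷ X.neg = u' ▷ Y'.neg ≫ g.hom ≫ Y'.pos ◁ v') :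
    sing f ≫ J u v = J u' v' ≫ sing g := by
  have h1 := sing_of_mem (comp_pair f u v)
  have h2 := sing_of_mem (pair_comp u' v' g)
  rw [h] at h1
  exact h1.trans h2.symm

lemma hom_outer {A A' : IntP C} (f : A ⟶ A') (B : IntP C) :
    (IntP.tensorHom f (ident B)).hom = outer f.hom B.pos B.neg := tensHom_id_right _ _ _

lemma hom_inner {A A' : IntP C} (f : A ⟶ A') (B : IntP C) :
    (IntP.tensorHom (ident B) f).hom = inner f.hom B.pos B.neg := tensHom_id_left _ _ _

/-- Naturality extends from single arrows to all paths. -/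
lemma square_ext {Φ Ψ : PathInt C → PathInt C}
    (φ : ∀ {X Y : PathInt C}, (X ⟶ Y) → (Φ X ⟶ Φ Y)) (ψ : ∀ {X Y : PathInt C}, (X ⟶ Y) → (Ψ X ⟶ Ψ Y))
    (hφ : ∀ X, φ (𝟙 X) = 𝟙 _) (hψ : ∀ X, ψ (𝟙 X) = 𝟙 _)
    (hφ' : ∀ {X Y Z : PathInt C} (f : X ⟶ Y) (g : Y ⟶ Z), φ (f ≫ g) = φ f ≫ φ g)
    (hψ' : ∀ {X Y Z : PathInt C} (f : X ⟶ Y) (g : Y ⟶ Z), ψ (f ≫ g) = ψ f ≫ ψ g)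
    (τ : ∀ X, Φ X ⟶ Ψ X)
    (h : ∀ {X Y : IntP C} (f : X ⟶ Y), φ (sing f) ≫ τ ⟨Y⟩ = τ ⟨X⟩ ≫ ψ (sing f))
    {X Y : PathInt C} (f : X ⟶ Y) : φ f ≫ τ Y = τ X ≫ ψ f := by
  induction f using hom_induction with
  | id => simp [hφ, hψ]
  | step p f ih => rw [hφ', hψ', Category.assoc, h, ← Category.assoc, ih, Category.assoc]

/-- The isomorphism given by a pair of isomorphisms of `C`. -/
def JIso {a p a' p' : C} (u : a ≅ a') (v : p' ≅ p) :
    (⟨⟨a, p⟩⟩ : PathInt C) ≅ (⟨⟨a', p'⟩⟩ : PathInt C) where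
  hom := J u.hom v.hom
  inv := J u.inv v.inv
  hom_inv_id := by rw [J_comp, Iso.hom_inv_id, Iso.inv_hom_id, J_id]
  inv_hom_id := by rw [J_comp, Iso.hom_inv_id, Iso.inv_hom_id, J_id]

/-- The tensor product on `Path(Intᵖ(C))/∼`; on paths it is `f ⊗ g = (f ⊗ 1), (1 ⊗ g)`. The structural
isomorphisms are the classes of those of `Intᵖ(C)`, which are given by pairs of structural
isomorphisms of `C`. -/
instance : MonoidalCategoryStruct (PathInt C) where
  tensorObj X Y := ⟨X.as.tensorObj Y.as⟩
  tensorUnit := ⟨⟨𝟙_ C, 𝟙_ C⟩⟩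
  whiskerLeft X _ _ f := whL X f
  whiskerRight f X := whR f X
  tensorHom {_ A' B _} f g := whR f B ≫ whL A' g
  associator X Y Z := JIso (α_ X.as.pos Y.as.pos Z.as.pos) (α_ Z.as.neg Y.as.neg X.as.neg)
  leftUnitor X := JIso (λ_ X.as.pos) (ρ_ X.as.neg).symm
  rightUnitor X := JIso (ρ_ X.as.pos) (λ_ X.as.neg).symm

/-- The symmetry of `Path(Intᵖ(C))/∼`, the class of the symmetry of `Intᵖ(C)`. -/
def braid (X Y : PathInt C) : X ⊗ Y ≅ Y ⊗ X := JIso (β_ X.as.pos Y.as.pos) (β_ X.as.neg Y.as.neg)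

lemma braid_nat_right (X : PathInt C) {Y Z : PathInt C} (f : Y ⟶ Z) :
    X ◁ f ≫ (braid X Z).hom = (braid X Y).hom ≫ f ▷ X := by
  refine square_ext (fun f => whL X f) (fun f => whR f X) (whL_id X) (whR_id X) (whL_comp X)
    (fun f g => whR_comp f g X) (fun Y => (braid X Y).hom) (fun {_ _} f => ?_) f
  refine J_square (IntP.tensorHom (ident X.as) f) (IntP.tensorHom f (ident X.as)) _ _ _ _ ?_
  rw [hom_inner, hom_outer]
  exact outer_braid' _ _ _

lemma braid_nat_left {Y Z : PathInt C} (f : Y ⟶ Z) (X : PathInt C) :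
    f ▷ X ≫ (braid Z X).hom = (braid Y X).hom ≫ X ◁ f := by
  refine square_ext (fun f => whR f X) (fun f => whL X f) (whR_id X) (whL_id X)
    (fun f g => whR_comp f g X) (whL_comp X) (fun Y => (braid Y X).hom) (fun {_ _} f => ?_) f
  refine J_square (IntP.tensorHom f (ident X.as)) (IntP.tensorHom (ident X.as) f) _ _ _ _ ?_
  rw [hom_inner, hom_outer]
  exact outer_braid _ _ _

lemma exchange_sing {A B A' B' : IntP C} (f : A ⟶ A') (g : B ⟶ B') :
    sing f ▷ ⟨B⟩ ≫ ⟨A'⟩ ◁ sing g = ⟨A⟩ ◁ sing g ≫ sing f ▷ ⟨B'⟩ := by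
  have h1 : sing f ▷ ⟨B⟩ ≫ ⟨A'⟩ ◁ sing g = sing (IntP.tensorHom f g) :=
    sing_of_mem (exchange_aux f g)
  have h2 : sing g ▷ ⟨A⟩ ≫ ⟨B'⟩ ◁ sing f = sing (IntP.tensorHom g f) :=
    sing_of_mem (exchange_aux g f)
  have h3 : (⟨A⟩ ◁ sing g ≫ sing f ▷ ⟨B'⟩) ≫ (braid ⟨A'⟩ ⟨B'⟩).hom =
      (braid ⟨A⟩ ⟨B⟩).hom ≫ sing (IntP.tensorHom g f) := by
    rw [Category.assoc, braid_nat_left, ← Category.assoc, braid_nat_right, Category.assoc, h2]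
  rw [← cancel_mono (braid ⟨A'⟩ ⟨B'⟩).hom, h3, h1]
  exact J_square (IntP.tensorHom f g) (IntP.tensorHom g f) _ _ _ _ (tensHom_braid f.hom g.hom)

lemma exchange {W X Y Z : PathInt C} (f : W ⟶ X) (g : Y ⟶ Z) :
    f ▷ Y ≫ X ◁ g = W ◁ g ≫ f ▷ Z := by
  refine square_ext (fun f => whR f Y) (fun f => whR f Z) (whR_id Y) (whR_id Z)
    (fun f g => whR_comp f g Y) (fun f g => whR_comp f g Z) (fun X => whL X g) (fun {A A'} f => ?_) f
  symm
  refine square_ext (fun f => whL ⟨A⟩ f) (fun f => whL ⟨A'⟩ f) (whL_id ⟨A⟩) (whL_id ⟨A'⟩)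
    (whL_comp ⟨A⟩) (whL_comp ⟨A'⟩) (fun X => whR (sing f) X) (fun {B B'} g => ?_) g
  exact (exchange_sing f g).symm

lemma assoc_nat_left {X X' : PathInt C} (f : X ⟶ X') (Y Z : PathInt C) :
    f ▷ Y ▷ Z ≫ (α_ X' Y Z).hom = (α_ X Y Z).hom ≫ f ▷ (Y ⊗ Z) := by
  refine square_ext (fun f => whR (whR f Y) Z) (fun f => whR f (Y ⊗ Z)) (fun X => rfl) (fun X => rfl)
    (fun f g => by rw [whR_comp, whR_comp]) (fun f g => whR_comp f g _)
    (fun X => (α_ X Y Z).hom) (fun {_ _} f => ?_) f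
  refine J_square (IntP.tensorHom (IntP.tensorHom f (ident Y.as)) (ident Z.as))
    (IntP.tensorHom f (ident (Y.as.tensorObj Z.as))) _ _ _ _ ?_
  rw [hom_outer, hom_outer, hom_outer]
  exact outer_assoc _ _ _ _ _

lemma assoc_nat_mid (X : PathInt C) {Y Y' : PathInt C} (f : Y ⟶ Y') (Z : PathInt C) :
    (X ◁ f) ▷ Z ≫ (α_ X Y' Z).hom = (α_ X Y Z).hom ≫ X ◁ f ▷ Z := by
  refine square_ext (fun f => whR (whL X f) Z) (fun f => whL X (whR f Z)) (fun X => rfl) (fun X => rfl)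
    (fun f g => by rw [whL_comp, whR_comp]) (fun f g => by rw [whR_comp, whL_comp])
    (fun Y => (α_ X Y Z).hom) (fun {_ _} f => ?_) f
  refine J_square (IntP.tensorHom (IntP.tensorHom (ident X.as) f) (ident Z.as))
    (IntP.tensorHom (ident X.as) (IntP.tensorHom f (ident Z.as))) _ _ _ _ ?_
  rw [hom_outer, hom_inner, hom_inner, hom_outer]
  exact outer_inner_assoc _ _ _ _ _

lemma assoc_nat_right (X Y : PathInt C) {Z Z' : PathInt C} (f : Z ⟶ Z') :
    (X ⊗ Y) ◁ f ≫ (α_ X Y Z').hom = (α_ X Y Z).hom ≫ X ◁ Y ◁ f := by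
  refine square_ext (fun f => whL (X ⊗ Y) f) (fun f => whL X (whL Y f)) (fun X => rfl) (fun X => rfl)
    (fun f g => whL_comp _ f g) (fun f g => by rw [whL_comp, whL_comp])
    (fun Z => (α_ X Y Z).hom) (fun {_ _} f => ?_) f
  refine J_square (IntP.tensorHom (ident (X.as.tensorObj Y.as)) f)
    (IntP.tensorHom (ident X.as) (IntP.tensorHom (ident Y.as) f)) _ _ _ _ ?_
  rw [hom_inner, hom_inner, hom_inner]
  exact inner_assoc _ _ _ _ _

lemma lUnit_nat {X Y : PathInt C} (f : X ⟶ Y) :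
    𝟙_ (PathInt C) ◁ f ≫ (λ_ Y).hom = (λ_ X).hom ≫ f := by
  refine square_ext (fun f => whL (𝟙_ (PathInt C)) f) (fun f => f) (fun X => rfl) (fun X => rfl)
    (fun f g => whL_comp _ f g) (fun f g => rfl)
    (fun X => (λ_ X).hom) (fun {_ _} f => ?_) f
  refine J_square (IntP.tensorHom (ident ⟨𝟙_ C, 𝟙_ C⟩) f) f _ _ _ _ ?_
  rw [hom_inner]
  exact inner_unit _

lemma rUnit_nat {X Y : PathInt C} (f : X ⟶ Y) :
    f ▷ 𝟙_ (PathInt C) ≫ (ρ_ Y).hom = (ρ_ X).hom ≫ f := by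
  refine square_ext (fun f => whR f (𝟙_ (PathInt C))) (fun f => f) (fun X => rfl) (fun X => rfl)
    (fun f g => whR_comp f g _) (fun f g => rfl)
    (fun X => (ρ_ X).hom) (fun {_ _} f => ?_) f
  refine J_square (IntP.tensorHom f (ident ⟨𝟙_ C, 𝟙_ C⟩)) f _ _ _ _ ?_
  rw [hom_outer]
  exact outer_unit _

lemma tensorHom_def_aux {W X Y Z : PathInt C} (f : W ⟶ X) (g : Y ⟶ Z) :
    f ⊗ₘ g = f ▷ Y ≫ X ◁ g := rfl

instance : MonoidalCategory (PathInt C) where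
  tensorHom_def _ _ := rfl
  id_tensorHom_id X Y := Category.comp_id _
  tensorHom_comp_tensorHom {X₁ Y₁ Z₁ X₂ Y₂ Z₂} f₁ f₂ g₁ g₂ := by
    have h1 : (f₁ ≫ g₁) ▷ X₂ = f₁ ▷ X₂ ≫ g₁ ▷ X₂ := whR_comp f₁ g₁ X₂
    have h2 : Z₁ ◁ (f₂ ≫ g₂) = Z₁ ◁ f₂ ≫ Z₁ ◁ g₂ := whL_comp Z₁ f₂ g₂
    simp only [tensorHom_def_aux, h1, h2, Category.assoc]
    rw [reassoc_of% exchange g₁ f₂]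
  whiskerLeft_id X Y := whL_id X Y
  id_whiskerRight X Y := whR_id Y X
  associator_naturality {X₁ X₂ X₃ Y₁ Y₂ Y₃} f g h := by
    have h1 : (f ▷ X₂ ≫ Y₁ ◁ g) ▷ X₃ = f ▷ X₂ ▷ X₃ ≫ (Y₁ ◁ g) ▷ X₃ := whR_comp _ _ X₃
    have h2 : Y₁ ◁ (g ▷ X₃ ≫ Y₂ ◁ h) = Y₁ ◁ g ▷ X₃ ≫ Y₁ ◁ Y₂ ◁ h := whL_comp Y₁ _ _
    simp only [tensorHom_def_aux, h1, h2, Category.assoc]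
    rw [assoc_nat_right, reassoc_of% assoc_nat_mid, reassoc_of% assoc_nat_left]
  leftUnitor_naturality f := lUnit_nat f
  rightUnitor_naturality f := rUnit_nat f
  pentagon W X Y Z := by
    change whR (J _ _) Z ≫ J _ _ ≫ whL W (J _ _) = J _ _ ≫ J _ _
    rw [whR_J, whL_J, J_comp, J_comp, J_comp]
    congr 1
    · exact MonoidalCategory.pentagon _ _ _ _
    · rw [Category.assoc]
      exact MonoidalCategory.pentagon _ _ _ _
  triangle X Y := by
    change J _ _ ≫ whL X (J _ _) = whR (J _ _) Y
    rw [whR_J, whL_J, J_comp]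
    congr 1
    · exact MonoidalCategory.triangle _ _
    · change (ρ_ _).inv ▷ _ ≫ (α_ _ _ _).hom = _ ◁ (λ_ _).inv
      simp

instance : SymmetricCategory (PathInt C) where
  braiding := braid
  braiding_naturality_right X _ _ f := braid_nat_right X f
  braiding_naturality_left f Z := braid_nat_left f Z
  hexagon_forward X Y Z := by
    change J _ _ ≫ J _ _ ≫ J _ _ = whR (J _ _) Z ≫ J _ _ ≫ whL Y (J _ _)
    rw [whR_J, whL_J, J_comp, J_comp, J_comp, J_comp]
    congr 1
    · exact BraidedCategory.hexagon_forward _ _ _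
    · simp only [Category.assoc]
      exact BraidedCategory.hexagon_forward _ _ _
  hexagon_reverse X Y Z := by
    change J _ _ ≫ J _ _ ≫ J _ _ = whL X (J _ _) ≫ J _ _ ≫ whR (J _ _) Y
    rw [whR_J, whL_J, J_comp, J_comp, J_comp, J_comp]
    congr 1
    · exact BraidedCategory.hexagon_reverse _ _ _
    · simp only [Category.assoc]
      exact BraidedCategory.hexagon_reverse _ _ _
  symmetry X Y := by
    change J _ _ ≫ J _ _ = _
    rw [J_comp]
    refine Eq.trans ?_ (J_id _ _)
    congr 1
    · exact SymmetricCategory.symmetry _ _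
    · exact SymmetricCategory.symmetry _ _

end PathInt

open IntP PathInt

/-- The embedding `N : C → Intᵖ(C)`, as a map of graphs: `N A = (A, I)`, and `N f` is `f` regarded
as a morphism `A ⊗ I ⟶ B ⊗ I`. -/
def N (C : Type u) [Category.{v} C] [MonoidalCategory C] : C ⥤q IntP C where
  obj A := ⟨A, 𝟙_ C⟩
  map f := ⟨f ⊗ₘ 𝟙 (𝟙_ C)⟩

variable [PartiallyTraced C]

/-- The canonical map `F : Intᵖ(C) → Path(Intᵖ(C))/∼`, as a map of graphs: the identity on objects,
and an arrow is sent to the class of the corresponding path of length one. -/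
def F (C : Type u) [Category.{v} C] [MonoidalCategory C] [SymmetricCategory C]
    [PartiallyTraced C] : IntP C ⥤q PathInt C where
  obj X := ⟨X⟩
  map f := sing f

/-- The composite `F ∘ N`, which is a functor between honest categories. -/
def embed (C : Type u) [Category.{v} C] [MonoidalCategory C] [SymmetricCategory C]
    [PartiallyTraced C] : C ⥤ PathInt C where
  obj A := (F C).obj ((N C).obj A)
  map f := (F C).map ((N C).map f)
  map_id A := J_id _ _
  map_comp f g := ((J_comp _ _ _ _).trans (by rw [Category.comp_id]; rfl)).symm

/-- The object `(A, I)`. -/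
abbrev base (A : C) : PathInt C := ⟨⟨A, 𝟙_ C⟩⟩

/-- The action of `F ∘ N` on morphisms. -/
abbrev baseMap {A B : C} (f : A ⟶ B) : base A ⟶ base B := J f (𝟙 (𝟙_ C))

/-- The comparison `(A, I) ⊗ (B, I) = (A ⊗ B, I ⊗ I) ≅ (A ⊗ B, I)`. -/
abbrev baseMu (A B : C) : base A ⊗ base B ≅ base (A ⊗ B) :=
  JIso (Iso.refl (A ⊗ B)) (λ_ (𝟙_ C)).symm

lemma base_nat_left {A B : C} (f : A ⟶ B) (X : C) :
    baseMap f ▷ base X ≫ (baseMu B X).hom = (baseMu A X).hom ≫ baseMap (f ▷ X) := by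
  change whR (J f (𝟙 (𝟙_ C))) (base X) ≫ J (𝟙 _) (λ_ (𝟙_ C)).inv = J (𝟙 _) (λ_ (𝟙_ C)).inv ≫ J _ _
  rw [whR_J, J_comp, J_comp]
  simp

lemma base_nat_right (X : C) {A B : C} (f : A ⟶ B) :
    base X ◁ baseMap f ≫ (baseMu X B).hom = (baseMu X A).hom ≫ baseMap (X ◁ f) := by
  change whL (base X) (J f (𝟙 (𝟙_ C))) ≫ J (𝟙 _) (λ_ (𝟙_ C)).inv = J (𝟙 _) (λ_ (𝟙_ C)).inv ≫ J _ _
  rw [whL_J, J_comp, J_comp]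
  simp

lemma base_assoc (X Y Z : C) :
    (baseMu X Y).hom ▷ base Z ≫ (baseMu (X ⊗ Y) Z).hom ≫ baseMap (α_ X Y Z).hom =
      (α_ (base X) (base Y) (base Z)).hom ≫ base X ◁ (baseMu Y Z).hom ≫
        (baseMu X (Y ⊗ Z)).hom := by
  change whR (J (𝟙 _) (λ_ (𝟙_ C)).inv) (base Z) ≫ J (𝟙 _) (λ_ (𝟙_ C)).inv ≫ J _ (𝟙 _) =
    J (α_ X Y Z).hom (α_ (𝟙_ C) (𝟙_ C) (𝟙_ C)).hom ≫ whL (base X) (J (𝟙 _) (λ_ (𝟙_ C)).inv) ≫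
      J (𝟙 _) (λ_ (𝟙_ C)).inv
  rw [whR_J, whL_J, J_comp, J_comp, J_comp, J_comp]
  congr 1
  · simp
  · simp only [Category.id_comp, Category.comp_id, Category.assoc]
    monoidal

lemma base_left_unit (X : C) : (λ_ (base X)).hom =
    (𝟙 (𝟙_ (PathInt C))) ▷ base X ≫ (baseMu (𝟙_ C) X).hom ≫ baseMap (λ_ X).hom := by
  rw [id_whiskerRight, Category.id_comp]
  change J (λ_ X).hom (ρ_ (𝟙_ C)).inv = J (𝟙 _) (λ_ (𝟙_ C)).inv ≫ J (λ_ X).hom (𝟙 _)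
  rw [J_comp, Category.id_comp, Category.id_comp, unitors_inv_equal]

lemma base_right_unit (X : C) : (ρ_ (base X)).hom =
    base X ◁ (𝟙 (𝟙_ (PathInt C))) ≫ (baseMu X (𝟙_ C)).hom ≫ baseMap (ρ_ X).hom := by
  rw [MonoidalCategory.whiskerLeft_id, Category.id_comp]
  change J (ρ_ X).hom (λ_ (𝟙_ C)).inv = J (𝟙 _) (λ_ (𝟙_ C)).inv ≫ J (ρ_ X).hom (𝟙 _)
  rw [J_comp, Category.id_comp, Category.id_comp]

lemma base_braid (X Y : C) : (baseMu X Y).hom ≫ baseMap (β_ X Y).hom =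
    (β_ (base X) (base Y)).hom ≫ (baseMu Y X).hom := by
  change J (𝟙 _) (λ_ (𝟙_ C)).inv ≫ J (β_ X Y).hom (𝟙 _) =
    J (β_ X Y).hom (β_ (𝟙_ C) (𝟙_ C)).hom ≫ J (𝟙 _) (λ_ (𝟙_ C)).inv
  rw [J_comp, J_comp]
  congr 1
  · simp
  · simp [unitors_inv_equal]

/-- The strong monoidal structure of `F ∘ N`: the unit comparison is the identity of `(I, I)`, and
the comparison for the tensor product is the structural isomorphism `I ⊗ I ≅ I` in the second
component (an identity if `C` is strict). -/
instance : (embed C).Monoidal := Functor.CoreMonoidal.toMonoidal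
  { εIso := Iso.refl _
    μIso := baseMu
    μIso_hom_natural_left := base_nat_left
    μIso_hom_natural_right := fun X f => base_nat_right X f
    associativity := base_assoc
    left_unitality := base_left_unit
    right_unitality := base_right_unit }

instance : (embed C).Braided where
  braided X Y := base_braid X Y

section Traced

variable {D : Type u₂} [Category.{v₂} D] [MonoidalCategory D] [SymmetricCategory D]

/-- The canonical trace of a compact closed category, i.e. of a symmetric monoidal category in which
every object `U` has a chosen dual `ᘁU` with unit `η_ : I ⟶ ᘁU ⊗ U` and counit
`ε_ : U ⊗ ᘁU ⟶ I`:
`A ⟶ A ⊗ ᘁU ⊗ U ⟶ A ⊗ U ⊗ ᘁU ⟶ B ⊗ U ⊗ ᘁU ⟶ B`. -/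
def canonicalTrace [LeftRigidCategory D] {A B : D} (U : D) (f : A ⊗ U ⟶ B ⊗ U) : A ⟶ B :=
  (ρ_ A).inv ≫ A ◁ η_ (ᘁU) U ≫ A ◁ (β_ (ᘁU) U).hom ≫ (α_ A U (ᘁU)).inv ≫ f ▷ (ᘁU) ≫
    (α_ B U (ᘁU)).hom ≫ B ◁ ε_ (ᘁU) U ≫ (ρ_ B).hom

/-- A strong symmetric monoidal functor from a partially traced category to a compact closed
category preserves the trace: whenever the trace of `f` is defined, with value `t`, the canonical
trace of `μ ≫ G f ≫ μ⁻¹` is `G t`. -/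
def PreservesTrace [LeftRigidCategory D] (G : C ⥤ D) [G.Braided] : Prop :=
  ∀ ⦃A B U : C⦄ (f : A ⊗ U ⟶ B ⊗ U) (t : A ⟶ B), t ∈ PartiallyTraced.tr U f →
    canonicalTrace (G.obj U)
      (Functor.LaxMonoidal.μ G A U ≫ G.map f ≫ Functor.OplaxMonoidal.δ G B U) = G.map t

end Traced

end PartialTrace

/-!
The category `PathInt C` is generated by the objects `(a, I)`, by duals `(I, a)` of them, and by the
image of `C`: every object `(a, x)` is isomorphic to `(a, I) ⊗ (I, x)`, and through these
isomorphisms the path of length one on `u : a ⊗ q ⟶ b ⊗ x` is the mate of the image of `u`.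

Uniqueness follows. A monoidal isomorphism `θ : L ≅ L'` is compatible with the dualities, so its
component at `(I, x)` is forced by the one at `(x, I)`, and hence `θ` by its restriction to `C`.
Conversely, a monoidal isomorphism between the restrictions, extended by this recipe, is natural
because forming mates commutes with `L` and `L'`, and it is monoidal because the tensor law
propagates from the generating objects to all of them.

For existence, the canonical trace makes `D` a (totally) traced category, and a trace preserving `G`
induces a braided functor `PathInt C ⥤ PathInt D`. Since `D` has duals, sending an arrow to its mate
is a functor `PathInt D ⥤ D`, whence `embed D : D ⥤ PathInt D` is faithful, and it is an
equivalence. Composing with its inverse gives the extension of `G`.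
-/

namespace PartialTrace

section Duality

open BraidedCategory

variable {E : Type u} [Category.{v} E] [MonoidalCategory E] [SymmetricCategory E]

lemma sw_tensor_tensor (W X Y Z T : E) : sw W (X ⊗ Y) (Z ⊗ T) =
    (α_ _ Z T).inv ≫ (α_ W X Y).inv ▷ Z ▷ T ≫ sw (W ⊗ X) Y Z ▷ T ≫ sw W X Z ▷ Y ▷ T ≫
      sw ((W ⊗ Z) ⊗ X) Y T ≫ sw (W ⊗ Z) X T ▷ Y ≫ (α_ W Z T).hom ▷ X ▷ Y ≫ (α_ _ X Y).hom := by
  simp only [sw, BraidedCategory.braiding_tensor_left_hom, braiding_tensor_right_hom]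
  monoidal

lemma tensorHom_sw {X X' Y Y' Z Z' : E} (f : X ⟶ X') (g : Y ⟶ Y') (h : Z ⟶ Z') :
    ((f ⊗ₘ g) ⊗ₘ h) ≫ sw X' Y' Z' = sw X Y Z ≫ ((f ⊗ₘ h) ⊗ₘ g) := by
  simp only [MonoidalCategory.tensorHom_def, comp_whiskerRight, Category.assoc]
  rw [sw_nat_last, reassoc_of% sw_nat_mid, reassoc_of% sw_nat_head, whisker_exchange]

/-- A morphism `I ⟶ P ⊗ Q`, inserted to the right of `X`. -/
def insertRight {P Q : E} (η : 𝟙_ E ⟶ P ⊗ Q) (X : E) : X ⟶ (X ⊗ P) ⊗ Q :=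
  (ρ_ X).inv ≫ X ◁ η ≫ (α_ X P Q).inv

/-- A morphism `P ⊗ Q ⟶ I`, applied to the right of `X`. -/
def applyRight {P Q : E} (ε : P ⊗ Q ⟶ 𝟙_ E) (X : E) : (X ⊗ P) ⊗ Q ⟶ X :=
  (α_ X P Q).hom ≫ X ◁ ε ≫ (ρ_ X).hom

/-- The unit of an exact pairing of `U'` and `U`, inserted to the right of `X`. The objects are
listed in the order in which they occur in the canonical trace `cup ≫ f ▷ U' ≫ cap`. -/
def cup (U U' : E) [ExactPairing U' U] (X : E) : X ⟶ (X ⊗ U) ⊗ U' :=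
  insertRight (η_ U' U ≫ (β_ U' U).hom) X

/-- The counit of an exact pairing of `U'` and `U`, applied to the right of `X`. -/
def cap (U U' : E) [ExactPairing U' U] (X : E) : (X ⊗ U) ⊗ U' ⟶ X :=
  applyRight (ε_ U' U) X

section

variable {P Q : E} (η : 𝟙_ E ⟶ P ⊗ Q)

omit [SymmetricCategory E] in
lemma comp_insertRight {X Y : E} (f : X ⟶ Y) :
    f ≫ insertRight η Y = insertRight η X ≫ f ▷ P ▷ Q := by
  simp only [insertRight, Category.assoc, ← associator_inv_naturality_left]
  rw [whisker_exchange_assoc, rightUnitor_inv_naturality_assoc]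

omit [SymmetricCategory E] in
lemma insertRight_tensorObj (X Y : E) :
    insertRight η (X ⊗ Y) = X ◁ insertRight η Y ≫ (α_ _ _ _).inv ≫ (α_ _ _ _).inv ▷ Q := by
  simp only [insertRight]; monoidal

lemma insertRight_whiskerRight (X Y : E) :
    insertRight η X ▷ Y = insertRight η (X ⊗ Y) ≫ sw X Y P ▷ Q ≫ sw (X ⊗ P) Y Q := by
  have slide := sw_nat_last X Y η
  rw [sw_unit_last, Category.assoc] at slide
  have sw_pair : sw X Y P ▷ Q ≫ sw (X ⊗ P) Y Q = (α_ _ _ _).hom ≫ sw X Y (P ⊗ Q) ≫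
      (α_ _ _ _).inv ▷ Y := by
    rw [← sw_tensor_last, Iso.hom_inv_id_assoc]
  rw [sw_pair, insertRight, insertRight]
  simp only [Category.assoc, Iso.inv_hom_id_assoc]
  rw [reassoc_of% slide]
  simp

lemma applyRight_whiskerRight (ε : P ⊗ Q ⟶ 𝟙_ E) (X Y : E) :
    applyRight ε X ▷ Y = sw (X ⊗ P) Q Y ≫ sw X P Y ▷ Q ≫ applyRight ε (X ⊗ Y) := by
  have slide := sw_nat_mid X ε Y
  rw [sw_unit_mid] at slide
  have sw_pair : sw (X ⊗ P) Q Y ≫ sw X P Y ▷ Q = (α_ _ _ _).hom ▷ Y ≫ sw X (P ⊗ Q) Y ≫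
      (α_ _ _ _).inv := by
    rw [← sw_tensor_mid, hom_inv_whiskerRight_assoc]
  rw [reassoc_of% sw_pair, applyRight, applyRight]
  simp only [Iso.inv_hom_id_assoc]
  rw [← reassoc_of% slide]
  simp

lemma insertRight_comp_braiding (X : E) :
    insertRight (η ≫ (β_ P Q).hom) X = insertRight η X ≫ sw X P Q := by
  simp [insertRight, sw]

end

variable (U U' V V' : E) [ExactPairing U' U] [ExactPairing V' V]

lemma comp_cup {X Y : E} (f : X ⟶ Y) : f ≫ cup U U' Y = cup U U' X ≫ f ▷ U ▷ U' :=
  comp_insertRight _ f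

omit [SymmetricCategory E] in
lemma whiskerRight_cap {X Y : E} (f : X ⟶ Y) : f ▷ U ▷ U' ≫ cap U U' Y = cap U U' X ≫ f := by
  simp only [cap, applyRight, Category.assoc, associator_naturality_left_assoc]
  rw [← whisker_exchange_assoc, rightUnitor_naturality]

lemma cup_tensorObj (X Y : E) :
    cup U U' (X ⊗ Y) = X ◁ cup U U' Y ≫ (α_ _ _ _).inv ≫ (α_ _ _ _).inv ▷ U' :=
  insertRight_tensorObj _ X Y

omit [SymmetricCategory E] in
lemma cap_tensorObj (X Y : E) :
    cap U U' (X ⊗ Y) = (α_ _ _ _).hom ▷ U' ≫ (α_ _ _ _).hom ≫ X ◁ cap U U' Y := by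
  simp only [cap, applyRight]; monoidal

lemma cup_whiskerRight (X Y : E) :
    cup U U' X ▷ Y = cup U U' (X ⊗ Y) ≫ sw X Y U ▷ U' ≫ sw (X ⊗ U) Y U' :=
  insertRight_whiskerRight _ X Y

lemma cap_whiskerRight (X Y : E) :
    cap U U' X ▷ Y = sw (X ⊗ U) U' Y ≫ sw X U Y ▷ U' ≫ cap U U' (X ⊗ Y) :=
  applyRight_whiskerRight _ X Y

lemma cup_whiskerRight_sw (X Y : E) :
    cup U U' X ▷ Y ≫ sw (X ⊗ U) U' Y = cup U U' (X ⊗ Y) ≫ sw X Y U ▷ U' := by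
  rw [cup_whiskerRight, Category.assoc, Category.assoc, sw_sw, Category.comp_id]

lemma sw_cap_whiskerRight (X Y : E) :
    sw (X ⊗ U) Y U' ≫ cap U U' X ▷ Y = sw X U Y ▷ U' ≫ cap U U' (X ⊗ Y) := by
  rw [cap_whiskerRight, reassoc_of% sw_sw]

lemma cup_sw_cap (X : E) : cup U U' (X ⊗ U) ≫ sw X U U ▷ U' ≫ cap U U' (X ⊗ U) = 𝟙 _ := by
  have triangle : (η_ U' U ≫ (β_ U' U).hom) ▷ U ≫ (α_ U U' U).hom ≫
      U ◁ ((β_ U' U).hom ≫ ε_ U' U) = (λ_ U).hom ≫ (ρ_ U).inv := by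
    nth_rewrite 1 [SymmetricCategory.braiding_swap_eq_inv_braiding]
    exact (exactPairing_swap U' U).evaluation_coevaluation'
  rw [← reassoc_of% cup_whiskerRight_sw]
  calc cup U U' X ▷ U ≫ sw (X ⊗ U) U' U ≫ cap U U' (X ⊗ U)
      = X ◁ ((λ_ U).inv ≫ ((η_ U' U ≫ (β_ U' U).hom) ▷ U ≫ (α_ U U' U).hom ≫
          U ◁ ((β_ U' U).hom ≫ ε_ U' U)) ≫ (ρ_ U).hom) := by
        simp only [cup, insertRight, cap, applyRight, sw]
        monoidal
    _ = 𝟙 _ := by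
        rw [triangle]
        simp

lemma cup_sw_cap_whiskerRight (X : E) :
    cup U U' (X ⊗ U') ≫ sw X U' U ▷ U' ≫ cap U U' X ▷ U' = 𝟙 _ := by
  have triangle : U' ◁ (η_ U' U ≫ (β_ U' U).hom) ≫ (α_ U' U U').inv ≫
      ((β_ U' U).hom ≫ ε_ U' U) ▷ U' = (ρ_ U').hom ≫ (λ_ U').inv := by
    nth_rewrite 1 [SymmetricCategory.braiding_swap_eq_inv_braiding]
    exact (exactPairing_swap U' U).coevaluation_evaluation'
  calc cup U U' (X ⊗ U') ≫ sw X U' U ▷ U' ≫ cap U U' X ▷ U'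
      = X ◁ ((ρ_ U').inv ≫ (U' ◁ (η_ U' U ≫ (β_ U' U).hom) ≫ (α_ U' U U').inv ≫
          ((β_ U' U).hom ≫ ε_ U' U) ▷ U') ≫ (λ_ U').hom) := by
        simp only [cup, insertRight, cap, applyRight, sw]
        monoidal
    _ = 𝟙 _ := by
        rw [triangle]
        simp

lemma cup_tensor (X : E) : cup (U ⊗ V) (V' ⊗ U') X = cup U U' X ≫ cup V V' (X ⊗ U) ▷ U' ≫
    (α_ X U V).hom ▷ V' ▷ U' ≫ (α_ _ V' U').hom := by
  have nested : insertRight (η_ (V' ⊗ U') (U ⊗ V)) X = insertRight (η_ V' V) X ≫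
      insertRight (η_ U' U) (X ⊗ V') ▷ V ≫ (α_ _ U' U).hom ▷ V ≫ (α_ _ _ V).hom ≫
      (α_ X V' _).hom ≫ X ◁ V' ◁ (α_ U' U V).hom ≫ X ◁ (α_ V' U' _).inv ≫ (α_ X _ _).inv := by
    simp only [insertRight, ExactPairing.tensor_coevaluation]
    monoidal
  have slide_cup : cup U U' (X ⊗ V') ≫ sw X V' U ▷ U' = cup U U' X ▷ V' ≫ sw (X ⊗ U) U' V' :=
    (cup_whiskerRight_sw U U' X V').symm
  have slide_cup_whiskerRight := congr($slide_cup ▷ V)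
  simp only [comp_whiskerRight] at slide_cup_whiskerRight
  have letters : insertRight (η_ V' V) X ≫ cup U U' (X ⊗ V') ▷ V ≫ sw X V' U ▷ U' ▷ V ≫
      sw ((X ⊗ U) ⊗ V') U' V ≫ sw (X ⊗ U) V' V ▷ U' = cup U U' X ≫ cup V V' (X ⊗ U) ▷ U' := by
    rw [reassoc_of% slide_cup_whiskerRight, ← reassoc_of% comp_insertRight,
      cup, cup, insertRight_comp_braiding _ (X ⊗ U), comp_whiskerRight, insertRight_whiskerRight]
    simp only [Category.assoc]
  rw [← reassoc_of% letters, cup, insertRight_comp_braiding, nested, sw_tensor_tensor, cup,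
    insertRight_comp_braiding _ (X ⊗ V')]
  monoidal

omit [SymmetricCategory E] in
lemma cap_tensor (X : E) : cap (U ⊗ V) (V' ⊗ U') X = (α_ _ V' U').inv ≫
    (α_ X U V).inv ▷ V' ▷ U' ≫ cap V V' (X ⊗ U) ▷ U' ≫ cap U U' X := by
  simp only [cap, applyRight, ExactPairing.tensor_evaluation]
  monoidal

lemma cup_sw_cap_past (X Z : E) : cup U U' ((X ⊗ U') ⊗ Z) ≫ sw (X ⊗ U') Z U ▷ U' ≫
    sw X U' U ▷ Z ▷ U' ≫ cap U U' X ▷ Z ▷ U' = sw X U' Z := by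
  rw [← reassoc_of% cup_whiskerRight_sw, ← reassoc_of% sw_nat_head, ← sw_nat_head,
    ← comp_whiskerRight_assoc, ← comp_whiskerRight_assoc, Category.assoc,
    cup_sw_cap_whiskerRight, id_whiskerRight, Category.id_comp]

lemma whiskerLeft_eq_cup_cap_source {V U : E} (V' : E) [ExactPairing V' V] (X : E) (g : V ⟶ U) :
    X ◁ g = cup V V' (X ⊗ V) ≫ ((X ⊗ V) ◁ g) ▷ V' ≫ sw X V U ▷ V' ≫ cap V V' (X ⊗ U) := by
  rw [← comp_whiskerRight_assoc, sw_nat_last, comp_whiskerRight_assoc, whiskerRight_cap,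
    reassoc_of% cup_sw_cap]

lemma whiskerLeft_eq_cup_cap_target {V U : E} (U' : E) [ExactPairing U' U] (X : E) (g : V ⟶ U) :
    X ◁ g = cup U U' X ▷ V ≫ sw (X ⊗ U) U' V ≫ ((X ⊗ U) ◁ g) ▷ U' ≫ cap U U' (X ⊗ U) := by
  rw [reassoc_of% cup_whiskerRight_sw, ← comp_whiskerRight_assoc, ← sw_nat_mid,
    comp_whiskerRight_assoc, ← reassoc_of% comp_cup, cup_sw_cap, Category.comp_id]

/-- The trace defined by an exact pairing of `U'` and `U`. -/
def pairingTrace {A B : E} (f : A ⊗ U ⟶ B ⊗ U) : A ⟶ B :=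
  cup U U' A ≫ f ▷ U' ≫ cap U U' B

lemma pairingTrace_naturality {A B A' B' : E} (g : A' ⟶ A) (f : A ⊗ U ⟶ B ⊗ U) (h : B ⟶ B') :
    pairingTrace U U' (g ▷ U ≫ f ≫ h ▷ U) = g ≫ pairingTrace U U' f ≫ h := by
  simp only [pairingTrace, comp_whiskerRight, Category.assoc, whiskerRight_cap,
    reassoc_of% comp_cup]

lemma pairingTrace_strength {A B X Y : E} (f : A ⊗ U ⟶ B ⊗ U) (g : X ⟶ Y) :
    pairingTrace U U' ((α_ X A U).hom ≫ (g ⊗ₘ f) ≫ (α_ Y B U).inv) =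
      g ⊗ₘ pairingTrace U U' f := by
  have left : pairingTrace U U' ((α_ X A U).hom ≫ X ◁ f ≫ (α_ X B U).inv) =
      X ◁ pairingTrace U U' f := by
    simp only [pairingTrace, cup_tensorObj, cap_tensorObj]
    monoidal
  have right := pairingTrace_naturality U U' (𝟙 _) ((α_ X A U).hom ≫ X ◁ f ≫ (α_ X B U).inv)
    (g ▷ B)
  rw [left, Category.id_comp, ← tensorHom_def'] at right
  rw [← right, tensorHom_def']
  simp

lemma pairingTrace_whiskerRight {A B : E} (f : A ⊗ U ⟶ B ⊗ U) (Y : E) :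
    pairingTrace U U' (sw A Y U ≫ f ▷ Y ≫ sw B U Y) = pairingTrace U U' f ▷ Y := by
  simp only [pairingTrace, comp_whiskerRight, Category.assoc, cap_whiskerRight, cup_whiskerRight,
    reassoc_of% sw_nat_head, reassoc_of% sw_sw]

lemma pairingTrace_braiding : pairingTrace U U' (β_ U U).hom = 𝟙 U := by
  have sw_unit : sw (𝟙_ E) U U = (λ_ U).hom ▷ U ≫ (β_ U U).hom ≫ (λ_ U).inv ▷ U := by
    simp [sw]
  have yank : pairingTrace U U' (sw (𝟙_ E) U U) = 𝟙 _ := cup_sw_cap U U' (𝟙_ E)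
  rw [sw_unit, pairingTrace_naturality] at yank
  rw [← cancel_epi (λ_ U).hom, ← cancel_mono (λ_ U).inv]
  simpa using yank

lemma cap_comp_cap (B : E) : sw B V U ▷ U' ▷ V' ≫ sw ((B ⊗ U) ⊗ V) U' V' ≫
    cap V V' (B ⊗ U) ▷ U' ≫ cap U U' B = cap U U' (B ⊗ V) ▷ V' ≫ cap V V' B := by
  have slide : sw ((B ⊗ U) ⊗ V) U' V' ≫ cap V V' (B ⊗ U) ▷ U' =
      sw (B ⊗ U) V U' ▷ V' ≫ cap V V' ((B ⊗ U) ⊗ U') := sw_cap_whiskerRight V V' (B ⊗ U) U'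
  rw [reassoc_of% slide, ← whiskerRight_cap, ← comp_whiskerRight_assoc, ← comp_whiskerRight_assoc,
    Category.assoc, sw_cap_whiskerRight, ← comp_whiskerRight_assoc, sw_sw, id_whiskerRight,
    Category.id_comp]

lemma cup_comp_cup (A : E) : cup U U' A ≫ cup V V' (A ⊗ U) ▷ U' =
    cup V V' A ≫ cup U U' A ▷ V ▷ V' ≫ sw (A ⊗ U) U' V ▷ V' ≫ sw ((A ⊗ U) ⊗ V) U' V' := by
  rw [cup_whiskerRight, ← reassoc_of% comp_cup]

lemma pairingTrace_dinaturality {A B : E} (f : A ⊗ U ⟶ B ⊗ V) (g : V ⟶ U) :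
    pairingTrace U U' (f ≫ B ◁ g) = pairingTrace V V' (A ◁ g ≫ f) := by
  have expand_left : f ≫ B ◁ g = cup V V' (A ⊗ U) ≫ (f ▷ V ≫ (B ⊗ V) ◁ g ≫ sw B V U) ▷ V' ≫
      cap V V' (B ⊗ U) := by
    rw [whiskerLeft_eq_cup_cap_source V', reassoc_of% comp_cup]
    simp only [comp_whiskerRight, Category.assoc]
  have expand_right : A ◁ g ≫ f = cup U U' A ▷ V ≫ sw (A ⊗ U) U' V ≫
      ((A ⊗ U) ◁ g ≫ f ▷ U) ▷ U' ≫ cap U U' (B ⊗ V) := by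
    rw [whiskerLeft_eq_cup_cap_target U', comp_whiskerRight]
    simp only [Category.assoc, whiskerRight_cap]
  rw [pairingTrace, pairingTrace, expand_left, expand_right]
  simp only [comp_whiskerRight, Category.assoc]
  rw [reassoc_of% cup_comp_cup, ← cap_comp_cap U U' V V', ← reassoc_of% sw_nat_head (f ▷ V),
    ← reassoc_of% sw_nat_head ((B ⊗ V) ◁ g), ← reassoc_of% sw_nat_head (sw B V U)]
  simp only [← comp_whiskerRight_assoc, whisker_exchange]

end Duality

section PairingHom

variable {E : Type u} [Category.{v} E] [MonoidalCategory E]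
variable {U U' V V' W W' T T' : E} [ExactPairing U' U] [ExactPairing V' V] [ExactPairing W' W]
  [ExactPairing T' T]

/-- Two morphisms between the components of exact pairings that are compatible with the units and
the counits. -/
structure IsPairingHom (s : U ⟶ W) (s' : U' ⟶ W') : Prop where
  unit : η_ U' U ≫ (s' ⊗ₘ s) = η_ W' W
  counit : (s ⊗ₘ s') ≫ ε_ W' W = ε_ U' U

variable (U' W') in
/-- The morphism of left duals induced by `g`, for arbitrary choices of the duals. -/
def transpose (g : W ⟶ U) : U' ⟶ W' :=
  @leftAdjointMate E _ _ W U ⟨W'⟩ ⟨U'⟩ g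

lemma isPairingHom_transpose (s : U ≅ W) : IsPairingHom s.hom (transpose U' W' s.inv) where
  unit := by
    have unit_naturality : η_ U' U ≫ transpose U' W' s.inv ▷ U = η_ W' W ≫ W' ◁ s.inv :=
      @coevaluation_comp_leftAdjointMate E _ _ W U ⟨W'⟩ ⟨U'⟩ s.inv
    rw [MonoidalCategory.tensorHom_def, reassoc_of% unit_naturality, whiskerLeft_inv_hom,
      Category.comp_id]
  counit := by
    have counit_naturality : W ◁ transpose U' W' s.inv ≫ ε_ W' W = s.inv ▷ U' ≫ ε_ U' U :=
      @leftAdjointMate_comp_evaluation E _ _ W U ⟨W'⟩ ⟨U'⟩ s.inv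
    rw [MonoidalCategory.tensorHom_def, Category.assoc, counit_naturality,
      hom_inv_whiskerRight_assoc]

/-- The isomorphism of left duals induced by an isomorphism, for arbitrary choices of the
duals. -/
def transposeIso (U' W' : E) [ExactPairing U' U] [ExactPairing W' W] (s : U ≅ W) : U' ≅ W' where
  hom := transpose U' W' s.inv
  inv := transpose W' U' s.hom
  hom_inv_id := by
    have comp := @comp_leftAdjointMate E _ _ U W U ⟨U'⟩ ⟨W'⟩ ⟨U'⟩ s.hom s.inv
    rw [s.hom_inv_id, @leftAdjointMate_id E _ _ U ⟨U'⟩] at comp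
    exact comp.symm
  inv_hom_id := by
    have comp := @comp_leftAdjointMate E _ _ W U W ⟨W'⟩ ⟨U'⟩ ⟨W'⟩ s.inv s.hom
    rw [s.inv_hom_id, @leftAdjointMate_id E _ _ W ⟨W'⟩] at comp
    exact comp.symm

namespace IsPairingHom

variable {s : U ⟶ W} {s' : U' ⟶ W'}

lemma comp {t : W ⟶ V} {t' : W' ⟶ V'} (h : IsPairingHom s s') (h' : IsPairingHom t t') :
    IsPairingHom (s ≫ t) (s' ≫ t') where
  unit := by rw [← MonoidalCategory.tensorHom_comp_tensorHom, reassoc_of% h.unit, h'.unit]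
  counit := by
    rw [← MonoidalCategory.tensorHom_comp_tensorHom, Category.assoc, h'.counit, h.counit]

lemma unique [IsIso s] {s'' : U' ⟶ W'} (h : IsPairingHom s s') (h' : IsPairingHom s s'') :
    s' = s'' := by
  have counit_eq : W ◁ s' ≫ ε_ W' W = W ◁ s'' ≫ ε_ W' W := by
    rw [← cancel_epi (s ▷ U'), ← tensorHom_def_assoc, ← tensorHom_def_assoc, h.counit, h'.counit]
  have apply_evaluation (t : U' ⟶ W') : (tensorLeftHomEquiv U' W' W (𝟙_ E)).symm
      (t ≫ (ρ_ W').inv) = W ◁ t ≫ ε_ W' W := by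
    have unitors : (ρ_ (𝟙_ E)).inv ≫ (λ_ (𝟙_ E)).hom = 𝟙 _ := by monoidal
    simp [tensorLeftHomEquiv, unitors]
  rw [← cancel_mono (ρ_ W').inv, ← (tensorLeftHomEquiv U' W' W (𝟙_ E)).symm.injective.eq_iff,
    apply_evaluation, apply_evaluation, counit_eq]

variable (T T') in
lemma whiskerRight (h : IsPairingHom s s') : IsPairingHom (s ▷ T) (T' ◁ s') where
  unit := by
    rw [ExactPairing.tensor_coevaluation, ExactPairing.tensor_coevaluation, ← h.unit,
      MonoidalCategory.tensorHom_def, MonoidalCategory.tensorHom_def]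
    monoidal
  counit := by
    rw [ExactPairing.tensor_evaluation, ExactPairing.tensor_evaluation, ← h.counit,
      tensorHom_def', tensorHom_def']
    calc ((U ⊗ T) ◁ T' ◁ s' ≫ s ▷ T ▷ (T' ⊗ W')) ≫ (𝟙 _ ⊗≫ W ◁ ε_ T' T ▷ W' ⊗≫ ε_ W' W)
        = 𝟙 _ ⊗≫ U ◁ ((T ⊗ T') ◁ s') ⊗≫
            (s ▷ ((T ⊗ T') ⊗ W') ≫ W ◁ ε_ T' T ▷ W') ⊗≫ ε_ W' W := by monoidal
      _ = 𝟙 _ ⊗≫ U ◁ ((T ⊗ T') ◁ s' ≫ ε_ T' T ▷ W') ⊗≫ s ▷ W' ⊗≫ ε_ W' W := by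
        rw [← whisker_exchange]
        monoidal
      _ = 𝟙 _ ⊗≫ U ◁ ε_ T' T ▷ U' ⊗≫ (U ◁ s' ≫ s ▷ W') ≫ ε_ W' W := by
        rw [whisker_exchange]
        monoidal

variable (T T') in
lemma whiskerLeft (h : IsPairingHom s s') : IsPairingHom (T ◁ s) (s' ▷ T') where
  unit := by
    rw [ExactPairing.tensor_coevaluation, ExactPairing.tensor_coevaluation, ← h.unit,
      tensorHom_def', tensorHom_def']
    calc (η_ U' U ⊗≫ (U' ◁ η_ T' T) ▷ U ⊗≫ 𝟙 _) ≫ ((U' ⊗ T') ◁ T ◁ s ≫ s' ▷ T' ▷ (T ⊗ W))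
        = η_ U' U ⊗≫ U' ◁ (η_ T' T ▷ U ≫ (T' ⊗ T) ◁ s) ⊗≫ s' ▷ ((T' ⊗ T) ⊗ W) ⊗≫ 𝟙 _ := by
          monoidal
      _ = η_ U' U ⊗≫ U' ◁ s ⊗≫ (U' ◁ η_ T' T ▷ W ≫ s' ▷ ((T' ⊗ T) ⊗ W)) ⊗≫ 𝟙 _ := by
        rw [← whisker_exchange]
        monoidal
      _ = (η_ U' U ≫ U' ◁ s ≫ s' ▷ W) ⊗≫ (W' ◁ η_ T' T) ▷ W ⊗≫ 𝟙 _ := by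
        rw [whisker_exchange]
        monoidal
  counit := by
    rw [ExactPairing.tensor_evaluation, ExactPairing.tensor_evaluation, ← h.counit,
      MonoidalCategory.tensorHom_def, MonoidalCategory.tensorHom_def]
    monoidal

lemma tensor {r : V ⟶ T} {r' : V' ⟶ T'} (h : IsPairingHom s s') (h' : IsPairingHom r r') :
    IsPairingHom (s ⊗ₘ r) (r' ⊗ₘ s') := by
  rw [MonoidalCategory.tensorHom_def, tensorHom_def']
  exact (h.whiskerRight V V').comp (h'.whiskerLeft W W')

end IsPairingHom
end PairingHom

section Mates

variable {E : Type u} [Category.{v} E] [MonoidalCategory E]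

lemma tensorHom_whiskerRight_comm {X Y X₁ Y₁ Z Z₁ : E} {p : X ⟶ X₁} {f : X ⟶ Y} {f₁ : X₁ ⟶ Y₁}
    {q : Y ⟶ Y₁} (comm : p ≫ f₁ = f ≫ q) (r : Z ⟶ Z₁) :
    (p ⊗ₘ r) ≫ f₁ ▷ Z₁ = f ▷ Z ≫ (q ⊗ₘ r) := by
  rw [tensorHom_def'_assoc, ← comp_whiskerRight, comm, comp_whiskerRight, whisker_exchange_assoc,
    ← tensorHom_def']

variable {U U' W W' : E} [ExactPairing U' U] [ExactPairing W' W]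

lemma IsPairingHom.tensorHom_cap {s : U ⟶ W} {s' : U' ⟶ W'} (h : IsPairingHom s s') {X Y : E}
    (u : X ⟶ Y) : ((u ⊗ₘ s) ⊗ₘ s') ≫ cap W W' Y = cap U U' X ≫ u := by
  rw [← whiskerRight_cap, cap, cap, applyRight, applyRight, ← h.counit, associator_naturality_assoc,
    associator_naturality_left_assoc, tensorHom_def_assoc,
    MonoidalCategory.whiskerLeft_comp_assoc]

variable [SymmetricCategory E]

lemma IsPairingHom.cup_tensorHom {s : U ⟶ W} {s' : U' ⟶ W'} (h : IsPairingHom s s') {X Y : E}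
    (u : X ⟶ Y) : cup U U' X ≫ ((u ⊗ₘ s) ⊗ₘ s') = u ≫ cup W W' Y := by
  rw [comp_cup, cup, cup, ← h.unit]
  simp only [insertRight, Category.assoc, BraidedCategory.braiding_naturality,
    ← associator_inv_naturality]
  rw [tensorHom_def']
  simp

variable {A B C a b c : E} (a' b' c' : E) [ExactPairing a' a] [ExactPairing b' b]
  [ExactPairing c' c]

/-- The mate of a morphism `A ⊗ b ⟶ B ⊗ a` with respect to dualities of `a` and of `b`. -/
def mate (f : A ⊗ b ⟶ B ⊗ a) : A ⊗ a' ⟶ B ⊗ b' :=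
  cup b b' (A ⊗ a') ≫ sw A a' b ▷ b' ≫ f ▷ a' ▷ b' ≫ cap a a' B ▷ b'

lemma mate_whiskerRight_comp_cap (f : A ⊗ b ⟶ B ⊗ a) (g : B ⊗ c ⟶ C ⊗ b) :
    mate a' b' f ▷ c ≫ sw B b' c ≫ g ▷ b' ≫ cap b b' C =
      sw A a' c ≫ pairingTrace b b' (sw A c b ≫ f ▷ c ≫ sw B a c ≫ g ▷ a ≫ sw C b a) ▷ a' ≫
        cap a a' C := by
  have cap_comp : cap a a' B ▷ c ≫ g =
      sw (B ⊗ a) a' c ≫ sw B a c ▷ a' ≫ g ▷ a ▷ a' ≫ cap a a' (C ⊗ b) := by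
    rw [cap_whiskerRight, whiskerRight_cap]
    simp only [Category.assoc]
  have slide : sw (A ⊗ a') c b ≫ sw A a' b ▷ c ≫ f ▷ a' ▷ c ≫ cap a a' B ▷ c ≫ g =
      sw A a' c ▷ b ≫ sw (A ⊗ c) a' b ≫ sw A c b ▷ a' ≫ f ▷ c ▷ a' ≫ sw B a c ▷ a' ≫
        g ▷ a ▷ a' ≫ cap a a' (C ⊗ b) := by
    rw [cap_comp, reassoc_of% sw_nat_head, ← reassoc_of% (sw_braid A a' c b)]
  have slide_whiskerRight := congr($slide ▷ b')
  simp only [comp_whiskerRight] at slide_whiskerRight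
  simp only [mate, pairingTrace, comp_whiskerRight, Category.assoc, cup_whiskerRight]
  rw [← reassoc_of% sw_nat_head (sw A a' b), ← reassoc_of% sw_nat_head (f ▷ a'),
    ← reassoc_of% sw_nat_head (cap a a' B)]
  simp only [reassoc_of% sw_sw]
  rw [reassoc_of% slide_whiskerRight, ← reassoc_of% comp_cup, ← cap_comp_cap]
  simp only [reassoc_of% sw_nat_head]

lemma mate_comp (f : A ⊗ b ⟶ B ⊗ a) (g : B ⊗ c ⟶ C ⊗ b) :
    mate a' b' f ≫ mate b' c' g = mate a' c'
      (pairingTrace b b' (sw A c b ≫ f ▷ c ≫ sw B a c ≫ g ▷ a ≫ sw C b a)) := by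
  rw [mate.eq_1 b' c', mate.eq_1 a' c', reassoc_of% comp_cup]
  simp only [← comp_whiskerRight]
  rw [mate_whiskerRight_comp_cap]

lemma mate_naturality {A₁ B₁ a₁ a₁' b₁ b₁' : E} [ExactPairing a₁' a₁] [ExactPairing b₁' b₁]
    {sa : a ⟶ a₁} {sa' : a' ⟶ a₁'} {sb : b ⟶ b₁} {sb' : b' ⟶ b₁'}
    (ha : IsPairingHom sa sa') (hb : IsPairingHom sb sb') (u : A ⟶ A₁) (w : B ⟶ B₁)
    {f : A ⊗ b ⟶ B ⊗ a} {f₁ : A₁ ⊗ b₁ ⟶ B₁ ⊗ a₁} (comm : (u ⊗ₘ sb) ≫ f₁ = f ≫ (w ⊗ₘ sa)) :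
    (u ⊗ₘ sa') ≫ mate a₁' b₁' f₁ = mate a' b' f ≫ (w ⊗ₘ sb') := by
  have sw_square := tensorHom_whiskerRight_comm (tensorHom_sw u sa' sb) sb'
  have f_square := tensorHom_whiskerRight_comm (tensorHom_whiskerRight_comm comm sa') sb'
  have cap_square := tensorHom_whiskerRight_comm (ha.tensorHom_cap w) sb'
  simp only [mate, Category.assoc]
  rw [← reassoc_of% hb.cup_tensorHom, reassoc_of% sw_square, reassoc_of% f_square, cap_square]

end Mates

section Map

open Functor.LaxMonoidal Functor.OplaxMonoidal Functor.Monoidal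

variable {E : Type u} [Category.{v} E] [MonoidalCategory E]
  {E' : Type u₂} [Category.{v₂} E'] [MonoidalCategory E'] (L : E ⥤ E')
  [L.Monoidal] (U U' : E) [ExactPairing U' U]

instance mapExactPairing : ExactPairing (L.obj U') (L.obj U) where
  coevaluation' := Functor.LaxMonoidal.ε L ≫ L.map (η_ U' U) ≫ δ L U' U
  evaluation' := μ L U U' ≫ L.map (ε_ U' U) ≫ Functor.OplaxMonoidal.η L
  coevaluation_evaluation' := by
    have triangle := congr(L.map $(ExactPairing.coevaluation_evaluation U' U))
    simp only [Functor.map_comp, map_whiskerLeft, map_whiskerRight, map_associator_inv,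
      map_rightUnitor, map_leftUnitor_inv] at triangle
    rw [← cancel_epi (L.obj U ◁ Functor.OplaxMonoidal.η L), ← cancel_epi (δ L _ _),
      ← cancel_mono (Functor.LaxMonoidal.ε L ▷ L.obj U), ← cancel_mono (μ L _ _)]
    simpa using triangle
  evaluation_coevaluation' := by
    have triangle := congr(L.map $(ExactPairing.evaluation_coevaluation U' U))
    simp only [Functor.map_comp, map_whiskerLeft, map_whiskerRight, map_associator,
      map_leftUnitor, map_rightUnitor_inv] at triangle
    rw [← cancel_epi (Functor.OplaxMonoidal.η L ▷ L.obj U'), ← cancel_epi (δ L _ _),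
      ← cancel_mono (L.obj U' ◁ Functor.LaxMonoidal.ε L), ← cancel_mono (μ L _ _)]
    simpa using triangle

lemma coevaluation_map : η_ (L.obj U') (L.obj U) =
    Functor.LaxMonoidal.ε L ≫ L.map (η_ U' U) ≫ δ L U' U :=
  rfl

lemma evaluation_map : ε_ (L.obj U') (L.obj U) =
    μ L U U' ≫ L.map (ε_ U' U) ≫ Functor.OplaxMonoidal.η L :=
  rfl

variable {U U'} in
lemma IsPairingHom.map {W W' : E} [ExactPairing W' W] {s : U ⟶ W} {s' : U' ⟶ W'}
    (h : IsPairingHom s s') : IsPairingHom (L.map s) (L.map s') where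
  unit := by
    rw [coevaluation_map, coevaluation_map, ← h.unit]
    simp
  counit := by
    rw [evaluation_map, evaluation_map, ← h.counit]
    simp

lemma cap_map (X : E) : μ L X U ▷ L.obj U' ≫ μ L (X ⊗ U) U' ≫ L.map (cap U U' X) =
    cap (L.obj U) (L.obj U') (L.obj X) := by
  simp [cap, applyRight, evaluation_map]

end Map

section BraidedMap

open Functor.LaxMonoidal Functor.OplaxMonoidal Functor.Monoidal

variable {E : Type u} [Category.{v} E] [MonoidalCategory E] [SymmetricCategory E]
  {E' : Type u₂} [Category.{v₂} E'] [MonoidalCategory E'] [SymmetricCategory E']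
  (L : E ⥤ E') [L.Braided]

lemma μ_map_sw (X Y Z : E) : μ L X Y ▷ L.obj Z ≫ μ L (X ⊗ Y) Z ≫ L.map (sw X Y Z) =
    sw (L.obj X) (L.obj Y) (L.obj Z) ≫ μ L X Z ▷ L.obj Y ≫ μ L (X ⊗ Z) Y := by
  have associativity_inv := Functor.LaxMonoidal.associativity_inv L X Z Y
  have braided := Functor.LaxBraided.braided (F := L) Y Z
  simp only [sw, Functor.map_comp, Category.assoc]
  rw [Functor.LaxMonoidal.associativity_assoc, ← μ_natural_right_assoc, ← associativity_inv,
    ← MonoidalCategory.whiskerLeft_comp_assoc, braided]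
  simp

omit [SymmetricCategory E] [SymmetricCategory E'] in
lemma insertRight_map {L : E ⥤ E'} [L.Monoidal] {P Q : E} (η : 𝟙_ E ⟶ P ⊗ Q) (X : E) :
    insertRight (Functor.LaxMonoidal.ε L ≫ L.map η ≫ δ L P Q) (L.obj X) ≫
      μ L X P ▷ L.obj Q ≫ μ L (X ⊗ P) Q = L.map (insertRight η X) := by
  simp [insertRight]

lemma cup_map (U U' : E) [ExactPairing U' U] (X : E) :
    cup (L.obj U) (L.obj U') (L.obj X) ≫ μ L X U ▷ L.obj U' ≫ μ L (X ⊗ U) U' =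
      L.map (cup U U' X) := by
  have coevaluation_braiding : η_ (L.obj U') (L.obj U) ≫ (β_ (L.obj U') (L.obj U)).hom =
      Functor.LaxMonoidal.ε L ≫ L.map (η_ U' U ≫ (β_ U' U).hom) ≫ δ L U U' := by
    simp [coevaluation_map, Functor.map_braiding]
  rw [cup, coevaluation_braiding]
  exact insertRight_map _ X

lemma mate_map {A B a b : E} (a' b' : E) [ExactPairing a' a] [ExactPairing b' b]
    (f : A ⊗ b ⟶ B ⊗ a) :
    mate (L.obj a') (L.obj b') (μ L A b ≫ L.map f ≫ δ L B a) ≫ μ L B b' =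
      μ L A a' ≫ L.map (mate a' b' f) := by
  have map_sw := μ_map_sw L A a' b
  have map_cap := cap_map L a a' B
  simp only [mate, Functor.map_comp, Category.assoc]
  rw [← cup_map, Category.assoc, Category.assoc, reassoc_of% comp_cup,
    ← μ_natural_left_assoc, ← μ_natural_left_assoc, ← μ_natural_left]
  simp only [← comp_whiskerRight_assoc]
  rw [reassoc_of% map_sw, ← μ_natural_left_assoc, ← map_cap]
  simp

end BraidedMap

section TraceLaws

variable {E : Type u} [Category.{v} E] [MonoidalCategory E] [SymmetricCategory E]

lemma pairingTrace_eq_of_dual (U U' U'' : E) [ExactPairing U' U] [ExactPairing U'' U] {A B : E}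
    (f : A ⊗ U ⟶ B ⊗ U) : pairingTrace U U' f = pairingTrace U U'' f := by
  simpa using pairingTrace_dinaturality U U' U U'' f (𝟙 U)

lemma pairingTrace_unit {A B : E} (f : A ⊗ 𝟙_ E ⟶ B ⊗ 𝟙_ E) :
    pairingTrace (𝟙_ E) (𝟙_ E) f = (ρ_ A).inv ≫ f ≫ (ρ_ B).hom := by
  have coevaluation : η_ (𝟙_ E) (𝟙_ E) ≫ (β_ (𝟙_ E) (𝟙_ E)).hom = (ρ_ (𝟙_ E)).inv := by
    simp [ExactPairing.coevaluation, ExactPairing.coevaluation', unitors_inv_equal]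
  have evaluation : ε_ (𝟙_ E) (𝟙_ E) = (ρ_ (𝟙_ E)).hom := rfl
  simp only [pairingTrace, cup, cap, insertRight, applyRight, coevaluation, evaluation]
  monoidal

variable (U U' V V' : E) [ExactPairing U' U] [ExactPairing V' V]

lemma pairingTrace_tensor {A B : E} (f : (A ⊗ U) ⊗ V ⟶ (B ⊗ U) ⊗ V) :
    pairingTrace (U ⊗ V) (V' ⊗ U') ((α_ A U V).inv ≫ f ≫ (α_ B U V).hom) =
      pairingTrace U U' (pairingTrace V V' f) := by
  simp only [pairingTrace, cup_tensor, cap_tensor]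
  monoidal

variable {U V} in
lemma pairingTrace_conj (s : V ≅ U) {A B : E} (f : A ⊗ V ⟶ B ⊗ V) :
    pairingTrace V V' f = pairingTrace U U' (A ◁ s.inv ≫ f ≫ B ◁ s.hom) := by
  rw [← Category.assoc, pairingTrace_dinaturality U U' V V', whiskerLeft_hom_inv_assoc]

lemma pairingTrace_nested {A B C a b c : E} (b' W' : E) [ExactPairing b' b]
    [ExactPairing W' (V ⊗ b)] (q : (A ⊗ V) ⊗ b ⟶ (B ⊗ a) ⊗ V) (f : B ⊗ c ⟶ C ⊗ b) :
    pairingTrace (V ⊗ b) W' (sw A c (V ⊗ b) ≫ (α_ A V b).inv ▷ c ≫ q ▷ c ≫ sw (B ⊗ a) V c ≫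
      sw B a c ▷ V ≫ f ▷ a ▷ V ≫ sw C b a ▷ V ≫ sw (C ⊗ a) b V ≫ (α_ (C ⊗ a) V b).hom) =
    pairingTrace b b' (sw A c b ≫ pairingTrace V V' (sw A b V ≫ q) ▷ c ≫ sw B a c ≫ f ▷ a ≫
      sw C b a) := by
  have input : (A ⊗ c) ◁ (β_ b V).hom ≫ sw A c (V ⊗ b) ≫ (α_ A V b).inv ▷ c =
      (α_ _ _ _).inv ≫ sw A c b ▷ V ≫ sw (A ⊗ b) c V ≫ sw A b V ▷ c := by
    rw [← sw_tensor_last, sw_eq_braid, sw_braid]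
    simp
  have output : sw (C ⊗ a) b V ≫ (α_ (C ⊗ a) V b).hom ≫ (C ⊗ a) ◁ (β_ V b).hom =
      (α_ _ _ _).hom := by
    rw [sw_eq_braid, Iso.hom_inv_id_assoc, reassoc_of% sw_sw]
  have absorb := pairingTrace_naturality V V' (sw A c b)
    (sw (A ⊗ b) c V ≫ (sw A b V ≫ q) ▷ c ≫ sw (B ⊗ a) V c) (sw B a c ≫ f ▷ a ≫ sw C b a)
  rw [pairingTrace_conj (V' ⊗ b') W' (β_ V b), ← pairingTrace_whiskerRight, ← absorb,
    ← pairingTrace_tensor, ← SymmetricCategory.braiding_swap_eq_inv_braiding]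
  simp only [Category.assoc]
  rw [reassoc_of% input, output]
  simp only [Category.assoc, comp_whiskerRight]

end TraceLaws

section MateLaws

variable {E : Type u} [Category.{v} E] [MonoidalCategory E] [SymmetricCategory E]
lemma cup_sw_cap_past_whiskerRight {A B a b : E} (a' y y' : E) [ExactPairing y' y]
    (f : A ⊗ b ⟶ B ⊗ a) :
    cup y y' (((A ⊗ y') ⊗ a') ⊗ b) ≫ sw (A ⊗ y') a' b ▷ y ▷ y' ≫ sw A y' b ▷ a' ▷ y ▷ y' ≫
      sw ((A ⊗ b) ⊗ y') a' y ▷ y' ≫ sw (A ⊗ b) y' y ▷ a' ▷ y' ≫ f ▷ y ▷ y' ▷ a' ▷ y' ≫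
      cap y y' (B ⊗ a) ▷ a' ▷ y' =
    sw A y' a' ▷ b ≫ sw (A ⊗ a') y' b ≫ sw A a' b ▷ y' ≫ f ▷ a' ▷ y' := by
  have slide : sw ((A ⊗ b) ⊗ y') a' y ▷ y' ≫ sw (A ⊗ b) y' y ▷ a' ▷ y' ≫ f ▷ y ▷ y' ▷ a' ▷ y' =
      f ▷ y' ▷ a' ▷ y ▷ y' ≫ sw ((B ⊗ a) ⊗ y') a' y ▷ y' ≫ sw (B ⊗ a) y' y ▷ a' ▷ y' := by
    simp only [← comp_whiskerRight]
    rw [reassoc_of% sw_nat_head, ← comp_whiskerRight, sw_nat_head]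
  rw [reassoc_of% slide, ← reassoc_of% comp_cup, ← reassoc_of% comp_cup, ← reassoc_of% comp_cup,
    cup_sw_cap_past, sw_nat_head, reassoc_of% (sw_braid A y' a' b)]

variable {A B a b : E} (a' b' : E) [ExactPairing a' a] [ExactPairing b' b]

lemma mate_id : mate a' a' (𝟙 (A ⊗ a)) = 𝟙 _ := by
  rw [mate, id_whiskerRight, id_whiskerRight, Category.id_comp, cup_sw_cap_whiskerRight]

lemma mate_whiskerRight (f : A ⟶ B) : mate a' a' (f ▷ a) = f ▷ a' := by
  rw [mate, ← comp_whiskerRight, whiskerRight_cap, comp_whiskerRight,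
    reassoc_of% cup_sw_cap_whiskerRight]

lemma whiskerLeft_mate (f : A ⊗ b ⟶ B ⊗ a) (X : E) :
    mate a' b' ((α_ X A b).hom ≫ X ◁ f ≫ (α_ X B a).inv) =
      (α_ _ _ _).hom ≫ X ◁ mate a' b' f ≫ (α_ _ _ _).inv := by
  simp only [mate, cup_tensorObj, cap_tensorObj, sw_tensor_head]
  monoidal

lemma mate_tensor (y y' : E) [ExactPairing y' y] (f : A ⊗ b ⟶ B ⊗ a) :
    mate (y' ⊗ a') (y' ⊗ b') ((α_ A b y).inv ≫ f ▷ y ≫ (α_ B a y).hom) ≫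
      (α_ B y' b').inv ≫ sw B y' b' = (α_ A y' a').inv ≫ sw A y' a' ≫ mate a' b' f ▷ y' := by
  have yank := congr($(cup_sw_cap_past_whiskerRight a' y y' f) ▷ b')
  simp only [comp_whiskerRight] at yank
  have letters : cup b b' ((A ⊗ y') ⊗ a') ≫ cup y y' (((A ⊗ y') ⊗ a') ⊗ b) ▷ b' ≫
      sw (A ⊗ y') a' b ▷ y ▷ y' ▷ b' ≫ sw A y' b ▷ a' ▷ y ▷ y' ▷ b' ≫
      sw ((A ⊗ b) ⊗ y') a' y ▷ y' ▷ b' ≫ sw (A ⊗ b) y' y ▷ a' ▷ y' ▷ b' ≫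
      f ▷ y ▷ y' ▷ a' ▷ y' ▷ b' ≫ cap y y' (B ⊗ a) ▷ a' ▷ y' ▷ b' ≫ cap a a' B ▷ y' ▷ b' ≫
      sw B y' b' = sw A y' a' ≫ mate a' b' f ▷ y' := by
    rw [reassoc_of% yank, mate]
    simp only [comp_whiskerRight, Category.assoc, cup_whiskerRight]
    rw [← reassoc_of% comp_cup]
    simp only [← reassoc_of% sw_nat_head, ← sw_nat_head]
  rw [← letters, mate, cup_tensor, cap_tensor, sw_tensor_tensor]
  simp only [cup, cap, insertRight, applyRight]
  monoidal

end MateLaws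

section Paths

variable {Q : Type u₁} [Quiver.{v₁} Q] {K : Type u₂} [Category.{v₂} K] {L : Type u} [Category.{v} L]

lemma composePath_naturality {F G : Q ⥤q K} (τ : ∀ X, F.obj X ⟶ G.obj X)
    (naturality : ∀ {X Y : Q} (f : X ⟶ Y), F.map f ≫ τ Y = τ X ≫ G.map f)
    {X Y : Q} (p : Quiver.Path X Y) :
    composePath (F.mapPath p) ≫ τ Y = τ X ≫ composePath (G.mapPath p) := by
  induction p with
  | nil => simp
  | cons p f ih => simp [naturality, reassoc_of% ih]

lemma composePath_mapPath_functor (T : K ⥤ L) {X Y : K} (p : Quiver.Path X Y) :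
    composePath (T.toPrefunctor.mapPath p) = T.map (composePath p) := by
  induction p with
  | nil => exact (T.map_id _).symm
  | cons p f ih =>
    rw [Prefunctor.mapPath_cons, composePath_cons, ih, composePath_cons, T.map_comp]
    rfl

lemma composePath_eq_of_natural_iso {F : Q ⥤q K} {G : Q ⥤q L} (T : K ⥤ L)
    (τ : ∀ X, G.obj X ≅ T.obj (F.obj X))
    (naturality : ∀ {X Y : Q} (f : X ⟶ Y), G.map f ≫ (τ Y).hom = (τ X).hom ≫ T.map (F.map f))
    {X Y : Q} {p q : Quiver.Path X Y}
    (h : composePath (F.mapPath p) = composePath (F.mapPath q)) :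
    composePath (G.mapPath p) = composePath (G.mapPath q) := by
  have transport (r : Quiver.Path X Y) : composePath (G.mapPath r) ≫ (τ Y).hom =
      (τ X).hom ≫ T.map (composePath (F.mapPath r)) := by
    rw [← composePath_mapPath_functor, ← Prefunctor.mapPath_comp_apply]
    exact composePath_naturality (G := F ⋙q T.toPrefunctor) (fun X => (τ X).hom) naturality r
  rw [← cancel_mono (τ Y).hom, transport, transport, h]

end Paths

section Lift

variable {C : Type u₁} [Category.{v₁} C] [MonoidalCategory C] [SymmetricCategory C]
  [PartiallyTraced C] {K : Type u₂} [Category.{v₂} K]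

open IntP

lemma isCongruence_composePath (H : IntP C ⥤q K)
    (map_comp : ∀ {A B : IntP C} {p : Quiver.Path A B} {f : A ⟶ B}, f ∈ comp p →
      composePath (H.mapPath p) = H.map f)
    (left right : IntP C → K ⥤ K)
    (leftIso : ∀ X A, H.obj ((tensorLeft X).obj A) ≅ (left X).obj (H.obj A))
    (rightIso : ∀ X A, H.obj ((tensorRight X).obj A) ≅ (right X).obj (H.obj A))
    (left_naturality : ∀ X {A B : IntP C} (f : A ⟶ B),
      H.map ((tensorLeft X).map f) ≫ (leftIso X B).hom =
        (leftIso X A).hom ≫ (left X).map (H.map f))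
    (right_naturality : ∀ X {A B : IntP C} (f : A ⟶ B),
      H.map ((tensorRight X).map f) ≫ (rightIso X B).hom =
        (rightIso X A).hom ≫ (right X).map (H.map f)) :
    IsCongruence (C := C)
      (fun _ _ p q => composePath (H.mapPath p) = composePath (H.mapPath q)) where
  equivalence _ _ := ⟨fun _ => rfl, Eq.symm, Eq.trans⟩
  append h h' := by
    rw [Prefunctor.mapPath_comp, Prefunctor.mapPath_comp, composePath_comp, composePath_comp, h, h']
  comp h := (map_comp h).trans (composePath_toPath _).symm
  tensorLeft X _ _ _ _ h := by
    rw [← Prefunctor.mapPath_comp_apply, ← Prefunctor.mapPath_comp_apply]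
    exact composePath_eq_of_natural_iso (left X) (leftIso X) (left_naturality X) h
  tensorRight X _ _ _ _ h := by
    rw [← Prefunctor.mapPath_comp_apply, ← Prefunctor.mapPath_comp_apply]
    exact composePath_eq_of_natural_iso (right X) (rightIso X) (right_naturality X) h

namespace PathInt

variable {H : IntP C ⥤q K}
  (hH : IsCongruence (C := C)
    (fun _ _ p q => composePath (H.mapPath p) = composePath (H.mapPath q)))

/-- The universal property of `Path(Intᵖ(C))/∼`: the functor induced by a map of graphs out of
`Intᵖ(C)` that respects `∼`. -/
def lift : PathInt C ⥤ K where
  obj A := H.obj A.as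
  map := Quot.lift (fun p => composePath (H.mapPath p)) (fun _ _ h => h _ hH)
  map_id _ := rfl
  map_comp := by
    rintro _ _ _ ⟨p⟩ ⟨q⟩
    exact (congrArg composePath (H.mapPath_comp p q)).trans (composePath_comp _ _)

lemma lift_map_sing {A B : IntP C} (f : A ⟶ B) : (lift hH).map (sing f) = H.map f :=
  composePath_toPath _

lemma naturality_of_sing {S T : PathInt C ⥤ K} (τ : ∀ X, S.obj X ⟶ T.obj X)
    (naturality : ∀ {A B : IntP C} (f : A ⟶ B),
      S.map (sing f) ≫ τ ⟨B⟩ = τ ⟨A⟩ ≫ T.map (sing f))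
    {X Y : PathInt C} (f : X ⟶ Y) : S.map f ≫ τ Y = τ X ≫ T.map f := by
  refine hom_induction (P := fun {Y} f => S.map f ≫ τ Y = τ X ≫ T.map f) ?_ ?_ f
  · simp
  · intro _ _ p f ih
    rw [S.map_comp, T.map_comp, Category.assoc, naturality, reassoc_of% ih]

end PathInt

end Lift

section CompactClosed

variable {D : Type u} [Category.{v} D] [MonoidalCategory D] [SymmetricCategory D]

section SplitDual

variable (b a p y p' y' w : D) [ExactPairing p' p] [ExactPairing y' y] [ExactPairing w (p ⊗ y)]

/-- The comparison `(b ⊗ a) ⊗ (p ⊗ y)* ≅ (b ⊗ (a ⊗ p*)) ⊗ y*`, where `p'`, `y'` and `w` are duals of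
`p`, `y` and `p ⊗ y`. -/
noncomputable def splitDual : (b ⊗ a) ⊗ w ≅ (b ⊗ (a ⊗ p')) ⊗ y' :=
  whiskerLeftIso _ (transposeIso w (y' ⊗ p') (Iso.refl (p ⊗ y))) ≪≫ (α_ _ _ _).symm ≪≫
    asIso (sw _ _ _) ≪≫ whiskerRightIso (α_ _ _ _) _

variable {a p} {a₁ p₁ : D} (p₁' w₁ : D) [ExactPairing p₁' p₁] [ExactPairing w₁ (p₁ ⊗ y)]

lemma mate_inner_splitDual (f : a ⊗ p₁ ⟶ a₁ ⊗ p) :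
    mate w w₁ (IntP.inner f b y) ≫ (splitDual b a₁ p₁ y p₁' y' w₁).hom =
      (splitDual b a p y p' y' w).hom ≫ (b ◁ mate p' p₁' f) ▷ y' := by
  have change_dual := mate_naturality w w₁
    (isPairingHom_transpose (U' := w) (W' := y' ⊗ p') (Iso.refl (p ⊗ y)))
    (isPairingHom_transpose (U' := w₁) (W' := y' ⊗ p₁') (Iso.refl (p₁ ⊗ y)))
    (𝟙 (b ⊗ a)) (𝟙 (b ⊗ a₁)) (f := IntP.inner f b y) (f₁ := IntP.inner f b y) (by simp)
  have inner_eq : IntP.inner f b y = (α_ (b ⊗ a) p₁ y).inv ≫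
      ((α_ b a p₁).hom ≫ b ◁ f ≫ (α_ b a₁ p).inv) ▷ y ≫ (α_ (b ⊗ a₁) p y).hom := by
    simp [IntP.inner]
  have mate_inner := mate_tensor p' p₁' y y'
    ((α_ b a p₁).hom ≫ b ◁ f ≫ (α_ b a₁ p).inv)
  rw [← inner_eq, whiskerLeft_mate] at mate_inner
  rw [id_tensorHom, id_tensorHom] at change_dual
  simp only [splitDual, Iso.trans_hom, whiskerLeftIso_hom, Iso.symm_hom, asIso_hom,
    whiskerRightIso_hom, Category.assoc, transposeIso]
  rw [← reassoc_of% change_dual, reassoc_of% mate_inner]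
  simp

end SplitDual

omit [SymmetricCategory D] in
lemma eq_of_whiskerRight_dual_unit_eq (U' : D) [ExactPairing U' (𝟙_ D)] {A B : D} {f g : A ⟶ B}
    (h : f ▷ U' = g ▷ U') : f = g := by
  rw [← whiskerRight_iff, ← cancel_epi (A ◁ (transposeIso U' (𝟙_ D) (Iso.refl (𝟙_ D))).hom),
    whisker_exchange, whisker_exchange, h]

variable [LeftRigidCategory D]

lemma canonicalTrace_eq_pairingTrace {A B : D} (U : D) (f : A ⊗ U ⟶ B ⊗ U) :
    canonicalTrace U f = pairingTrace U (ᘁU) f := by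
  simp [canonicalTrace, pairingTrace, cup, cap, insertRight, applyRight]

lemma canonicalTrace_eq {A B : D} (U U' : D) [ExactPairing U' U] (f : A ⊗ U ⟶ B ⊗ U) :
    canonicalTrace U f = pairingTrace U U' f := by
  rw [canonicalTrace_eq_pairingTrace, pairingTrace_eq_of_dual U (ᘁU) U']

variable (D) in
/-- The canonical trace of a compact closed category, as a partial trace that is total. -/
abbrev canonicalPartialTrace : PartiallyTraced D where
  tr U f := Part.some (canonicalTrace U f)
  naturality f g h := by
    simp only [Part.map_some, canonicalTrace_eq_pairingTrace, pairingTrace_naturality, le_refl]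
  dinaturality {_ _ U U'} f g := by
    rw [canonicalTrace_eq_pairingTrace, canonicalTrace_eq_pairingTrace,
      pairingTrace_dinaturality U (ᘁU) U' (ᘁU')]
  strength f g := by
    simp only [Part.map_some, canonicalTrace_eq_pairingTrace, pairingTrace_strength, le_refl]
  vanishing_one f := by
    rw [canonicalTrace_eq (𝟙_ D) (𝟙_ D), pairingTrace_unit]
  vanishing_two {A B U V} f _ := by
    rw [Part.bind_some, canonicalTrace_eq U (ᘁU), canonicalTrace_eq V (ᘁV),
      canonicalTrace_eq (U ⊗ V) ((ᘁV : D) ⊗ (ᘁU : D)), pairingTrace_tensor]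
  yanking A := by
    rw [canonicalTrace_eq_pairingTrace, pairingTrace_braiding]

attribute [local instance] canonicalPartialTrace

namespace IntP

/-- The composite of a path in `Intᵖ(D)` for a compact closed category `D`. -/
def total {A B : IntP D} (p : Quiver.Path A B) : A ⟶ B :=
  ⟨canonicalTrace (loop p) (sw A.pos B.neg (loop p) ≫ pre p)⟩

lemma comp_eq_total {A B : IntP D} (p : Quiver.Path A B) : comp p = Part.some (total p) := rfl

lemma total_eq_iff {A B : IntP D} {p : Quiver.Path A B} {f : A ⟶ B} :
    total p = f ↔ comp p = Part.some f := by
  rw [comp_eq_total, Part.some_inj]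

lemma total_cons_hom {A B B' : IntP D} (p : Quiver.Path A B) (f : B ⟶ B') :
    (total (p.cons f)).hom = pairingTrace B.neg (ᘁB.neg) (sw A.pos B'.neg B.neg ≫
      (total p).hom ▷ B'.neg ≫ sw B.pos A.neg B'.neg ≫ f.hom ▷ A.neg ≫
        sw B'.pos B.neg A.neg) := by
  simp only [total, canonicalTrace_eq_pairingTrace]
  exact pairingTrace_nested (loop p) (ᘁ(loop p) : D) (ᘁB.neg : D) (ᘁ(loop p ⊗ B.neg) : D)
    (pre p) f.hom

/-- The functor from `Intᵖ(D)` to `D` on single arrows: it sends `(A⁺, A⁻)` to `A⁺ ⊗ (A⁻)*` and an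
arrow to its mate. -/
def collapse : IntP D ⥤q D where
  obj A := A.pos ⊗ (ᘁA.neg : D)
  map {A B} f := mate (ᘁA.neg) (ᘁB.neg) f.hom

lemma collapse_map_ident (A : IntP D) : collapse.map (ident A) = 𝟙 _ := mate_id _

lemma collapse_map_pair_id {A B : D} (k : A ⟶ B) (u : D) :
    collapse.map (pair (A := ⟨A, u⟩) (B := ⟨B, u⟩) k (𝟙 u)) = k ▷ (ᘁu : D) := by
  rw [← mate_whiskerRight (a := u), ← tensorHom_id]
  rfl

lemma composePath_mapPath_collapse {A B : IntP D} (p : Quiver.Path A B) :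
    composePath (collapse.mapPath p) = collapse.map (total p) := by
  induction p with
  | nil => rw [total_eq_iff.2 (comp_nil A), collapse_map_ident, Prefunctor.mapPath_nil,
      composePath_nil]
  | cons p f ih =>
    rw [Prefunctor.mapPath_cons, composePath_cons, ih]
    exact (mate_comp _ _ _ _ _).trans (congrArg _ (total_cons_hom p f).symm)

lemma collapse_map_comp {A B B' : IntP D} {f : A ⟶ B} {g : B ⟶ B'} {k : A ⟶ B'}
    (h : comp (f.toPath.cons g) = Part.some k) :
    collapse.map f ≫ collapse.map g = collapse.map k := by
  rw [← total_eq_iff.2 h, ← composePath_mapPath_collapse]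
  simp

/-- The effect on `D` of tensoring with `X` on the left in `Intᵖ(D)`. -/
abbrev surround (X : IntP D) : D ⥤ D :=
  MonoidalCategory.tensorLeft X.pos ⋙ MonoidalCategory.tensorRight (ᘁX.neg : D)

/-- The comparison of `collapse` of `X ⊗ A` with `X⁺ ⊗ (A⁺ ⊗ (A⁻)*) ⊗ (X⁻)*`. -/
noncomputable def collapseTensor (X A : IntP D) :
    collapse.obj ((tensorLeft X).obj A) ≅ (surround X).obj (collapse.obj A) :=
  splitDual X.pos A.pos A.neg X.neg (ᘁA.neg) (ᘁX.neg) (ᘁ(A.neg ⊗ X.neg))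

lemma collapse_map_tensorLeft (X : IntP D) {A B : IntP D} (f : A ⟶ B) :
    collapse.map ((tensorLeft X).map f) ≫ (collapseTensor X B).hom =
      (collapseTensor X A).hom ≫ (surround X).map (collapse.map f) := by
  have map_eq : collapse.map ((tensorLeft X).map f) =
      mate (ᘁ(A.neg ⊗ X.neg) : D) (ᘁ(B.neg ⊗ X.neg) : D) (inner f.hom X.pos X.neg) :=
    congrArg (mate _ _) (PathInt.hom_inner f X)
  rw [map_eq]
  exact mate_inner_splitDual _ _ _ _ _ _ _ _

lemma collapse_map_braiding_comp (A B : IntP D) :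
    collapse.map (pair (A := A.tensorObj B) (B := B.tensorObj A) (β_ _ _).hom (β_ _ _).hom) ≫
      collapse.map (pair (A := B.tensorObj A) (B := A.tensorObj B) (β_ _ _).hom (β_ _ _).hom) =
      𝟙 _ := by
  rw [collapse_map_comp (comp_pair _ _ _), ← collapse_map_ident]
  congr 1
  apply Hom.ext
  simp only [pair, ident, ← id_tensorHom, ← tensorHom_id, MonoidalCategory.tensorHom_comp_tensorHom,
    SymmetricCategory.symmetry, Category.comp_id, id_tensorHom_id]

/-- The image of the symmetry of `Intᵖ(D)` in `D`. -/
def collapseBraiding (A B : IntP D) :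
    collapse.obj ((tensorRight B).obj A) ≅ collapse.obj ((tensorLeft B).obj A) where
  hom := collapse.map (pair (A := A.tensorObj B) (B := B.tensorObj A) (β_ _ _).hom (β_ _ _).hom)
  inv := collapse.map (pair (A := B.tensorObj A) (B := A.tensorObj B) (β_ _ _).hom (β_ _ _).hom)
  hom_inv_id := collapse_map_braiding_comp A B
  inv_hom_id := collapse_map_braiding_comp B A

lemma collapse_map_tensorRight (X : IntP D) {A B : IntP D} (f : A ⟶ B) :
    collapse.map ((tensorRight X).map f) ≫ (collapseBraiding B X).hom =
      (collapseBraiding A X).hom ≫ collapse.map ((tensorLeft X).map f) := by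
  refine (collapse_map_comp (comp_pair _ _ _)).trans
    (.trans (congrArg _ (Hom.ext ?_)) (collapse_map_comp (pair_comp _ _ _)).symm)
  simp only [tensorLeft, tensorRight, PathInt.hom_inner, PathInt.hom_outer]
  exact outer_braid _ _ _

lemma isCongruence_collapse : IsCongruence (C := D)
    (fun _ _ p q => composePath (collapse.mapPath p) = composePath (collapse.mapPath q)) :=
  isCongruence_composePath collapse
    (fun {_ _ p _} h => by
      rw [composePath_mapPath_collapse, total_eq_iff.2 (Part.eq_some_iff.2 h)])
    surround surround collapseTensor (fun X A => collapseBraiding A X ≪≫ collapseTensor X A)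
    collapse_map_tensorLeft
    (fun X _ _ f => by
      rw [Iso.trans_hom, Iso.trans_hom, reassoc_of% collapse_map_tensorRight X f,
        collapse_map_tensorLeft, Category.assoc])

end IntP

namespace PathInt

open IntP

lemma exists_eq_sing {A B : IntP D} (f : (⟨A⟩ : PathInt D) ⟶ ⟨B⟩) : ∃ g : A ⟶ B, f = sing g := by
  obtain ⟨p⟩ := f
  exact ⟨total p, Quot.sound (isCongruence_sim.comp (Part.eq_some_iff.1 (comp_eq_total p)))⟩

instance : (embed D).Faithful where
  map_injective {A B f g} h := by
    have lift_map_embed (k : A ⟶ B) :=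
      (lift_map_sing isCongruence_collapse (pair (A := ⟨A, 𝟙_ D⟩) (B := ⟨B, 𝟙_ D⟩) k (𝟙 _))).trans
        (collapse_map_pair_id k (𝟙_ D))
    exact eq_of_whiskerRight_dual_unit_eq _ ((lift_map_embed f).symm.trans
      ((congrArg (lift isCongruence_collapse).map h).trans (lift_map_embed g)))

instance : (embed D).Full where
  map_surjective {A B} f := by
    obtain ⟨g, rfl⟩ := exists_eq_sing f
    refine ⟨(ρ_ A).inv ≫ g.hom ≫ (ρ_ B).hom, congrArg sing (Hom.ext ?_)⟩
    have conj_rightUnitor (k : A ⊗ 𝟙_ D ⟶ B ⊗ 𝟙_ D) :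
        ((ρ_ A).inv ≫ k ≫ (ρ_ B).hom) ⊗ₘ 𝟙 (𝟙_ D) = k := by simp
    exact conj_rightUnitor g.hom

end PathInt

end CompactClosed

section Snakes

open BraidedCategory

variable {E : Type u} [Category.{v} E] [MonoidalCategory E] [SymmetricCategory E]

/-- The exact pairing of `U'` and `U` with prescribed `η : I ⟶ U ⊗ U'` and `ε : U ⊗ U' ⟶ I`, the
triangle identities being stated for the operators `insertRight η` and `applyRight ε`. -/
abbrev exactPairingOfSnakes {U U' : E} (η : 𝟙_ E ⟶ U ⊗ U') (ε : U ⊗ U' ⟶ 𝟙_ E)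
    (snake : insertRight η (𝟙_ E ⊗ U) ≫ sw (𝟙_ E) U U ▷ U' ≫ applyRight ε (𝟙_ E ⊗ U) = 𝟙 _)
    (snake' : insertRight η (𝟙_ E ⊗ U') ≫ sw (𝟙_ E) U' U ▷ U' ≫ applyRight ε (𝟙_ E) ▷ U' = 𝟙 _) :
    ExactPairing U' U where
  coevaluation' := η ≫ (β_ U U').hom
  evaluation' := ε
  coevaluation_evaluation' := by
    have slide : ε ▷ U ≫ (λ_ U).hom = (α_ U U' U).hom ≫ U ◁ (β_ U' U).hom ≫ (α_ U U U').inv ≫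
        (β_ U U).hom ▷ U' ≫ (α_ U U U').hom ≫ U ◁ ε ≫ (ρ_ U).hom := by
      rw [← braiding_rightUnitor, braiding_naturality_left_assoc, braiding_tensor_left_hom]
      simp only [Category.assoc]
    have zig : U ◁ η ≫ (α_ U U U').inv ≫ (β_ U U).hom ▷ U' ≫ (α_ U U U').hom ≫ U ◁ ε ≫
        (ρ_ U).hom = (ρ_ U).hom := calc
      _ = (ρ_ U).hom ≫ (λ_ U).inv ≫ (insertRight η (𝟙_ E ⊗ U) ≫ sw (𝟙_ E) U U ▷ U' ≫
          applyRight ε (𝟙_ E ⊗ U)) ≫ (λ_ U).hom := by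
        simp only [insertRight, applyRight, sw]
        monoidal
      _ = (ρ_ U).hom := by simp [snake]
    rw [← cancel_mono (λ_ U).hom, Category.assoc, Category.assoc, Category.assoc, slide]
    simpa [← MonoidalCategory.whiskerLeft_comp_assoc] using zig
  evaluation_coevaluation' := by
    have slide : ε ▷ U' ≫ (λ_ U').hom = (α_ U U' U').hom ≫ U ◁ (β_ U' U').hom ≫
        (α_ U U' U').inv ≫ (β_ U U').hom ▷ U' ≫ (α_ U' U U').hom ≫ U' ◁ ε ≫ (ρ_ U').hom := by
      rw [← braiding_rightUnitor, braiding_naturality_left_assoc, braiding_tensor_left_hom]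
      simp only [Category.assoc]
    have slide' : (λ_ U').inv ≫ η ▷ U' = (ρ_ U').inv ≫ U' ◁ η ≫ (α_ U' U U').inv ≫
        (β_ U' U).hom ▷ U' ≫ (α_ U U' U').hom ≫ U ◁ (β_ U' U').hom ≫ (α_ U U' U').inv := by
      rw [← braiding_tensor_right_hom, braiding_naturality_right, braiding_tensorUnit_right_assoc]
      simp
    have zag : (ρ_ U').inv ≫ U' ◁ η ≫ (α_ U' U U').inv ≫ (β_ U' U).hom ▷ U' ≫ ε ▷ U' ≫
        (λ_ U').hom = 𝟙 U' := calc
      _ = (λ_ U').inv ≫ (insertRight η (𝟙_ E ⊗ U') ≫ sw (𝟙_ E) U' U ▷ U' ≫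
          applyRight ε (𝟙_ E) ▷ U') ≫ (λ_ U').hom := by
        simp only [insertRight, applyRight, sw]
        monoidal
      _ = 𝟙 U' := by simp [snake']
    rw [slide] at zag
    rw [← cancel_epi (λ_ U').inv, ← cancel_mono (ρ_ U').hom, comp_whiskerRight]
    simp only [Category.assoc]
    rw [reassoc_of% slide', zag]
    simp

end Snakes

namespace PathInt

open PartiallyTraced IntP

variable {C : Type u} [Category.{v} C] [MonoidalCategory C] [SymmetricCategory C]
  [PartiallyTraced C]

/-- The object `(I, p)`. -/
abbrev cobase (p : C) : PathInt C := ⟨⟨𝟙_ C, p⟩⟩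

/-- An arrow of `Intᵖ(C)` with explicit components, as a morphism of `Path(Intᵖ(C))/∼`. -/
abbrev arrow {a x b y : C} (f : a ⊗ y ⟶ b ⊗ x) :
    (⟨⟨a, x⟩⟩ : PathInt C) ⟶ (⟨⟨b, y⟩⟩ : PathInt C) := sing (X := ⟨a, x⟩) (Y := ⟨b, y⟩) ⟨f⟩

lemma arrow_comp_J {a x b y b' y' : C} (f : a ⊗ y ⟶ b ⊗ x) (u : b ⟶ b') (v : y' ⟶ y) :
    arrow f ≫ J u v = arrow (a ◁ v ≫ f ≫ u ▷ x) :=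
  sing_of_mem (comp_pair (X := ⟨a, x⟩) (A := ⟨b, y⟩) (B := ⟨b', y'⟩) ⟨f⟩ u v)

lemma J_comp_arrow {a x b y a' x' : C} (u : a' ⟶ a) (v : x ⟶ x') (f : a ⊗ y ⟶ b ⊗ x) :
    J u v ≫ arrow f = arrow (u ▷ y ≫ f ≫ b ◁ v) :=
  sing_of_mem (pair_comp (X := ⟨a', x'⟩) (A := ⟨a, x⟩) (B := ⟨b, y⟩) u v ⟨f⟩)

lemma arrow_id (a x : C) : arrow (𝟙 (a ⊗ x)) = 𝟙 _ := sing_ident _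

lemma arrow_comp_arrow {a x b y c z : C} (f : a ⊗ y ⟶ b ⊗ x) (g : b ⊗ z ⟶ c ⊗ y) {t : a ⊗ z ⟶ c ⊗ x}
    (h : t ∈ tr y (sw a z y ≫ f ▷ z ≫ sw b x z ≫ g ▷ x ≫ sw c y x)) :
    arrow f ≫ arrow g = arrow t :=
  sing_of_mem <| (comp_two (X := ⟨a, x⟩) (Y := ⟨b, y⟩) (Z := ⟨c, z⟩) ⟨f⟩ ⟨g⟩).trans <| by
    rw [Part.eq_some_iff.2 h]; exact Part.map_some _ _

lemma whiskerLeft_arrow (X : PathInt C) {a x b y : C} (f : a ⊗ y ⟶ b ⊗ x) :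
    X ◁ arrow f = arrow (inner f X.as.pos X.as.neg) :=
  congrArg sing (Hom.ext (hom_inner (A := ⟨a, x⟩) (A' := ⟨b, y⟩) ⟨f⟩ X.as))

lemma whiskerRight_arrow (X : PathInt C) {a x b y : C} (f : a ⊗ y ⟶ b ⊗ x) :
    arrow f ▷ X = arrow (outer f X.as.pos X.as.neg) :=
  congrArg sing (Hom.ext (hom_outer (A := ⟨a, x⟩) (A' := ⟨b, y⟩) ⟨f⟩ X.as))

lemma whiskerLeft_J (X : PathInt C) {a p a' p' : C} (u : a ⟶ a') (v : p' ⟶ p) :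
    X ◁ J u v = J (X.as.pos ◁ u) (v ▷ X.as.neg) := whL_J X u v

lemma whiskerRight_J (X : PathInt C) {a p a' p' : C} (u : a ⟶ a') (v : p' ⟶ p) :
    J u v ▷ X = J (u ▷ X.as.pos) (X.as.neg ◁ v) := whR_J X u v

lemma sw_eq_J (X Y Z : PathInt C) : sw X Y Z = J (sw X.as.pos Y.as.pos Z.as.pos)
    ((α_ Y.as.neg Z.as.neg X.as.neg).inv ≫ (β_ Y.as.neg Z.as.neg).hom ▷ X.as.neg ≫
      (α_ Z.as.neg Y.as.neg X.as.neg).hom) := by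
  change J _ _ ≫ X ◁ J _ _ ≫ J _ _ = _
  rw [whiskerLeft_J, J_comp, J_comp]
  simp only [Category.assoc]
  rfl

/-- The structural arrow `(a, x) ⟶ (a ⊗ q, q ⊗ x)`, inserting a factor `q` on both sides. -/
def insertPair (q a x : C) : (⟨⟨a, x⟩⟩ : PathInt C) ⟶ ⟨⟨a ⊗ q, q ⊗ x⟩⟩ := arrow (α_ a q x).inv

/-- The structural arrow `(a ⊗ q, q ⊗ x) ⟶ (a, x)`, cancelling a factor `q` on both sides. -/
def cancelPair (q a x : C) : (⟨⟨a ⊗ q, q ⊗ x⟩⟩ : PathInt C) ⟶ ⟨⟨a, x⟩⟩ := arrow (α_ a q x).hom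

lemma J_comp_insertPair {a x a' x' : C} (q : C) (u : a ⟶ a') (v : x' ⟶ x) :
    J u v ≫ insertPair q a' x' = insertPair q a x ≫ J (u ▷ q) (q ◁ v) := by
  rw [insertPair, insertPair, J_comp_arrow, arrow_comp_J, associator_inv_naturality_left_assoc,
    associator_inv_naturality_right_assoc, whisker_exchange]

lemma cancelPair_comp_J {a x a' x' : C} (q : C) (u : a ⟶ a') (v : x' ⟶ x) :
    cancelPair q a x ≫ J u v = J (u ▷ q) (q ◁ v) ≫ cancelPair q a' x' := by
  rw [cancelPair, cancelPair, J_comp_arrow, arrow_comp_J, associator_naturality_left_assoc,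
    associator_naturality_right_assoc, whisker_exchange]

lemma insertPair_J_cancelPair {a x b q : C} (u : a ⊗ q ⟶ b ⊗ x) :
    insertPair q a x ≫ J u (β_ x q).hom ≫ cancelPair x b q = arrow u := by
  rw [insertPair, cancelPair, ← Category.assoc, arrow_comp_J]
  refine arrow_comp_arrow _ _ (Part.eq_some_iff.1 ?_)
  have yank := tr_yank (sw a q x) (sw a x q ≫ u ▷ x ≫ sw b x x)
  rw [reassoc_of% @sw_sw C] at yank
  have yank_twice := tr_two _ yank
  rw [show tr x (u ▷ x ≫ sw b x x) = Part.some u by simpa using tr_yank u (𝟙 (b ⊗ x))] at yank_twice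
  rw [← yank_twice]
  congr 1
  have braid_assoc : a ◁ (β_ x q).hom ≫ (α_ a q x).inv = (α_ _ _ _).inv ≫ sw a x q := by simp [sw]
  rw [reassoc_of% braid_assoc, sw_last_eq, sw_mid_eq]
  simp only [comp_whiskerRight, Category.assoc, hom_inv_whiskerRight_assoc, reassoc_of% @sw_sw C]

lemma insertPair_sw_cancelPair (q y w : C) :
    insertPair q (y ⊗ q) w ≫ J (sw y q q) (𝟙 (q ⊗ w)) ≫ cancelPair q (y ⊗ q) w = 𝟙 _ := by
  rw [insertPair, cancelPair, ← Category.assoc, arrow_comp_J, ← arrow_id]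
  refine arrow_comp_arrow _ _ (Part.eq_some_iff.1 ?_)
  have yank_twice := tr_two _ (tr_yank (sw (y ⊗ q) w q) (sw y q q ▷ w ≫ sw (y ⊗ q) q w))
  have yank := tr_yank (sw y q w) (sw y w q)
  rw [sw_braid, ← yank_twice, sw_sw] at yank
  rw [← yank]
  congr 1
  rw [sw_last_eq, sw_mid_eq]
  simp only [comp_whiskerRight, Category.assoc, hom_inv_whiskerRight_assoc,
    MonoidalCategory.whiskerLeft_id, Category.id_comp, reassoc_of% @sw_sw C]

/-- The unit of the duality between `(q, I)` and `(I, q)`. -/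
def baseUnit (q : C) : 𝟙_ (PathInt C) ⟶ base q ⊗ cobase q :=
  arrow ((λ_ _).hom ≫ (ρ_ (q ⊗ 𝟙_ C)).inv)

/-- The counit of the duality between `(q, I)` and `(I, q)`. -/
def baseCounit (q : C) : base q ⊗ cobase q ⟶ 𝟙_ (PathInt C) :=
  arrow ((ρ_ _).hom ≫ (λ_ (q ⊗ 𝟙_ C)).inv)

lemma insertRight_baseUnit (q y z : C) : insertRight (baseUnit q) ⟨⟨y, z⟩⟩ =
    insertPair q y z ≫ J (ρ_ (y ⊗ q)).inv (q ◁ (λ_ z).hom) := by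
  rw [insertRight, insertPair, arrow_comp_J]
  change J _ _ ≫ _ ◁ arrow _ ≫ J _ _ = _
  rw [whiskerLeft_arrow, arrow_comp_J, J_comp_arrow]
  refine congrArg arrow (?_ : (ρ_ y).inv ▷ _ ≫ ((y ⊗ 𝟙_ C) ◁ (α_ q (𝟙_ C) z).inv ≫
    inner ((λ_ _).hom ≫ (ρ_ (q ⊗ 𝟙_ C)).inv) y z ≫ (α_ y q (𝟙_ C)).inv ▷ (𝟙_ C ⊗ z)) ≫
    ((y ⊗ q) ⊗ 𝟙_ C) ◁ (λ_ z).hom = y ◁ q ◁ (λ_ z).hom ≫ (α_ y q z).inv ≫ (ρ_ (y ⊗ q)).inv ▷ z)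
  rw [IntP.inner]
  monoidal

lemma applyRight_baseCounit (q y z : C) : applyRight (baseCounit q) ⟨⟨y, z⟩⟩ =
    J (ρ_ (y ⊗ q)).hom (q ◁ (λ_ z).inv) ≫ cancelPair q y z := by
  rw [applyRight, cancelPair, J_comp_arrow]
  change J _ _ ≫ _ ◁ arrow _ ≫ J _ _ = _
  rw [whiskerLeft_arrow, arrow_comp_J, J_comp_arrow]
  refine congrArg arrow (?_ : (α_ y q (𝟙_ C)).hom ▷ z ≫ ((y ⊗ (q ⊗ 𝟙_ C)) ◁ (λ_ z).inv ≫
    inner ((ρ_ _).hom ≫ (λ_ (q ⊗ 𝟙_ C)).inv) y z ≫ (ρ_ y).hom ▷ ((q ⊗ 𝟙_ C) ⊗ z)) ≫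
    y ◁ (α_ q (𝟙_ C) z).hom = (ρ_ (y ⊗ q)).hom ▷ z ≫ (α_ y q z).hom ≫ y ◁ q ◁ (λ_ z).inv)
  rw [IntP.inner]
  monoidal

lemma baseUnit_snake (q : C) : insertRight (baseUnit q) (𝟙_ (PathInt C) ⊗ base q) ≫
    sw (𝟙_ (PathInt C)) (base q) (base q) ▷ cobase q ≫
      applyRight (baseCounit q) (𝟙_ (PathInt C) ⊗ base q) = 𝟙 _ := by
  change insertRight (baseUnit q) ⟨⟨𝟙_ C ⊗ q, 𝟙_ C ⊗ 𝟙_ C⟩⟩ ≫ _ ≫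
    applyRight (baseCounit q) ⟨⟨𝟙_ C ⊗ q, 𝟙_ C ⊗ 𝟙_ C⟩⟩ = _
  refine Eq.trans ?_ (insertPair_sw_cancelPair q (𝟙_ C) (𝟙_ C ⊗ 𝟙_ C))
  rw [insertRight_baseUnit, applyRight_baseCounit, sw_eq_J, whiskerRight_J]
  simp only [Category.assoc]
  congr 1
  simp only [← Category.assoc]
  congr 1
  simp only [J_comp]
  congr 1
  · change ((ρ_ _).inv ≫ sw (𝟙_ C) q q ▷ 𝟙_ C) ≫ (ρ_ _).hom = _
    simp
  · simp

lemma baseCounit_snake (q : C) : insertRight (baseUnit q) (𝟙_ (PathInt C) ⊗ cobase q) ≫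
    sw (𝟙_ (PathInt C)) (cobase q) (base q) ▷ cobase q ≫
      applyRight (baseCounit q) (𝟙_ (PathInt C)) ▷ cobase q = 𝟙 _ := by
  have insertPair_cancelPair := insertPair_J_cancelPair (𝟙 ((𝟙_ C ⊗ 𝟙_ C) ⊗ q))
  rw [arrow_id] at insertPair_cancelPair
  let e : (𝟙_ (PathInt C) ⊗ cobase q) ≅ (⟨⟨𝟙_ C ⊗ 𝟙_ C, q⟩⟩ : PathInt C) :=
    JIso (Iso.refl _) (ρ_ q).symm
  rw [applyRight_whiskerRight, ← cancel_mono e.hom, Category.id_comp]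
  refine Eq.trans ?_
    ((congrArg (fun t => J (𝟙 _) (ρ_ q).inv ≫ t) insertPair_cancelPair).trans
      (Category.comp_id _))
  change (insertRight (baseUnit q) ⟨⟨𝟙_ C ⊗ 𝟙_ C, q ⊗ 𝟙_ C⟩⟩ ≫ _ ≫ _ ≫ _ ≫
    applyRight (baseCounit q) ⟨⟨𝟙_ C ⊗ 𝟙_ C, q ⊗ 𝟙_ C⟩⟩) ≫ J (𝟙 _) (ρ_ q).inv = _
  rw [insertRight_baseUnit, applyRight_baseCounit, sw_eq_J, sw_eq_J, sw_eq_J]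
  simp only [whiskerRight_J, Category.assoc, cancelPair_comp_J]
  rw [reassoc_of% J_comp_insertPair]
  congr 1
  simp only [← Category.assoc]
  congr 1
  simp only [J_comp]
  congr 1
  · simp only [sw_unit_mid, sw_unit_last]
    monoidal
  · simp only [whiskerLeft_rightUnitor_inv, braiding_tensorUnit_left, braiding_tensorUnit_right]
    monoidal

instance exactPairingCobaseBase (q : C) : ExactPairing (cobase q) (base q) :=
  exactPairingOfSnakes (baseUnit q) (baseCounit q) (baseUnit_snake q) (baseCounit_snake q)

lemma cup_base (q y z : C) : cup (base q) (cobase q) ⟨⟨y, z⟩⟩ =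
    insertPair q y z ≫ J (ρ_ (y ⊗ q)).inv (q ◁ (λ_ z).hom) := by
  refine Eq.trans (congrArg (insertRight · _) ?_) (insertRight_baseUnit q y z)
  change (baseUnit q ≫ (β_ _ _).hom) ≫ (β_ _ _).hom = _
  rw [Category.assoc, SymmetricCategory.symmetry, Category.comp_id]

lemma cap_base (q y z : C) : cap (base q) (cobase q) ⟨⟨y, z⟩⟩ =
    J (ρ_ (y ⊗ q)).hom (q ◁ (λ_ z).inv) ≫ cancelPair q y z := applyRight_baseCounit q y z

/-- Every object `(a, x)` is the tensor product of `(a, I)` and `(I, x)`. -/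
def decomp (a x : C) : base a ⊗ cobase x ≅ ⟨⟨a, x⟩⟩ := JIso (ρ_ a) (ρ_ x).symm

lemma decomp_comp_arrow {a x b q : C} (u : a ⊗ q ⟶ b ⊗ x) :
    (decomp a x).hom ≫ arrow u =
      mate (cobase x) (cobase q) (a := base x) (b := base q) (A := base a) (B := base b)
        (J u (𝟙 (𝟙_ C ⊗ 𝟙_ C))) ≫ (decomp b q).hom := by
  rw [mate, cap_whiskerRight]
  change J _ _ ≫ _ = ((cup (base q) (cobase q) ⟨⟨_, _⟩⟩ ≫ _ ≫ _ ≫ _ ≫ _ ≫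
    cap (base x) (cobase x) ⟨⟨_, _⟩⟩)) ≫ J _ _
  rw [cup_base, cap_base, sw_eq_J, sw_eq_J, sw_eq_J]
  simp only [whiskerRight_J, Category.assoc, cancelPair_comp_J]
  rw [← insertPair_J_cancelPair, reassoc_of% J_comp_insertPair]
  simp only [← Category.assoc]
  congr 1
  simp only [Category.assoc]
  congr 1
  simp only [J_comp]
  congr 1
  · simp only [sw_unit_mid, sw_unit_last]
    monoidal
  · simp only [whiskerLeft_rightUnitor_inv, braiding_tensorUnit_left, braiding_tensorUnit_right,
      Iso.symm_hom]
    monoidal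

end PathInt

open IntP Functor.LaxMonoidal Functor.OplaxMonoidal Functor.Monoidal

section Intertwines

variable {C : Type u₁} [Category.{v₁} C] {D : Type u₂} [Category.{v₂} D] {P Q R P' P'' : D}
  {X Y Z X' X'' : C}

/-- The morphism `k` of `D` corresponds to the morphism `h` of `C` under the comparison morphisms
`u` and `u'` with values of `G`. -/
def Intertwines (G : C ⥤ D) (u : P ⟶ G.obj X) (u' : P' ⟶ G.obj X') (k : P ⟶ P') (h : X ⟶ X') :
    Prop := u ≫ G.map h = k ≫ u'

namespace Intertwines

variable {G : C ⥤ D}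

lemma comp {u : P ⟶ G.obj X} {u' : P' ⟶ G.obj X'} {u'' : P'' ⟶ G.obj X''} {h : X ⟶ X'}
    {k : P ⟶ P'} {h' : X' ⟶ X''} {k' : P' ⟶ P''} (hk : Intertwines G u u' k h)
    (hk' : Intertwines G u' u'' k' h') : Intertwines G u u'' (k ≫ k') (h ≫ h') := by
  rw [Intertwines, G.map_comp, reassoc_of% hk, hk', Category.assoc]

lemma inv {u : P ⟶ G.obj X} {u' : P' ⟶ G.obj X'} {k : P ≅ P'} {h : X ≅ X'}
    (hk : Intertwines G u u' k.hom h.hom) : Intertwines G u' u k.inv h.inv := by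
  rw [Intertwines, Iso.eq_inv_comp, ← reassoc_of% hk, ← G.map_comp, Iso.hom_inv_id, G.map_id,
    Category.comp_id]

end Intertwines

variable [MonoidalCategory C] [SymmetricCategory C] [MonoidalCategory D] [SymmetricCategory D]
  {G : C ⥤ D} [G.Braided]

variable (G) in
/-- The external product of two morphisms to values of a monoidal functor. -/
def extProd (u : P ⟶ G.obj X) (v : Q ⟶ G.obj Y) : P ⊗ Q ⟶ G.obj (X ⊗ Y) :=
  (u ⊗ₘ v) ≫ μ G X Y

lemma extProd_id (X Y : C) : extProd G (𝟙 (G.obj X)) (𝟙 (G.obj Y)) = μ G X Y := by simp [extProd]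

lemma Intertwines.whiskerRight {u : P ⟶ G.obj X} {u' : P' ⟶ G.obj X'} {k : P ⟶ P'} {h : X ⟶ X'}
    (hk : Intertwines G u u' k h) (v : Q ⟶ G.obj Y) :
    Intertwines G (extProd G u v) (extProd G u' v) (k ▷ Q) (h ▷ Y) := by
  rw [Intertwines, extProd, extProd, Category.assoc, ← μ_natural_left, ← tensorHom_id,
    ← tensorHom_id, MonoidalCategory.tensorHom_comp_tensorHom_assoc,
    MonoidalCategory.tensorHom_comp_tensorHom_assoc, hk, Category.comp_id, Category.id_comp]

lemma Intertwines.whiskerLeft {u : P ⟶ G.obj X} {u' : P' ⟶ G.obj X'} {k : P ⟶ P'} {h : X ⟶ X'}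
    (hk : Intertwines G u u' k h) (v : Q ⟶ G.obj Y) :
    Intertwines G (extProd G v u) (extProd G v u') (Q ◁ k) (Y ◁ h) := by
  rw [Intertwines, extProd, extProd, Category.assoc, ← μ_natural_right, ← id_tensorHom,
    ← id_tensorHom, MonoidalCategory.tensorHom_comp_tensorHom_assoc,
    MonoidalCategory.tensorHom_comp_tensorHom_assoc, hk, Category.comp_id, Category.id_comp]

lemma intertwines_associator (u : P ⟶ G.obj X) (v : Q ⟶ G.obj Y) (w : R ⟶ G.obj Z) :
    Intertwines G (extProd G (extProd G u v) w) (extProd G u (extProd G v w))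
      (α_ P Q R).hom (α_ X Y Z).hom := by
  have left_assoc : extProd G (extProd G u v) w =
      ((u ⊗ₘ v) ⊗ₘ w) ≫ μ G X Y ▷ G.obj Z ≫ μ G (X ⊗ Y) Z := by
    rw [extProd, extProd, ← Category.assoc, ← tensorHom_id,
      MonoidalCategory.tensorHom_comp_tensorHom, Category.comp_id]
  have right_assoc : extProd G u (extProd G v w) =
      (u ⊗ₘ (v ⊗ₘ w)) ≫ G.obj X ◁ μ G Y Z ≫ μ G X (Y ⊗ Z) := by
    rw [extProd, extProd, ← Category.assoc, ← id_tensorHom,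
      MonoidalCategory.tensorHom_comp_tensorHom, Category.comp_id]
  rw [Intertwines, left_assoc, right_assoc, Category.assoc, Category.assoc,
    Functor.LaxMonoidal.associativity, MonoidalCategory.associator_naturality_assoc]

lemma intertwines_associator_inv (u : P ⟶ G.obj X) (v : Q ⟶ G.obj Y) (w : R ⟶ G.obj Z) :
    Intertwines G (extProd G u (extProd G v w)) (extProd G (extProd G u v) w)
      (α_ P Q R).inv (α_ X Y Z).inv :=
  (intertwines_associator u v w).inv

lemma intertwines_rightUnitor (u : P ⟶ G.obj X) :
    Intertwines G (extProd G u (ε G)) u (ρ_ P).hom (ρ_ X).hom := by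
  rw [Intertwines, extProd, MonoidalCategory.tensorHom_def, Category.assoc, Category.assoc,
    ← rightUnitor_naturality, Functor.LaxMonoidal.right_unitality]

lemma intertwines_braiding (u : P ⟶ G.obj X) (v : Q ⟶ G.obj Y) :
    Intertwines G (extProd G u v) (extProd G v u) (β_ P Q).hom (β_ X Y).hom := by
  rw [Intertwines, extProd, extProd, Category.assoc, Functor.LaxBraided.braided,
    BraidedCategory.braiding_naturality_assoc]

lemma intertwines_sw (u : P ⟶ G.obj X) (v : Q ⟶ G.obj Y) (w : R ⟶ G.obj Z) :
    Intertwines G (extProd G (extProd G u v) w) (extProd G (extProd G u w) v)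
      (sw P Q R) (sw X Y Z) :=
  (intertwines_associator u v w).comp <| ((intertwines_braiding v w).whiskerLeft u).comp <|
    intertwines_associator_inv u w v

variable {a p b q : C}

/-- The image under `G` of an arrow of `Intᵖ(C)`. -/
def conj (G : C ⥤ D) [G.Braided] (f : a ⊗ p ⟶ b ⊗ q) :
    G.obj a ⊗ G.obj p ⟶ G.obj b ⊗ G.obj q := μ G a p ≫ G.map f ≫ δ G b q

lemma conj_tensorHom (u : a ⟶ b) (v : p ⟶ q) : conj G (u ⊗ₘ v) = G.map u ⊗ₘ G.map v := by
  simp [conj, ← μ_natural_assoc]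

lemma intertwines_conj (f : a ⊗ p ⟶ b ⊗ q) :
    Intertwines G (extProd G (𝟙 (G.obj a)) (𝟙 (G.obj p))) (extProd G (𝟙 _) (𝟙 _)) (conj G f) f := by
  simp [Intertwines, extProd_id, conj]

lemma intertwines_inner (f : a ⊗ p ⟶ b ⊗ q) (x y : C) :
    Intertwines G
      (extProd G (extProd G (𝟙 (G.obj x)) (𝟙 (G.obj a))) (extProd G (𝟙 (G.obj p)) (𝟙 (G.obj y))))
      (extProd G (extProd G (𝟙 (G.obj x)) (𝟙 (G.obj b))) (extProd G (𝟙 (G.obj q)) (𝟙 (G.obj y))))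
      (IntP.inner (conj G f) (G.obj x) (G.obj y)) (IntP.inner f x y) :=
  (intertwines_associator_inv _ _ _).comp <|
    ((intertwines_associator _ _ _).whiskerRight _).comp <|
    (((intertwines_conj f).whiskerLeft _).whiskerRight _).comp <|
    ((intertwines_associator_inv _ _ _).whiskerRight _).comp <| intertwines_associator _ _ _

lemma intertwines_outer (f : a ⊗ p ⟶ b ⊗ q) (x y : C) :
    Intertwines G
      (extProd G (extProd G (𝟙 (G.obj a)) (𝟙 (G.obj x))) (extProd G (𝟙 (G.obj y)) (𝟙 (G.obj p))))
      (extProd G (extProd G (𝟙 (G.obj b)) (𝟙 (G.obj x))) (extProd G (𝟙 (G.obj y)) (𝟙 (G.obj q))))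
      (outer (conj G f) (G.obj x) (G.obj y)) (outer f x y) :=
  (intertwines_associator_inv _ _ _).comp <| (intertwines_sw _ _ _).comp <|
    ((intertwines_sw _ _ _).whiskerRight _).comp <|
    (((intertwines_conj f).whiskerRight _).whiskerRight _).comp <|
    ((intertwines_sw _ _ _).whiskerRight _).comp <| (intertwines_sw _ _ _).comp <|
    intertwines_associator _ _ _

variable (G) in
/-- The map of graphs `Intᵖ(C) → Intᵖ(D)` induced by `G`. -/
def intMap : IntP C ⥤q IntP D where
  obj A := ⟨G.obj A.pos, G.obj A.neg⟩
  map f := ⟨conj G f.hom⟩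

variable (G) in
/-- The comparison of the object traced out for the image of a path with the image of the object
traced out for the path. -/
def loopIso {A : IntP C} : {B : IntP C} → (p : Quiver.Path A B) →
    (loop ((intMap G).mapPath p) ≅ G.obj (loop p))
  | _, .nil => εIso G
  | _, .cons (b := B) p _ => whiskerRightIso (loopIso p) (G.obj B.neg) ≪≫ μIso G _ _

lemma loopIso_cons_hom {A B B' : IntP C} (p : Quiver.Path A B) (f : B ⟶ B') :
    (loopIso G (p.cons f)).hom = extProd G (loopIso G p).hom (𝟙 (G.obj B.neg)) := by
  change (loopIso G p).hom ▷ G.obj B.neg ≫ μ G (loop p) B.neg = _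
  simp [extProd]

variable (G) in
/-- The morphism `pre` of the image of a path, with source and target expressed through `G`. -/
def preMap {A B : IntP C} (p : Quiver.Path A B) :
    (G.obj A.pos ⊗ loop ((intMap G).mapPath p)) ⊗ G.obj B.neg ⟶
      (G.obj B.pos ⊗ G.obj A.neg) ⊗ loop ((intMap G).mapPath p) := pre ((intMap G).mapPath p)

lemma intertwines_pre {A B : IntP C} (p : Quiver.Path A B) :
    Intertwines G (extProd G (extProd G (𝟙 (G.obj A.pos)) (loopIso G p).hom) (𝟙 (G.obj B.neg)))
      (extProd G (extProd G (𝟙 (G.obj B.pos)) (𝟙 (G.obj A.neg))) (loopIso G p).hom)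
      (preMap G p) (pre p) := by
  induction p with
  | nil => exact ((intertwines_rightUnitor _).whiskerRight _).comp (intertwines_rightUnitor _).inv
  | cons p f ih =>
    rw [loopIso_cons_hom]
    exact ((intertwines_associator_inv _ _ _).whiskerRight _).comp <| (ih.whiskerRight _).comp <|
      (intertwines_sw _ _ _).comp <| ((intertwines_sw _ _ _).whiskerRight _).comp <|
      (((intertwines_conj f.hom).whiskerRight _).whiskerRight _).comp <|
      ((intertwines_sw _ _ _).whiskerRight _).comp <| (intertwines_sw _ _ _).comp <|
      intertwines_associator _ _ _

lemma loopIso_conj_sw_pre {A B : IntP C} (p : Quiver.Path A B) :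
    _ ◁ (loopIso G p).inv ≫
      (sw (G.obj A.pos) (G.obj B.neg) (loop ((intMap G).mapPath p)) ≫ preMap G p) ≫
      _ ◁ (loopIso G p).hom = μ G A.pos B.neg ▷ _ ≫ conj G (sw A.pos B.neg (loop p) ≫ pre p) ≫
        δ G B.pos A.neg ▷ _ := by
  have square := (intertwines_sw (𝟙 (G.obj A.pos)) (𝟙 (G.obj B.neg)) (loopIso G p).hom).comp
    (intertwines_pre p)
  have extProd_eq (a b : C) : extProd G (extProd G (𝟙 (G.obj a)) (𝟙 (G.obj b))) (loopIso G p).hom =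
      _ ◁ (loopIso G p).hom ≫ μ G a b ▷ _ ≫ μ G _ _ := by
    rw [extProd_id, extProd, MonoidalCategory.tensorHom_def', Category.assoc]
  rw [Intertwines, extProd_eq, extProd_eq] at square
  rw [conj, ← cancel_mono (μ G B.pos A.neg ▷ G.obj (loop p)), ← cancel_mono (μ G _ (loop p)),
    ← cancel_epi (_ ◁ (loopIso G p).hom)]
  simp only [Category.assoc, whiskerRight_δ_μ, δ_μ, Category.comp_id] at square ⊢
  rw [square]
  simp

end Intertwines

section PathMap

variable {C : Type u₁} [Category.{v₁} C] [MonoidalCategory C] [SymmetricCategory C]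
  [PartiallyTraced C] {D : Type u₂} [Category.{v₂} D] [MonoidalCategory D] [SymmetricCategory D]
  [PartiallyTraced D]

/-- A strong symmetric monoidal functor between partially traced categories is traced if it
preserves all traces that are defined. -/
def IsTraced (G : C ⥤ D) [G.Braided] : Prop :=
  ∀ ⦃A B U : C⦄ (f : A ⊗ U ⟶ B ⊗ U) (t : A ⟶ B), t ∈ PartiallyTraced.tr U f →
    G.map t ∈ PartiallyTraced.tr (G.obj U) (conj G f)

variable {G : C ⥤ D} [G.Braided]

lemma IsTraced.map_mem_comp (hG : IsTraced G) {A B : IntP C} {p : Quiver.Path A B} {f : A ⟶ B}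
    (h : f ∈ comp p) : (intMap G).map f ∈ comp ((intMap G).mapPath p) := by
  obtain ⟨t, ht, rfl⟩ := (Part.mem_map_iff _).1 h
  refine (Part.mem_map_iff _).2 ⟨conj G t, ?_, rfl⟩
  have conj_mem := PartiallyTraced.naturality _ (μ G A.pos B.neg) (δ G B.pos A.neg) _
    (Part.mem_map _ (hG _ _ ht))
  rwa [← loopIso_conj_sw_pre, ← tr_conj (loopIso G p)] at conj_mem

variable (G) in
/-- The image under `G` of an object of `Intᵖ(C)`. -/
abbrev mapObj (A : IntP C) : PathInt D := ⟨⟨G.obj A.pos, G.obj A.neg⟩⟩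

variable (G) in
/-- The comparison of the tensor product of `Intᵖ(D)` with the image of that of `Intᵖ(C)`. -/
def compareTensor (A B : IntP C) : mapObj G A ⊗ mapObj G B ≅ mapObj G (A.tensorObj B) :=
  PathInt.JIso (μIso G A.pos B.pos) (μIso G B.neg A.neg).symm

omit [PartiallyTraced C] in
lemma Intertwines.arrow_comp_compare {a b c d a' b' c' d' : C}
    {f : (a ⊗ b) ⊗ (c ⊗ d) ⟶ (a' ⊗ b') ⊗ (c' ⊗ d')}
    {g : (G.obj a ⊗ G.obj b) ⊗ (G.obj c ⊗ G.obj d) ⟶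
      (G.obj a' ⊗ G.obj b') ⊗ (G.obj c' ⊗ G.obj d')}
    (h : Intertwines G
      (extProd G (extProd G (𝟙 (G.obj a)) (𝟙 (G.obj b))) (extProd G (𝟙 (G.obj c)) (𝟙 (G.obj d))))
      (extProd G (extProd G (𝟙 _) (𝟙 _)) (extProd G (𝟙 _) (𝟙 _))) g f) :
    PathInt.arrow g ≫ PathInt.J (μ G a' b') (δ G c d) =
      PathInt.J (μ G a b) (δ G c' d') ≫ PathInt.arrow (conj G f) := by
  rw [PathInt.arrow_comp_J, PathInt.J_comp_arrow]
  refine congrArg PathInt.arrow ?_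
  simp only [Intertwines, extProd_id] at h
  simp only [extProd, MonoidalCategory.tensorHom_def', Category.assoc] at h
  rw [← cancel_epi (_ ◁ μ G c d), ← cancel_mono (_ ◁ μ G c' d'), ← cancel_mono (μ G _ _)]
  simp only [Category.assoc, conj, whiskerLeft_μ_δ_assoc, whiskerLeft_δ_μ_assoc, δ_μ,
    Category.comp_id]
  rw [← whisker_exchange_assoc, ← h]

lemma whiskerLeft_comp_compareTensor (X : IntP C) {A B : IntP C} (f : A ⟶ B) :
    mapObj G X ◁ PathInt.sing ((intMap G).map f) ≫ (compareTensor G X B).hom =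
      (compareTensor G X A).hom ≫ PathInt.sing ((intMap G).map ((tensorLeft X).map f)) := by
  have whisker_eq := PathInt.whiskerLeft_arrow (mapObj G X) (conj G f.hom)
  have map_eq : conj G ((tensorLeft X).map f).hom = conj G (IntP.inner f.hom X.pos X.neg) :=
    congrArg (conj G) (PathInt.hom_inner f X)
  exact (congrArg (· ≫ _) whisker_eq).trans
    ((intertwines_inner f.hom X.pos X.neg).arrow_comp_compare.trans
      (congrArg (fun t => _ ≫ PathInt.arrow t) map_eq.symm))

lemma whiskerRight_comp_compareTensor (X : IntP C) {A B : IntP C} (f : A ⟶ B) :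
    PathInt.sing ((intMap G).map f) ▷ mapObj G X ≫ (compareTensor G B X).hom =
      (compareTensor G A X).hom ≫ PathInt.sing ((intMap G).map ((tensorRight X).map f)) := by
  have whisker_eq := PathInt.whiskerRight_arrow (mapObj G X) (conj G f.hom)
  have map_eq : conj G ((tensorRight X).map f).hom = conj G (outer f.hom X.pos X.neg) :=
    congrArg (conj G) (PathInt.hom_outer f X)
  exact (congrArg (· ≫ _) whisker_eq).trans
    ((intertwines_outer f.hom X.pos X.neg).arrow_comp_compare.trans
      (congrArg (fun t => _ ≫ PathInt.arrow t) map_eq.symm))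

omit [PartiallyTraced C] in
lemma composePath_mapPath_intMap_comp_F {A B : IntP C} (p : Quiver.Path A B) :
    composePath ((intMap G ⋙q F D).mapPath p) =
      (Quot.mk _ ((intMap G).mapPath p) : mapObj G A ⟶ mapObj G B) := by
  induction p with
  | nil => rfl
  | cons p f ih =>
    rw [Prefunctor.mapPath_cons, composePath_cons, ih]
    rfl

lemma IsTraced.isCongruence (hG : IsTraced G) : IsCongruence (C := C) (fun _ _ p q =>
    composePath ((intMap G ⋙q F D).mapPath p) = composePath ((intMap G ⋙q F D).mapPath q)) :=
  isCongruence_composePath (intMap G ⋙q F D)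
    (fun h => (composePath_mapPath_intMap_comp_F _).trans
      (Quot.sound (isCongruence_sim.comp (hG.map_mem_comp h))))
    (fun X => MonoidalCategory.tensorLeft (mapObj G X))
    (fun X => MonoidalCategory.tensorRight (mapObj G X))
    (fun X A => (compareTensor G X A).symm) (fun X A => (compareTensor G A X).symm)
    (fun X _ _ f => (CommSq.horiz_inv ⟨(whiskerLeft_comp_compareTensor X f).symm⟩).w.symm)
    (fun X _ _ f => (CommSq.horiz_inv ⟨(whiskerRight_comp_compareTensor X f).symm⟩).w.symm)

/-- The functor `Path(Intᵖ(C))/∼ → Path(Intᵖ(D))/∼` induced by a traced functor. -/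
abbrev pathMap (hG : IsTraced G) : PathInt C ⥤ PathInt D := PathInt.lift hG.isCongruence

lemma pathMap_map_J (hG : IsTraced G) {a p b q : C} (u : a ⟶ b) (v : q ⟶ p) :
    (pathMap hG).map (PathInt.J u v) = PathInt.J (G.map u) (G.map v) :=
  (PathInt.lift_map_sing hG.isCongruence _).trans (congrArg PathInt.arrow (conj_tensorHom u v))

lemma J_comp_pathMap_map_J (hG : IsTraced G) {a p : D} {b q c r : C} (u : a ⟶ G.obj b)
    (v : G.obj q ⟶ p) (u' : b ⟶ c) (v' : r ⟶ q) :
    PathInt.J u v ≫ (pathMap hG).map (PathInt.J u' v') =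
      PathInt.J (u ≫ G.map u') (G.map v' ≫ v) :=
  (congrArg (PathInt.J u v ≫ ·) (pathMap_map_J hG u' v')).trans (PathInt.J_comp u v _ _)

variable (G) in
/-- The comparison of the unit of `Path(Intᵖ(D))/∼` with the image of that of `Path(Intᵖ(C))/∼`. -/
abbrev compareUnit : 𝟙_ (PathInt D) ≅ mapObj G ⟨𝟙_ C, 𝟙_ C⟩ :=
  PathInt.JIso (εIso G) (εIso G).symm

/-- The strong monoidal structure of `pathMap`. -/
abbrev pathMapCoreMonoidal (hG : IsTraced G) : (pathMap hG).CoreMonoidal where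
  εIso := compareUnit G
  μIso X Y := compareTensor G X.as Y.as
  μIso_hom_natural_left f Z := PathInt.naturality_of_sing
    (S := pathMap hG ⋙ MonoidalCategory.tensorRight ((pathMap hG).obj Z))
    (T := MonoidalCategory.tensorRight Z ⋙ pathMap hG)
    (fun X => (compareTensor G X.as Z.as).hom)
    (fun f => whiskerRight_comp_compareTensor Z.as f) f
  μIso_hom_natural_right Z f := PathInt.naturality_of_sing
    (S := pathMap hG ⋙ MonoidalCategory.tensorLeft ((pathMap hG).obj Z))
    (T := MonoidalCategory.tensorLeft Z ⋙ pathMap hG)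
    (fun X => (compareTensor G Z.as X.as).hom)
    (fun f => whiskerLeft_comp_compareTensor Z.as f) f
  associativity X Y Z := by
    change PathInt.J (μ G _ _) (δ G _ _) ▷ mapObj G Z.as ≫ PathInt.J (μ G _ _) (δ G _ _) ≫
      (pathMap hG).map (PathInt.J (α_ _ _ _).hom (α_ _ _ _).hom) =
      PathInt.J (α_ _ _ _).hom (α_ _ _ _).hom ≫ mapObj G X.as ◁ PathInt.J (μ G _ _) (δ G _ _) ≫
        PathInt.J (μ G _ _) (δ G _ _)
    rw [PathInt.whiskerRight_J, PathInt.whiskerLeft_J, J_comp_pathMap_map_J, PathInt.J_comp,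
      PathInt.J_comp]
    refine (PathInt.J_comp _ _ _ _).trans (congrArg₂ PathInt.J ?_ ?_)
    · exact Functor.LaxMonoidal.associativity _ _ _ _
    · simp only [Category.assoc]
      exact (Functor.OplaxMonoidal.associativity _ _ _ _).symm
  left_unitality X := by
    change PathInt.J (λ_ _).hom (ρ_ _).inv = PathInt.J (ε G) (η G) ▷ mapObj G X.as ≫
      PathInt.J (μ G _ _) (δ G _ _) ≫ (pathMap hG).map (PathInt.J (λ_ _).hom (ρ_ _).inv)
    rw [PathInt.whiskerRight_J, J_comp_pathMap_map_J]
    refine Eq.trans (congrArg₂ PathInt.J ?_ ?_) (PathInt.J_comp _ _ _ _).symm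
    · exact Functor.LaxMonoidal.left_unitality _ _
    · simp only [Category.assoc]
      exact Functor.OplaxMonoidal.right_unitality _ _
  right_unitality X := by
    change PathInt.J (ρ_ _).hom (λ_ _).inv = mapObj G X.as ◁ PathInt.J (ε G) (η G) ≫
      PathInt.J (μ G _ _) (δ G _ _) ≫ (pathMap hG).map (PathInt.J (ρ_ _).hom (λ_ _).inv)
    rw [PathInt.whiskerLeft_J, J_comp_pathMap_map_J]
    refine Eq.trans (congrArg₂ PathInt.J ?_ ?_) (PathInt.J_comp _ _ _ _).symm
    · exact Functor.LaxMonoidal.right_unitality _ _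
    · simp only [Category.assoc]
      exact Functor.OplaxMonoidal.left_unitality _ _

instance (hG : IsTraced G) : (pathMap hG).Monoidal := (pathMapCoreMonoidal hG).toMonoidal

instance (hG : IsTraced G) : (pathMap hG).Braided where
  braided X Y := by
    change PathInt.J (μ G _ _) (δ G _ _) ≫
      (pathMap hG).map (PathInt.J (β_ _ _).hom (β_ _ _).hom) =
      PathInt.J (β_ _ _).hom (β_ _ _).hom ≫ PathInt.J (μ G _ _) (δ G _ _)
    rw [J_comp_pathMap_map_J, PathInt.J_comp]
    congr 1
    · exact Functor.LaxBraided.braided _ _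
    · rw [← cancel_epi (μ G _ _), ← cancel_mono (μ G _ _)]
      simp

end PathMap

section Equivalence

variable {D : Type u} [Category.{v} D] [MonoidalCategory D] [SymmetricCategory D]
  [LeftRigidCategory D]

attribute [local instance] canonicalPartialTrace

instance : (embed D).EssSurj where
  mem_essImage X :=
    let _ : ExactPairing (PathInt.cobase X.as.neg) ((embed D).obj X.as.neg) :=
      PathInt.exactPairingCobaseBase X.as.neg
    ⟨X.as.pos ⊗ (ᘁX.as.neg : D), ⟨(μIso (embed D) _ _).symm ≪≫
      whiskerLeftIso (base X.as.pos) (transposeIso ((embed D).obj (ᘁX.as.neg : D))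
        (PathInt.cobase X.as.neg) (Iso.refl ((embed D).obj X.as.neg))) ≪≫
      PathInt.decomp X.as.pos X.as.neg⟩⟩

instance : (embed D).IsEquivalence where

end Equivalence

section Inverse

variable {E : Type u₁} [Category.{v₁} E] [MonoidalCategory E]
  [SymmetricCategory E] {E' : Type u₂} [Category.{v₂} E'] [MonoidalCategory E']
  [SymmetricCategory E']

lemma exists_braided_inverse (H : E ⥤ E') [H.Braided] [H.IsEquivalence] :
    ∃ (K : E' ⥤ E) (_ : K.Braided) (u : H ⋙ K ≅ 𝟭 E), NatTrans.IsMonoidal u.hom := by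
  let e := H.asEquivalence
  let _ : e.functor.Braided := ‹H.Braided›
  let _ : e.inverse.Monoidal := e.inverseMonoidal
  have : e.IsMonoidal := { leftAdjoint_ε := rfl, leftAdjoint_μ := fun _ _ => rfl }
  have braided X Y : μ e.inverse X Y ≫ e.inverse.map (β_ X Y).hom =
      (β_ (e.inverse.obj X) (e.inverse.obj Y)).hom ≫ μ e.inverse Y X := by
    have counit_natural := e.counitIso.hom.naturality (β_ X Y).hom
    have functor_braided :=
      Functor.LaxBraided.braided (F := e.functor) (e.inverse.obj X) (e.inverse.obj Y)
    rw [Functor.id_map, Functor.comp_map] at counit_natural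
    apply e.functor.map_injective
    rw [← cancel_mono (e.counitIso.hom.app _), ← cancel_epi (μ e.functor _ _)]
    simp only [Functor.map_comp, Category.assoc]
    rw [counit_natural, e.functor_map_μ_inverse_comp_counitIso_hom_app_tensor_assoc,
      e.functor_map_μ_inverse_comp_counitIso_hom_app_tensor,
      BraidedCategory.braiding_naturality, reassoc_of% functor_braided]
    simp
  exact ⟨e.inverse, { braided }, e.unitIso.symm,
    inferInstanceAs (NatTrans.IsMonoidal e.unitIso.inv)⟩

end Inverse

section Existence

variable {C : Type u₁} [Category.{v₁} C] [MonoidalCategory C] [SymmetricCategory C]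
  [PartiallyTraced C] {D : Type u₂} [Category.{v₂} D] [MonoidalCategory D] [SymmetricCategory D]
  {G : C ⥤ D} [G.Braided]

/-- The functor `pathMap` extends `G`. -/
def embedPathMap [PartiallyTraced D] (hG : IsTraced G) : embed C ⋙ pathMap hG ≅ G ⋙ embed D :=
  NatIso.ofComponents (fun A => (PathInt.JIso (Iso.refl (G.obj A)) (εIso G) :
    mapObj G ⟨A, 𝟙_ C⟩ ≅ base (G.obj A))) fun {A B} f => by
      change (pathMap hG).map (PathInt.J f (𝟙 (𝟙_ C))) ≫ PathInt.J (𝟙 _) (ε G) =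
        PathInt.J (𝟙 _) (ε G) ≫ PathInt.J (G.map f) (𝟙 _)
      rw [pathMap_map_J]
      refine (PathInt.J_comp _ _ _ _).trans (Eq.trans ?_ (PathInt.J_comp _ _ _ _).symm)
      simp

instance [PartiallyTraced D] (hG : IsTraced G) : NatTrans.IsMonoidal (embedPathMap hG).hom where
  unit := by
    change ((PathInt.J (ε G) (η G)) ≫ (pathMap hG).map (𝟙 (𝟙_ (PathInt C)))) ≫
      PathInt.J (𝟙 _) (ε G) = 𝟙 (𝟙_ (PathInt D)) ≫ PathInt.J (ε G) (𝟙 _)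
    rw [(pathMap hG).map_id, Category.id_comp]
    refine (congrArg (· ≫ _) (Category.comp_id _)).trans ((PathInt.J_comp _ _ _ _).trans
      (congrArg₂ PathInt.J (Category.comp_id _) (ε_η G)))
  tensor X Y := by
    change (PathInt.J (μ G X Y) (δ G _ _) ≫ (pathMap hG).map (PathInt.J (𝟙 _) (λ_ (𝟙_ C)).inv)) ≫
      PathInt.J (𝟙 _) (ε G) = (PathInt.J (𝟙 _) (ε G) ▷ mapObj G ⟨Y, 𝟙_ C⟩ ≫
        base (G.obj X) ◁ PathInt.J (𝟙 _) (ε G)) ≫ PathInt.J (𝟙 _) (λ_ (𝟙_ D)).inv ≫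
          PathInt.J (μ G X Y) (𝟙 _)
    rw [J_comp_pathMap_map_J, PathInt.whiskerRight_J, PathInt.whiskerLeft_J, PathInt.J_comp]
    refine (PathInt.J_comp _ _ _ _).trans (Eq.trans ?_
      ((congrArg (_ ≫ ·) (PathInt.J_comp _ _ _ _)).trans (PathInt.J_comp _ _ _ _)).symm)
    congr 1
    · simp
    · rw [← cancel_mono (μ G _ _)]
      simp only [Category.assoc, δ_μ, Category.comp_id, Category.id_comp,
        ← Functor.LaxMonoidal.left_unitality_inv]
      rw [leftUnitor_inv_naturality_assoc, whisker_exchange_assoc]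

variable [LeftRigidCategory D]

attribute [local instance] canonicalPartialTrace

lemma PreservesTrace.isTraced (hG : PreservesTrace G) : IsTraced G :=
  fun _ _ _ f t ht => Part.mem_some_iff.2 (hG f t ht).symm

lemma PreservesTrace.exists_extension (hG : PreservesTrace G) :
    ∃ (L : PathInt C ⥤ D) (_ : L.Braided) (φ : embed C ⋙ L ≅ G), NatTrans.IsMonoidal φ.hom := by
  obtain ⟨K, _, u, hu⟩ := exists_braided_inverse (embed D)
  refine ⟨pathMap hG.isTraced ⋙ K, inferInstance, (Functor.associator _ _ _).symm ≪≫
    Functor.isoWhiskerRight (embedPathMap hG.isTraced) K ≪≫ Functor.associator _ _ _ ≪≫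
    Functor.isoWhiskerLeft G u ≪≫ Functor.rightUnitor G, ?_⟩
  dsimp only [Iso.trans_hom, Iso.symm_hom, Functor.isoWhiskerRight_hom, Functor.isoWhiskerLeft_hom]
  infer_instance

end Existence

section RespectsTensor

variable {B : Type u₁} [Category.{v₁} B] [MonoidalCategory B] [SymmetricCategory B]
  {D : Type u₂} [Category.{v₂} D] [MonoidalCategory D] [SymmetricCategory D]
  {L L' : B ⥤ D} [L.Braided] [L'.Braided]

/-- The natural transformation `θ` satisfies the tensor law of a monoidal transformation at the
pair of objects `X`, `Y`. -/
def RespectsTensor (θ : L ⟶ L') (X Y : B) : Prop :=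
  μ L X Y ≫ θ.app (X ⊗ Y) = extProd L' (θ.app X) (θ.app Y)

namespace RespectsTensor

variable {θ : L ⟶ L'} {X Y Z X' Y' : B}

lemma of_iso (h : RespectsTensor θ X Y) (e : X ≅ X') (f : Y ≅ Y') : RespectsTensor θ X' Y' := by
  have extProd_naturality : (L.map e.hom ⊗ₘ L.map f.hom) ≫ extProd L' (θ.app X') (θ.app Y') =
      extProd L' (θ.app X) (θ.app Y) ≫ L'.map (e.hom ⊗ₘ f.hom) := by
    rw [extProd, extProd, Category.assoc, ← μ_natural,
      MonoidalCategory.tensorHom_comp_tensorHom_assoc,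
      MonoidalCategory.tensorHom_comp_tensorHom_assoc, θ.naturality, θ.naturality]
  rw [RespectsTensor, ← cancel_epi (L.map e.hom ⊗ₘ L.map f.hom), extProd_naturality, ← h,
    μ_natural_assoc, θ.naturality, Category.assoc]

lemma symm (h : RespectsTensor θ X Y) : RespectsTensor θ Y X := by
  rw [RespectsTensor, ← cancel_epi (β_ (L.obj X) (L.obj Y)).hom,
    ← intertwines_braiding (G := L') (θ.app X) (θ.app Y), ← h,
    ← Functor.LaxBraided.braided_assoc, θ.naturality, Category.assoc]

lemma tensor_right (h : RespectsTensor θ X Y) (h' : RespectsTensor θ (X ⊗ Y) Z)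
    (h'' : RespectsTensor θ Y Z) : RespectsTensor θ X (Y ⊗ Z) := by
  have left_assoc : extProd L' (extProd L' (θ.app X) (θ.app Y)) (θ.app Z) =
      μ L X Y ▷ L.obj Z ≫ extProd L' (θ.app (X ⊗ Y)) (θ.app Z) := by
    rw [← h, extProd, extProd, ← tensorHom_id, MonoidalCategory.tensorHom_comp_tensorHom_assoc,
      Category.id_comp]
  have right_assoc : extProd L' (θ.app X) (extProd L' (θ.app Y) (θ.app Z)) =
      L.obj X ◁ μ L Y Z ≫ extProd L' (θ.app X) (θ.app (Y ⊗ Z)) := by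
    rw [← h'', extProd, extProd, ← id_tensorHom, MonoidalCategory.tensorHom_comp_tensorHom_assoc,
      Category.id_comp]
  have square := intertwines_associator (G := L') (θ.app X) (θ.app Y) (θ.app Z)
  rwa [Intertwines, left_assoc, right_assoc, ← h', Category.assoc, Category.assoc, ← θ.naturality,
    Functor.LaxMonoidal.associativity_assoc, cancel_epi, cancel_epi] at square

lemma tensor_left (h : RespectsTensor θ Y Z) (h' : RespectsTensor θ X (Y ⊗ Z))
    (h'' : RespectsTensor θ X Y) : RespectsTensor θ (X ⊗ Y) Z :=
  (h.symm.tensor_right (h'.symm.of_iso (β_ _ _) (Iso.refl _)) h''.symm).symm.of_iso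
    (β_ _ _) (Iso.refl _)

end RespectsTensor

end RespectsTensor

section UnitComponent

variable {B : Type u₁} [Category.{v₁} B] [MonoidalCategory B]
  {D : Type u₂} [Category.{v₂} D] [MonoidalCategory D]
  {L L' : B ⥤ D} [L.Monoidal] [L'.Monoidal] {t : L.obj (𝟙_ B) ⟶ L'.obj (𝟙_ B)}

lemma tensorHom_μ_map_rightUnitor {X : B} (s : L.obj X ⟶ L'.obj X) (ht : ε L ≫ t = ε L') :
    (s ⊗ₘ t) ≫ μ L' X (𝟙_ B) ≫ L'.map (ρ_ X).hom = μ L X (𝟙_ B) ≫ L.map (ρ_ X).hom ≫ s := by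
  rw [← cancel_epi (L.obj X ◁ ε L), ← id_tensorHom,
    MonoidalCategory.tensorHom_comp_tensorHom_assoc, ht, Category.id_comp, id_tensorHom,
    ← Functor.LaxMonoidal.right_unitality_assoc, ← rightUnitor_naturality,
    Functor.LaxMonoidal.right_unitality, MonoidalCategory.tensorHom_def, Category.assoc]

lemma tensorHom_μ_map_leftUnitor {X : B} (s : L.obj X ⟶ L'.obj X) (ht : ε L ≫ t = ε L') :
    (t ⊗ₘ s) ≫ μ L' (𝟙_ B) X ≫ L'.map (λ_ X).hom = μ L (𝟙_ B) X ≫ L.map (λ_ X).hom ≫ s := by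
  rw [← cancel_epi (ε L ▷ L.obj X), ← tensorHom_id,
    MonoidalCategory.tensorHom_comp_tensorHom_assoc, ht, Category.id_comp, tensorHom_id,
    ← Functor.LaxMonoidal.left_unitality_assoc, ← leftUnitor_naturality,
    Functor.LaxMonoidal.left_unitality, tensorHom_def', Category.assoc]

lemma isPairingHom_of_unit_pairing [ExactPairing (𝟙_ B) (𝟙_ B)]
    (coevaluation_eq : η_ (𝟙_ B) (𝟙_ B) = (λ_ (𝟙_ B)).inv)
    (evaluation_eq : ε_ (𝟙_ B) (𝟙_ B) = (λ_ (𝟙_ B)).hom) (ht : ε L ≫ t = ε L') :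
    IsPairingHom t t where
  unit := by
    rw [coevaluation_map, coevaluation_map, coevaluation_eq,
      ← cancel_mono (μ L' (𝟙_ B) (𝟙_ B) ≫ L'.map (λ_ (𝟙_ B)).hom)]
    simp only [Category.assoc]
    rw [tensorHom_μ_map_leftUnitor t ht, δ_μ_assoc, δ_μ_assoc, ← L.map_comp_assoc, ← L'.map_comp,
      Iso.inv_hom_id, L.map_id, L'.map_id, Category.id_comp, Category.comp_id, ht]
  counit := by
    have η_eq : t ≫ Functor.OplaxMonoidal.η L' = Functor.OplaxMonoidal.η L := by
      rw [← cancel_epi (ε L), reassoc_of% ht, ε_η, ε_η]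
    rw [evaluation_map, evaluation_map, evaluation_eq,
      reassoc_of% tensorHom_μ_map_leftUnitor t ht, η_eq]

end UnitComponent

section TensorPairing

variable {D : Type u} [Category.{v} D] [MonoidalCategory D] (U U' V V' : D) [ExactPairing U' U]
  [ExactPairing V' V]

lemma coevaluation_tensor : η_ (V' ⊗ U') (U ⊗ V) =
    η_ V' V ≫ V' ◁ ((λ_ V).inv ≫ η_ U' U ▷ V ≫ (α_ U' U V).hom) ≫ (α_ V' U' (U ⊗ V)).inv := by
  rw [ExactPairing.tensor_coevaluation]
  monoidal

lemma evaluation_tensor : ε_ (V' ⊗ U') (U ⊗ V) =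
    (α_ U V (V' ⊗ U')).hom ≫ U ◁ ((α_ V V' U').inv ≫ ε_ V' V ▷ U' ≫ (λ_ U').hom) ≫ ε_ U' U := by
  rw [ExactPairing.tensor_evaluation]
  monoidal

end TensorPairing

section MapPairing

variable {B : Type u₁} [Category.{v₁} B] [MonoidalCategory B]
  {D : Type u₂} [Category.{v₂} D] [MonoidalCategory D]
  {L L' : B ⥤ D} [L.Monoidal] [L'.Monoidal]

lemma isPairingHom_μ (L : B ⥤ D) [L.Monoidal] (U U' V V' : B) [ExactPairing U' U]
    [ExactPairing V' V] : IsPairingHom (μ L U V) (μ L V' U') where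
  unit := by
    have whiskerLeft_whiskerLeft_δ_μ : L.obj V' ◁ L.obj U' ◁ δ L U V ≫
        L.obj V' ◁ L.obj U' ◁ μ L U V = 𝟙 _ := by
      simp only [← MonoidalCategory.whiskerLeft_comp, δ_μ, MonoidalCategory.whiskerLeft_id]
    rw [coevaluation_map, coevaluation_tensor, coevaluation_tensor, coevaluation_map,
      coevaluation_map, tensorHom_def', ← cancel_mono (μ L (V' ⊗ U') (U ⊗ V)),
      ← cancel_mono (L.map (α_ V' U' (U ⊗ V)).hom)]
    simp [reassoc_of% whiskerLeft_whiskerLeft_δ_μ]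
  counit := by
    have whiskerLeft_associativity :=
      congr(L.obj U ◁ $(Functor.LaxMonoidal.associativity_inv L V V' U') ≫ μ L U _)
    simp only [MonoidalCategory.whiskerLeft_comp, Category.assoc, μ_natural_right]
      at whiskerLeft_associativity
    rw [evaluation_map, evaluation_tensor, evaluation_tensor, evaluation_map, evaluation_map,
      tensorHom_def']
    simp [reassoc_of% whiskerLeft_associativity]

lemma isPairingHom_app {U U' : B} [ExactPairing U' U] (θ : L ⟶ L') [NatTrans.IsMonoidal θ] :
    IsPairingHom (θ.app U) (θ.app U') where
  unit := by
    rw [coevaluation_map, coevaluation_map, ← cancel_mono (μ L' U' U)]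
    simp only [Category.assoc, δ_μ, Category.comp_id]
    rw [← NatTrans.IsMonoidal.tensor, δ_μ_assoc, θ.naturality, NatTrans.IsMonoidal.unit_assoc]
  counit := by
    rw [evaluation_map, evaluation_map, ← NatTrans.IsMonoidal.tensor_assoc, ← θ.naturality_assoc,
      ← cancel_mono (ε L')]
    simp only [Category.assoc, η_ε, Category.comp_id]
    rw [← NatTrans.IsMonoidal.unit (τ := θ), η_ε_assoc]

end MapPairing

section Uniqueness

open PathInt

variable {C : Type u₁} [Category.{v₁} C] [MonoidalCategory C] [SymmetricCategory C]
  [PartiallyTraced C]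
  {D : Type u₂} [Category.{v₂} D] [MonoidalCategory D] [SymmetricCategory D]

namespace PathInt

lemma coevaluation_base_unit :
    η_ (cobase (𝟙_ C)) (base (𝟙_ C)) = (λ_ (𝟙_ (PathInt C))).inv := by
  have baseUnit_unit : baseUnit (𝟙_ C) = (λ_ (𝟙_ (PathInt C))).inv := by
    refine congrArg arrow (?_ : (λ_ _).hom ≫ (ρ_ _).inv = (λ_ _).inv ⊗ₘ (ρ_ _).hom)
    monoidal
  have braided : baseUnit (𝟙_ C) ≫ (β_ (𝟙_ (PathInt C)) (𝟙_ (PathInt C))).hom =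
      (λ_ (𝟙_ (PathInt C))).inv := by
    rw [baseUnit_unit, leftUnitor_inv_braiding, unitors_inv_equal]
  exact braided

lemma evaluation_base_unit :
    ε_ (cobase (𝟙_ C)) (base (𝟙_ C)) = (λ_ (𝟙_ (PathInt C))).hom := by
  refine congrArg arrow (?_ : (ρ_ _).hom ≫ (λ_ _).inv = (λ_ _).hom ⊗ₘ (ρ_ _).inv)
  monoidal

lemma decomp_unit_right (a : C) : (decomp a (𝟙_ C)).hom = (ρ_ (base a)).hom :=
  congrArg (J (ρ_ a).hom) (unitors_inv_equal (C := C)).symm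

lemma decomp_unit_left (p : C) : (decomp (𝟙_ C) p).hom = (λ_ (cobase p)).hom :=
  congrArg (fun t => J t (ρ_ p).inv) (unitors_equal (C := C)).symm

lemma J_comp_baseMu {a q b x : C} (u : a ⊗ q ⟶ b ⊗ x) :
    (J u (𝟙 (𝟙_ C ⊗ 𝟙_ C)) : base a ⊗ base q ⟶ base b ⊗ base x) ≫ (baseMu b x).hom =
      (baseMu a q).hom ≫ baseMap u := by
  change J u (𝟙 _) ≫ J (𝟙 _) _ = J (𝟙 _) _ ≫ J u (𝟙 _)
  rw [J_comp, J_comp]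
  simp

/-- The comparison `(I, p) ⊗ (I, q) ≅ (I, q ⊗ p)`, defined as the dual of the comparison
`(q, I) ⊗ (p, I) ≅ (q ⊗ p, I)`. -/
def cobaseMu (p q : C) : cobase p ⊗ cobase q ≅ cobase (q ⊗ p) :=
  transposeIso (cobase p ⊗ cobase q) (cobase (q ⊗ p)) (baseMu q p)

lemma isPairingHom_baseMu (p q : C) : IsPairingHom (baseMu q p).hom (cobaseMu p q).hom :=
  isPairingHom_transpose _

end PathInt

variable {L L' : PathInt C ⥤ D} (ψ : embed C ⋙ L ≅ embed C ⋙ L') [L.Braided] [L'.Braided]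

/-- The component of `ψ` at `a`, as an isomorphism between the images of `(a, I)`. -/
abbrev baseApp (a : C) : L.obj (base a) ≅ L'.obj (base a) := ψ.app a

/-- The isomorphism between the images of `(I, p)` dual to the component of `ψ` at `p`. -/
def cobaseApp (p : C) : L.obj (cobase p) ≅ L'.obj (cobase p) :=
  transposeIso (L.obj (cobase p)) (L'.obj (cobase p)) (baseApp ψ p)

/-- The component at `X` of the extension of `ψ`, determined by the decomposition of `X` as
`(a, I) ⊗ (I, x)`. -/
def extendApp (X : PathInt C) : L.obj X ≅ L'.obj X :=
  (L.mapIso (decomp X.as.pos X.as.neg)).symm ≪≫ (μIso L _ _).symm ≪≫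
    (baseApp ψ X.as.pos ⊗ᵢ cobaseApp ψ X.as.neg) ≪≫ μIso L' _ _ ≪≫
    L'.mapIso (decomp X.as.pos X.as.neg)

lemma isPairingHom_baseApp (p : C) : IsPairingHom (baseApp ψ p).hom (cobaseApp ψ p).hom :=
  isPairingHom_transpose _

lemma μ_map_decomp_extendApp (a x : C) : μ L (base a) (cobase x) ≫ L.map (decomp a x).hom ≫
      (extendApp ψ ⟨⟨a, x⟩⟩).hom =
    ((baseApp ψ a).hom ⊗ₘ (cobaseApp ψ x).hom) ≫ μ L' (base a) (cobase x) ≫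
      L'.map (decomp a x).hom := by
  change _ ≫ _ ≫ L.map (decomp a x).inv ≫ δ L _ _ ≫ _ = _
  rw [← L.map_comp_assoc, Iso.hom_inv_id, L.map_id, Category.id_comp, μ_δ_assoc]
  rfl

variable [NatTrans.IsMonoidal ψ.hom]

lemma baseApp_tensor (a b : C) : ((baseApp ψ a).hom ⊗ₘ (baseApp ψ b).hom) ≫
      μ L' (base a) (base b) ≫ L'.map (baseMu a b).hom =
    μ L (base a) (base b) ≫ L.map (baseMu a b).hom ≫ (baseApp ψ (a ⊗ b)).hom := by
  have tensor := NatTrans.IsMonoidal.tensor (τ := ψ.hom) a b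
  rw [Functor.LaxMonoidal.comp_μ, Functor.LaxMonoidal.comp_μ, Category.assoc] at tensor
  exact tensor.symm

lemma baseApp_unit : ε L ≫ (baseApp ψ (𝟙_ C)).hom = ε L' := by
  have unit := NatTrans.IsMonoidal.unit (τ := ψ.hom)
  have map_ε : L.map (ε (embed C)) = 𝟙 _ := L.map_id _
  have map_ε' : L'.map (ε (embed C)) = 𝟙 _ := L'.map_id _
  rw [Functor.LaxMonoidal.comp_ε, Functor.LaxMonoidal.comp_ε, map_ε, map_ε'] at unit
  refine Eq.trans ?_ (unit.trans (Category.comp_id _))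
  exact congrArg (· ≫ _) (Category.comp_id _).symm

lemma baseApp_tensorHom_conj {a q b x : C} {u : a ⊗ q ⟶ b ⊗ x}
    {v : base a ⊗ base q ⟶ base b ⊗ base x}
    (hv : v ≫ (baseMu b x).hom = (baseMu a q).hom ≫ baseMap u) :
    ((baseApp ψ a).hom ⊗ₘ (baseApp ψ q).hom) ≫ μ L' (base a) (base q) ≫
      L'.map v ≫ δ L' (base b) (base x) =
    (μ L (base a) (base q) ≫ L.map v ≫ δ L (base b) (base x)) ≫
      ((baseApp ψ b).hom ⊗ₘ (baseApp ψ x).hom) := by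
  have naturality : L.map (baseMap u) ≫ (baseApp ψ (b ⊗ x)).hom =
      (baseApp ψ (a ⊗ q)).hom ≫ L'.map (baseMap u) := ψ.hom.naturality u
  rw [← cancel_mono (μ L' (base b) (base x)), ← cancel_mono (L'.map (baseMu b x).hom)]
  simp only [Category.assoc]
  rw [baseApp_tensor ψ b x, δ_μ_assoc, δ_μ_assoc, ← L'.map_comp, ← L.map_comp_assoc, hv,
    L.map_comp, L'.map_comp, reassoc_of% baseApp_tensor ψ a q, ← naturality, Category.assoc]

lemma extendApp_naturality_arrow {a x b q : C} (u : a ⊗ q ⟶ b ⊗ x) :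
    L.map (arrow u) ≫ (extendApp ψ ⟨⟨b, q⟩⟩).hom =
      (extendApp ψ ⟨⟨a, x⟩⟩).hom ≫ L'.map (arrow u) := by
  have mate_square := mate_naturality _ _ (isPairingHom_baseApp ψ x) (isPairingHom_baseApp ψ q) _ _
    (baseApp_tensorHom_conj ψ (J_comp_baseMu u))
  have map_mate := mate_map L (cobase x) (cobase q) (a := base x) (b := base q) (A := base a)
    (B := base b) (J u (𝟙 (𝟙_ C ⊗ 𝟙_ C)))
  have map_mate' := mate_map L' (cobase x) (cobase q) (a := base x) (b := base q) (A := base a)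
    (B := base b) (J u (𝟙 (𝟙_ C ⊗ 𝟙_ C)))
  rw [← cancel_epi (L.map (decomp a x).hom), ← cancel_epi (μ L (base a) (cobase x)),
    reassoc_of% μ_map_decomp_extendApp ψ a x, ← L'.map_comp, ← L.map_comp_assoc, decomp_comp_arrow,
    L.map_comp, L'.map_comp, ← reassoc_of% map_mate', reassoc_of% mate_square, Category.assoc,
    ← reassoc_of% map_mate, μ_map_decomp_extendApp ψ b q]

/-- The extension of a monoidal isomorphism between the restrictions of `L` and `L'` to `C`, as a
natural isomorphism. -/
def extendIso : L ≅ L' :=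
  NatIso.ofComponents (extendApp ψ) (fun f => naturality_of_sing (fun X => (extendApp ψ X).hom)
    (fun g => extendApp_naturality_arrow ψ g.hom) f)

lemma cobaseApp_unit : (cobaseApp ψ (𝟙_ C)).hom = (baseApp ψ (𝟙_ C)).hom :=
  (isPairingHom_baseApp ψ (𝟙_ C)).unique
    (@isPairingHom_of_unit_pairing _ _ _ _ _ _ _ _ _ _ _ (exactPairingCobaseBase (𝟙_ C))
      coevaluation_base_unit evaluation_base_unit (baseApp_unit ψ))

lemma extendIso_app_base (a : C) : (extendIso ψ).hom.app (base a) = (baseApp ψ a).hom := by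
  have decomposed := μ_map_decomp_extendApp ψ a (𝟙_ C)
  rw [decomp_unit_right, cobaseApp_unit] at decomposed
  exact (cancel_epi _).1 ((cancel_epi _).1
    (decomposed.trans (tensorHom_μ_map_rightUnitor (baseApp ψ a).hom (baseApp_unit ψ))))

lemma extendIso_app_cobase (p : C) :
    (extendIso ψ).hom.app (cobase p) = (cobaseApp ψ p).hom := by
  have decomposed := μ_map_decomp_extendApp ψ (𝟙_ C) p
  rw [decomp_unit_left] at decomposed
  exact (cancel_epi _).1 ((cancel_epi _).1
    (decomposed.trans (tensorHom_μ_map_leftUnitor (cobaseApp ψ p).hom (baseApp_unit ψ))))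

lemma respectsTensor_base_base (a b : C) :
    RespectsTensor (extendIso ψ).hom (base a) (base b) := by
  have naturality := (extendIso ψ).hom.naturality (baseMu a b).hom
  rw [extendIso_app_base] at naturality
  rw [RespectsTensor, extProd, ← cancel_mono (L'.map (baseMu a b).hom), extendIso_app_base,
    extendIso_app_base, Category.assoc, Category.assoc, baseApp_tensor, naturality]

lemma respectsTensor_base_cobase (a p : C) :
    RespectsTensor (extendIso ψ).hom (base a) (cobase p) := by
  rw [RespectsTensor, extProd, ← cancel_mono (L'.map (decomp a p).hom), extendIso_app_base,
    extendIso_app_cobase, Category.assoc, Category.assoc, ← μ_map_decomp_extendApp ψ a p,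
    ← (extendIso ψ).hom.naturality (decomp a p).hom]
  rfl

lemma respectsTensor_cobase_cobase (p q : C) :
    RespectsTensor (extendIso ψ).hom (cobase p) (cobase q) := by
  have via_L := ((isPairingHom_μ L (base q) (cobase q) (base p) (cobase p)).comp
    ((isPairingHom_baseMu p q).map L)).comp (isPairingHom_baseApp ψ (q ⊗ p))
  have via_L' := (((isPairingHom_baseApp ψ q).tensor (isPairingHom_baseApp ψ p)).comp
    (isPairingHom_μ L' (base q) (cobase q) (base p) (cobase p))).comp
      ((isPairingHom_baseMu p q).map L')
  rw [Category.assoc, baseApp_tensor, ← Category.assoc] at via_L'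
  have naturality := (extendIso ψ).hom.naturality (cobaseMu p q).hom
  rw [extendIso_app_cobase] at naturality
  rw [RespectsTensor, extProd, ← cancel_mono (L'.map (cobaseMu p q).hom), extendIso_app_cobase,
    extendIso_app_cobase, ← via_L.unique via_L', Category.assoc, Category.assoc, naturality]

lemma respectsTensor_base (a : C) (Y : PathInt C) :
    RespectsTensor (extendIso ψ).hom (base a) Y :=
  ((respectsTensor_base_base ψ a Y.as.pos).tensor_right
    ((respectsTensor_base_cobase ψ (a ⊗ Y.as.pos) Y.as.neg).of_iso (baseMu _ _).symm (Iso.refl _))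
    (respectsTensor_base_cobase ψ _ _)).of_iso (Iso.refl _) (decomp Y.as.pos Y.as.neg)

lemma respectsTensor_cobase (p : C) (Y : PathInt C) :
    RespectsTensor (extendIso ψ).hom (cobase p) Y :=
  ((respectsTensor_cobase_cobase ψ p Y.as.neg).tensor_right
    ((respectsTensor_base_cobase ψ Y.as.pos (Y.as.neg ⊗ p)).symm.of_iso (cobaseMu _ _).symm
      (Iso.refl _))
    (respectsTensor_base_cobase ψ _ _).symm).of_iso (Iso.refl _)
      (β_ _ _ ≪≫ decomp Y.as.pos Y.as.neg)

instance : NatTrans.IsMonoidal (extendIso ψ).hom where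
  unit := (congrArg (ε L ≫ ·) (extendIso_app_base ψ (𝟙_ C))).trans (baseApp_unit ψ)
  tensor X Y := ((respectsTensor_cobase ψ X.as.neg Y).tensor_left
    (respectsTensor_base ψ X.as.pos _) (respectsTensor_base_cobase ψ _ _)).of_iso
      (decomp X.as.pos X.as.neg) (Iso.refl _)

lemma whiskerLeft_extendIso : Functor.whiskerLeft (embed C) (extendIso ψ).hom = ψ.hom :=
  NatTrans.ext (funext (extendIso_app_base ψ))

lemma eq_extendIso (θ : L ≅ L') [NatTrans.IsMonoidal θ.hom]
    (h : Functor.whiskerLeft (embed C) θ.hom = ψ.hom) : θ = extendIso ψ := by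
  have app_base (a : C) : θ.hom.app (base a) = (baseApp ψ a).hom := NatTrans.congr_app h a
  have app_cobase (p : C) : θ.hom.app (cobase p) = (cobaseApp ψ p).hom :=
    (app_base p ▸ isPairingHom_app θ.hom (U := base p) (U' := cobase p)).unique
      (isPairingHom_baseApp ψ p)
  ext X
  have tensor := NatTrans.IsMonoidal.tensor (τ := θ.hom) (base X.as.pos) (cobase X.as.neg)
  have decomposed := μ_map_decomp_extendApp ψ X.as.pos X.as.neg
  rw [app_base, app_cobase] at tensor
  rw [← reassoc_of% tensor, ← θ.hom.naturality, cancel_epi, cancel_epi] at decomposed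
  exact decomposed.symm

theorem existsUnique_monoidal_extension : ∃! θ : L ≅ L', NatTrans.IsMonoidal θ.hom ∧
    Functor.whiskerLeft (embed C) θ.hom = ψ.hom :=
  ⟨extendIso ψ, ⟨inferInstance, whiskerLeft_extendIso ψ⟩, fun θ ⟨_, h⟩ => eq_extendIso ψ θ h⟩

end Uniqueness

end PartialTrace

theorem mainTheorem10 {C : Type u₁} [Category.{v₁} C] [MonoidalCategory C] [SymmetricCategory C]
    [PartialTrace.PartiallyTraced C]
    {D : Type u₂} [Category.{v₂} D] [MonoidalCategory D] [SymmetricCategory D]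
    [LeftRigidCategory D]
    (G : C ⥤ D) [G.Braided] (hG : PartialTrace.PreservesTrace G) :
    (∃ (L : PartialTrace.PathInt C ⥤ D) (_ : L.Braided) (φ : PartialTrace.embed C ⋙ L ≅ G),
      NatTrans.IsMonoidal φ.hom) ∧
    ∀ (L L' : PartialTrace.PathInt C ⥤ D) [L.Braided] [L'.Braided]
      (φ : PartialTrace.embed C ⋙ L ≅ G) (φ' : PartialTrace.embed C ⋙ L' ≅ G),
      NatTrans.IsMonoidal φ.hom → NatTrans.IsMonoidal φ'.hom →
      ∃! θ : L ≅ L', NatTrans.IsMonoidal θ.hom ∧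
        Functor.whiskerLeft (PartialTrace.embed C) θ.hom ≫ φ'.hom = φ.hom := by
  refine ⟨hG.exists_extension, fun L L' _ _ φ φ' hφ hφ' => ?_⟩
  have : NatTrans.IsMonoidal (φ ≪≫ φ'.symm).hom :=
    inferInstanceAs (NatTrans.IsMonoidal (φ.hom ≫ φ'.inv))
  simpa only [Iso.trans_hom, Iso.symm_hom, Iso.eq_comp_inv] using
    PartialTrace.existsUnique_monoidal_extension (φ ≪≫ φ'.symm)
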